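/- Let $G:\mathbb{R}\to[0,\infty)$ be continuous and coercive, and suppose there are $p_m<p_M<0$ with $G(0)=0\le G(p_m)=m<G(p_M)=M$ such that $G$ is strictly decreasing on $(-\infty,p_m]$, strictly increasing on $[p_m,p_M]$, strictly decreasing on $[p_M,0]$ and strictly increasing on $[0,\infty)$. Let $\beta>0$ with $\max\{\beta,M\}<m+\beta$. Let $\mu_1,\mu_2$ be Borel probability measures on $[0,1]$ such that, for some $c\in(0,1)$, $$0\in\operatorname{supp}\mu_1\subset[0,c),\qquad 1\in\operatorname{supp}\mu_2\subset(c,1].\tag{1}$$ Let $\mathbb{Q}$ be the law on $[0,1]^{\mathbb{Z}}$ of two independent interlaced bi-infinite i.i.d. sequences with common distributions $\mu_1$ and $\mu_2$, where a fair coin decides which of the two is used at index $0$ (the stationary Markov chain that jumps from $\operatorname{supp}\mu_1$ to a $\mu_2$-distributed point and from $\operatorname{supp}\mu_2$ to a $\mu_1$-distributed point). On $\Omega=[0,1)\times[0,1]^{\mathbb{Z}}$ with $\mathbb{P}=\text{Lebesgue}\times\mathbb{Q}$ and $\omega=(w,(v_i)_{i\in\mathbb{Z}})$, let $V(\cdot,\omega)$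 be the piecewise-linear function $$V(x,\omega)=(1-\operatorname{frac}(x+w))\,v_{\lfloor x+w\rfloor}+\operatorname{frac}(x+w)\,v_{\lfloor x+w\rfloor+1}.$$ The effective Hamiltonian $\overline H$ is the coercive continuous function on $\mathbb{R}$ such that, for $\mathbb{P}$-a.e. $\omega$ and every uniformly continuous $g:\mathbb{R}\to\mathbb{R}$, the uniformly continuous viscosity solutions $u^\varepsilon_g$ on $[0,\infty)\times\mathbb{R}$ of $\partial_tu^\varepsilon+G(\partial_xu^\varepsilon)+\beta V(x/\varepsilon,\omega)=0$, $u^\varepsilon(0,\cdot)=g$, converge locally uniformly on $[0,\infty)\times\mathbb{R}$ as $\varepsilon\to0$ to the uniformly continuous viscosity solution $\overline u_g$ of $\partial_t\overline u+\overline H(\partial_x\overline u)=0$, $\overline u(0,\cdot)=g$. Let $\mathcal{L}(\overline H)$ be the set of $\lambda\in\mathbb{R}$ such that $\overline H\equiv\lambda$ on some nonempty open interval, and let $\mathcal{A}(\mu)$ denote the set of atoms of $\mu$. Then the following hold. (a) For all $\mu_1,\mu_2$ satisfying (1) for some $c\in(0,1)$, the equation homogenizes in this sense, and $$\mathcal{L}(\overline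 H)\cap(\max\{\beta,M\},m+\beta)=\bigl((M+\beta\mathcal{A}(\mu_1))\cup(m+\beta\mathcal{A}(\mu_2))\bigr)\cap(\max\{\beta,M\},m+\beta).$$ (b) For every finite or countable $S\subset(\max\{\beta,M\},m+\beta)$ there are $c\in(0,1)$ and $\mu_1,\mu_2$ satisfying (1) such that $\mathcal{L}(\overline H)\cap(\max\{\beta,M\},m+\beta)=S$. (c) For every finite or countable $S\subset\{\beta\}\cup[\max\{\beta,M\},m+\beta]$ with $\beta\in S$ there are $c\in(0,1)$ and $\mu_1,\mu_2$ satisfying (1) such that $\mathcal{L}(\overline H)=S$. -/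

import Mathlib

open Set Filter Topology MeasureTheory
open scoped ENNReal

noncomputable section

namespace DoubleWellHJ

/-- `G` is a continuous and coercive double-well function: an absolute minimum at `0` with value
`0`, a local minimum at `pm` with value `m`, and a local maximum at `pM` with value `M`. -/
structure IsDoubleWell (G : ℝ → ℝ) (m M pm pM : ℝ) : Prop where
  continuous : Continuous G
  coercive_top : Tendsto G atTop atTop
  coercive_bot : Tendsto G atBot atTop
  pm_lt_pM : pm < pM
  pM_neg : pM < 0
  map_zero : G 0 = 0
  m_nonneg : 0 ≤ m
  map_pm : G pm = m
  m_lt_M : m < M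
  map_pM : G pM = M
  strictAnti_one : StrictAntiOn G (Iic pm)
  strictMono_two : StrictMonoOn G (Icc pm pM)
  strictAnti_three : StrictAntiOn G (Icc pM 0)
  strictMono_four : StrictMonoOn G (Ici 0)

/-- Viscosity subsolution of `∂ₜ u + F (x, ∂ₓ u) = 0` on `(0, ∞) × ℝ`; points are `(t, x)`. -/
def IsViscositySubsolution (F : ℝ → ℝ → ℝ) (u : ℝ × ℝ → ℝ) : Prop :=
  ∀ φ : ℝ × ℝ → ℝ, ContDiff ℝ 1 φ → ∀ z : ℝ × ℝ, 0 < z.1 →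
    IsLocalMax (fun y => u y - φ y) z →
      fderiv ℝ φ z (1, 0) + F z.2 (fderiv ℝ φ z (0, 1)) ≤ 0

/-- Viscosity supersolution of `∂ₜ u + F (x, ∂ₓ u) = 0` on `(0, ∞) × ℝ`; points are `(t, x)`. -/
def IsViscositySupersolution (F : ℝ → ℝ → ℝ) (u : ℝ × ℝ → ℝ) : Prop :=
  ∀ φ : ℝ × ℝ → ℝ, ContDiff ℝ 1 φ → ∀ z : ℝ × ℝ, 0 < z.1 →
    IsLocalMin (fun y => u y - φ y) z →
      0 ≤ fderiv ℝ φ z (1, 0) + F z.2 (fderiv ℝ φ z (0, 1))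

/-- The closed half-plane `[0, ∞) × ℝ` of times and positions. -/
def halfPlane : Set (ℝ × ℝ) := Ici (0 : ℝ) ×ˢ univ

/-- `u` is the viscosity solution in `UC([0, ∞) × ℝ)` of `∂ₜ u + F (x, ∂ₓ u) = 0` with initial
condition `u (0, ·) = g`. Only the values of `u` on `[0, ∞) × ℝ` matter. -/
structure IsSolution (F : ℝ → ℝ → ℝ) (g : ℝ → ℝ) (u : ℝ × ℝ → ℝ) : Prop where
  uniformContinuousOn : UniformContinuousOn u halfPlane
  initial : ∀ x : ℝ, u (0, x) = g x
  subsolution : IsViscositySubsolution F u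
  supersolution : IsViscositySupersolution F u

/-- The Hamilton-Jacobi equation `∂ₜ u + G (∂ₓ u) + β V (x / ε, ω) = 0` homogenizes, as `ε → 0`,
to `∂ₜ u + H (∂ₓ u) = 0`, with `H` continuous and coercive; that is, `H` is the effective
Hamiltonian. The exceptional null set of `ω` depends neither on the initial condition `g` nor on
`ε`. -/
structure IsEffectiveHamiltonian {Ω : Type*} [MeasurableSpace Ω] (P : Measure Ω)
    (G : ℝ → ℝ) (β : ℝ) (V : ℝ → Ω → ℝ) (H : ℝ → ℝ) : Prop where
  continuous : Continuous H
  coercive_top : Tendsto H atTop atTop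
  coercive_bot : Tendsto H atBot atTop
  homogenizes : ∀ᵐ ω ∂P, ∀ g : ℝ → ℝ, UniformContinuous g →
    ∀ u : ℝ → ℝ × ℝ → ℝ,
      (∀ ε : ℝ, 0 < ε → IsSolution (fun x p => G p + β * V (x / ε) ω) g (u ε)) →
    ∀ ubar : ℝ × ℝ → ℝ, IsSolution (fun _ p => H p) g ubar →
      TendstoLocallyUniformlyOn u ubar (𝓝[>] 0) halfPlane

/-- The set of heights at which the graph of `H` has a flat piece. -/
def flatHeights (H : ℝ → ℝ) : Set ℝ :=
  {l | ∃ a b : ℝ, a < b ∧ ∀ θ ∈ Ioo a b, H θ = l}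

/-- The set of atoms of a Borel measure on `[0, 1]`, as a set of real numbers. -/
def atoms (μ : Measure unitInterval) : Set ℝ :=
  (fun a : unitInterval => (a : ℝ)) '' {a | μ {a} ≠ 0}

/-- The sample space `[0, 1) × [0, 1] ^ ℤ`. -/
abbrev Sample : Type := Ico (0 : ℝ) 1 × (ℤ → unitInterval)

/-- The law of a sequence of independent random variables, distributed as `μ₁` at the even indices
and as `μ₂` at the odd indices. -/
def alternatingLaw (μ₁ μ₂ : ProbabilityMeasure unitInterval) : Measure (ℤ → unitInterval) :=
  Measure.infinitePi fun i : ℤ =>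
    ((if Even i then μ₁ else μ₂ : ProbabilityMeasure unitInterval) : Measure unitInterval)

/-- The law of two independent, interlaced, bi-infinite sequences of i.i.d. random variables with
common distributions `μ₁` and `μ₂`, where a fair coin decides which one is used at the index `0`.
When `μ₁` and `μ₂` have disjoint supports, this is the law of the stationary Markov chain that
moves from the support of either measure to a point drawn from the other one, with invariant
distribution `(μ₁ + μ₂) / 2`. -/
def interlacedLaw (μ₁ μ₂ : ProbabilityMeasure unitInterval) : Measure (ℤ → unitInterval) :=
  (2⁻¹ : ℝ≥0∞) • alternatingLaw μ₁ μ₂ + (2⁻¹ : ℝ≥0∞) • alternatingLaw μ₂ μ₁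

/-- The product of Lebesgue measure on `[0, 1)` and the interlaced law. -/
def sampleLaw (μ₁ μ₂ : ProbabilityMeasure unitInterval) : Measure Sample :=
  (Measure.comap ((↑) : Ico (0 : ℝ) 1 → ℝ) volume).prod (interlacedLaw μ₁ μ₂)

/-- The piecewise linear potential: `x ↦ V (x, (w, v))` interpolates linearly between the values
`v i` at the points `i - w`. -/
def potential (x : ℝ) (ω : Sample) : ℝ :=
  (1 - Int.fract (x + (ω.1 : ℝ))) * (ω.2 ⌊x + (ω.1 : ℝ)⌋ : ℝ)
    + Int.fract (x + (ω.1 : ℝ)) * (ω.2 (⌊x + (ω.1 : ℝ)⌋ + 1) : ℝ)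

/-- `0 ∈ supp μ₁ ⊆ [0, c)` and `1 ∈ supp μ₂ ⊆ (c, 1]`, for some `c ∈ (0, 1)`. -/
structure SeparatedSupports (c : ℝ) (μ₁ μ₂ : ProbabilityMeasure unitInterval) : Prop where
  c_mem : c ∈ Ioo (0 : ℝ) 1
  zero_mem : (0 : unitInterval) ∈ (μ₁ : Measure unitInterval).support
  lt_c : ∀ v ∈ (μ₁ : Measure unitInterval).support, (v : ℝ) < c
  one_mem : (1 : unitInterval) ∈ (μ₂ : Measure unitInterval).support
  c_lt : ∀ v ∈ (μ₂ : Measure unitInterval).support, c < (v : ℝ)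

end DoubleWellHJ

end

/-! Put W = βV. A corrector at height λ ≥ β solves G(f') + W = λ, so its slope q satisfies G(q) = λ
- W, and the level λ - W lies in [λ - β, λ], hence is nonnegative. With nonnegative slopes there is
one choice, the increasing branch g₄. With nonpositive slopes there are two decreasing branches, g₁
on the left well (levels ≥ m) and g₃ next to the origin (levels ≤ M). The viscosity conditions at a
kink ask for G ≥ level across an upward jump of the slope and for G ≤ level across a downward one.
Read from left to right, the slope may therefore pass from g₃ to g₁ only at level M and from g₁ to
g₃ only at level m: a hysteresis loop (`InLeftWell`, `wellSlope`, `isSlope_wellSlope`).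

A site with level above M or below m erases the memory of the loop. Such sites have positive
probability at every height, so truncation to independent blocks and the strong law give almost sure
mean slopes (`ae_hasMean`): φ(λ) for the corrector with hysteresis and ψ(λ) for the nonnegative one.
Here φ is strictly decreasing and nonpositive, ψ is strictly increasing, continuous and bounded
below by a positive constant on [β, ∞). The effective Hamiltonian is H(θ) = inf {λ > β : φ(λ) ≤ θ ≤
ψ(λ)} (`slopeHeight`).

That H is effective needs approximate correctors at every slope θ (`hasSlopes_profile`). A slope
skipped by φ is produced by gluing the correctors of two heights just below and just above H(θ), at
points where both are on the same branch; for H(θ) = β the two correctors of one height are glued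
where V is close to 1 and both slopes are near 0. The gluing points have gaps of size o(L) in
windows of length L, which suffices for any prescribed mean (`exists_interpolated_slope`).
Correctors at every slope imply homogenization by the perturbed test function method
(`HasSlopes.homogenizes`).

Finally, H has a flat piece at β, because φ ≤ 0 < ψ with a uniform gap, none below β, and one at λ >
β exactly when φ is discontinuous at λ. Even sites carry the maxima of the level and odd sites the
minima. The loop reacts to an infinitesimal change of λ only where a maximum equals M or a minimum
equals m, so φ jumps exactly when this has positive probability: λ = M + βa with a an atom of μ₁ (if
λ < m + β; otherwise the slope has settled in the left well), or λ = m + βa with a an atom of μ₂ (if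
λ > M; otherwise the left well is almost surely not visited). See `continuousAt_lowMean`,
`exists_lowMean_jump_of_atom_low`, `exists_lowMean_jump_of_atom_high`. Prescribing the flat heights
is then prescribing atoms (`exists_separatedSupports`). -/

namespace DoubleWellHJ

/-! ### Viscosity subsolutions tested with Lipschitz functions -/

/-- `p` is a proximal subgradient of `f` at `y`. -/
def IsProxSubgradient (f : ℝ → ℝ) (y p : ℝ) : Prop :=
  ∃ C : ℝ, ∀ᶠ x in 𝓝 y, f y + p * (x - y) - C * (x - y) ^ 2 ≤ f x

lemma hasDerivAt_fst_of_contDiff {φ : ℝ × ℝ → ℝ} (hφ : ContDiff ℝ 1 φ) (z : ℝ × ℝ) :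
    HasDerivAt (fun t => φ (t, z.2)) (fderiv ℝ φ z (1, 0)) z.1 := by
  have h1 : HasFDerivAt φ (fderiv ℝ φ z) z := (hφ.differentiable one_ne_zero z).hasFDerivAt
  have h2 : HasDerivAt (fun t : ℝ => (t, z.2)) ((1 : ℝ), (0 : ℝ)) z.1 :=
    (hasDerivAt_id z.1).prodMk (hasDerivAt_const z.1 z.2)
  exact h1.comp_hasDerivAt z.1 h2

lemma hasDerivAt_snd_of_contDiff {φ : ℝ × ℝ → ℝ} (hφ : ContDiff ℝ 1 φ) (z : ℝ × ℝ) :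
    HasDerivAt (fun x => φ (z.1, x)) (fderiv ℝ φ z (0, 1)) z.2 := by
  have h1 : HasFDerivAt φ (fderiv ℝ φ z) z := (hφ.differentiable one_ne_zero z).hasFDerivAt
  have h2 : HasDerivAt (fun x : ℝ => (z.1, x)) ((0 : ℝ), (1 : ℝ)) z.2 :=
    (hasDerivAt_const z.2 z.1).prodMk (hasDerivAt_id z.2)
  exact h1.comp_hasDerivAt z.2 h2

lemma IsViscositySubsolution.le_of_hasDerivAt {F : ℝ → ℝ → ℝ} {u φ : ℝ × ℝ → ℝ}
    (hu : IsViscositySubsolution F u) (hφ : ContDiff ℝ 1 φ) {z : ℝ × ℝ} (hz : 0 < z.1)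
    (hmax : IsLocalMax (fun y => u y - φ y) z) {a b : ℝ}
    (ha : HasDerivAt (fun t => φ (t, z.2)) a z.1) (hb : HasDerivAt (fun x => φ (z.1, x)) b z.2) :
    a + F z.2 b ≤ 0 := by
  have h := hu φ hφ z hz hmax
  rwa [(hasDerivAt_fst_of_contDiff hφ z).unique ha, (hasDerivAt_snd_of_contDiff hφ z).unique hb]
    at h

lemma IsViscositySupersolution.le_of_hasDerivAt {F : ℝ → ℝ → ℝ} {u φ : ℝ × ℝ → ℝ}
    (hu : IsViscositySupersolution F u) (hφ : ContDiff ℝ 1 φ) {z : ℝ × ℝ} (hz : 0 < z.1)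
    (hmin : IsLocalMin (fun y => u y - φ y) z) {a b : ℝ}
    (ha : HasDerivAt (fun t => φ (t, z.2)) a z.1) (hb : HasDerivAt (fun x => φ (z.1, x)) b z.2) :
    0 ≤ a + F z.2 b := by
  have h := hu φ hφ z hz hmin
  rwa [(hasDerivAt_fst_of_contDiff hφ z).unique ha, (hasDerivAt_snd_of_contDiff hφ z).unique hb]
    at h

lemma continuous_of_abs_sub_le {f : ℝ → ℝ} {C : ℝ} (hf : ∀ x y, |f x - f y| ≤ C * |x - y|) :
    Continuous f := by
  have : LipschitzWith (Real.toNNReal C) f := by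
    refine LipschitzWith.of_dist_le_mul fun x y => ?_
    rw [Real.dist_eq, Real.dist_eq]
    exact (hf x y).trans (mul_le_mul_of_nonneg_right (Real.le_coe_toNNReal C) (abs_nonneg _))
  exact this.continuous

/-- A merely Lipschitz `f` is not an admissible test function, so its space variable is doubled. At
a maximum of the doubled function the coupling hands one and the same slope p = N(x' - y) to both
sides: p is a proximal subgradient of `f` at y, and it enters the gradient of a smooth function
touching `u` from above at z'. -/
lemma exists_approx_slope_of_isLocalMax {G w f : ℝ → ℝ} {u Ψ : ℝ × ℝ → ℝ} {C Λ : ℝ}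
    (hu : ContinuousOn u halfPlane)
    (hsub : IsViscositySubsolution (fun x p => G p + w x) u) (hΨ : ContDiff ℝ 1 Ψ) (hC : 0 ≤ C)
    (hf : ∀ x y, |f x - f y| ≤ C * |x - y|)
    (hf' : ∀ y p, IsProxSubgradient f y p → Λ ≤ G p + w y) {z : ℝ × ℝ} (hz : 0 < z.1)
    (hmax : IsLocalMax (fun y => u y - Ψ y - f y.2) z) {η : ℝ} (hη : 0 < η) :
    ∃ (z' : ℝ × ℝ) (y p : ℝ), dist z' z ≤ η ∧ |y - z.2| ≤ η ∧ |p| ≤ 2 * C ∧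
      (fderiv ℝ Ψ z' (1, 0) + 2 * (z'.1 - z.1)) +
        (G (fderiv ℝ Ψ z' (0, 1) + 2 * (z'.2 - z.2) + p) + w z'.2) ≤ 0 ∧ Λ ≤ G p + w y := by
  obtain ⟨r0, hr0, hball⟩ := Metric.eventually_nhds_iff_ball.1 hmax
  obtain ⟨r, hr, hrr0, hrz, hrη⟩ : ∃ r > 0, r < r0 ∧ r < z.1 ∧ r ≤ η :=
    ⟨min (min (r0 / 2) (z.1 / 2)) η, by positivity,
      ((min_le_left _ _).trans (min_le_left _ _)).trans_lt (by linarith),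
      ((min_le_left _ _).trans (min_le_right _ _)).trans_lt (by linarith), min_le_right _ _⟩
  obtain ⟨N, hN0, hN1, hN2⟩ : ∃ N : ℝ, 0 < N ∧ 2 * C / N < r / 2 ∧ 2 * C ^ 2 / N < (r / 2) ^ 2 := by
    have h1 : Tendsto (fun N : ℝ => 2 * C / N) atTop (𝓝 0) := tendsto_const_nhds.div_atTop tendsto_id
    have h2 : Tendsto (fun N : ℝ => 2 * C ^ 2 / N) atTop (𝓝 0) :=
      tendsto_const_nhds.div_atTop tendsto_id
    have := (eventually_gt_atTop (0 : ℝ)).and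
      ((h1.eventually_lt_const (show (0 : ℝ) < r / 2 by positivity)).and
        (h2.eventually_lt_const (show (0 : ℝ) < (r / 2) ^ 2 by positivity)))
    exact this.exists
  have hfc := continuous_of_abs_sub_le hf
  have hsubset : Metric.closedBall z r ⊆ halfPlane := by
    intro p hp
    have h1 : dist p.1 z.1 ≤ r := (le_max_left _ _).trans (Metric.mem_closedBall.1 hp)
    rw [Real.dist_eq, abs_le] at h1
    exact ⟨by simp only [mem_Ici]; linarith, mem_univ _⟩
  let Φ : (ℝ × ℝ) × ℝ → ℝ := fun q =>
    u q.1 - Ψ q.1 - ((q.1.1 - z.1) ^ 2 + (q.1.2 - z.2) ^ 2) - f q.2 - N / 2 * (q.1.2 - q.2) ^ 2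
  have hK : IsCompact (Metric.closedBall z r ×ˢ Icc (z.2 - r) (z.2 + r)) :=
    (isCompact_closedBall z r).prod isCompact_Icc
  have hzK : ((z, z.2) : (ℝ × ℝ) × ℝ) ∈ Metric.closedBall z r ×ˢ Icc (z.2 - r) (z.2 + r) :=
    ⟨Metric.mem_closedBall_self hr.le, by constructor <;> linarith⟩
  have hΨc := hΨ.continuous
  have hΦ : ContinuousOn Φ (Metric.closedBall z r ×ˢ Icc (z.2 - r) (z.2 + r)) := by
    have h1 : ContinuousOn (fun q : (ℝ × ℝ) × ℝ => u q.1)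
        (Metric.closedBall z r ×ˢ Icc (z.2 - r) (z.2 + r)) :=
      hu.comp continuous_fst.continuousOn fun q hq => hsubset hq.1
    have h2 : Continuous (fun q : (ℝ × ℝ) × ℝ => Ψ q.1 + ((q.1.1 - z.1) ^ 2 + (q.1.2 - z.2) ^ 2)
      + f q.2 + N / 2 * (q.1.2 - q.2) ^ 2) := by fun_prop
    refine (h1.sub h2.continuousOn).congr fun q _ => ?_
    simp only [Φ, Pi.sub_apply]; ring
  obtain ⟨⟨z', y⟩, ⟨hz'K, hyK⟩, hmx⟩ := hK.exists_isMaxOn ⟨_, hzK⟩ hΦ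
  set d := |z'.2 - y| with hd
  have hd0 : 0 ≤ d := abs_nonneg _
  -- Comparison with the point `(z, z.2)`. It gives d ≤ 2C/N, hence |p| = N d ≤ 2C, and squared
  -- distance at most 2C²/N from z'; these are the quantities made small by the choice of `N`.
  have hkey : (z'.1 - z.1) ^ 2 + (z'.2 - z.2) ^ 2 + N / 2 * d ^ 2 ≤ C * d := by
    have h1 : Φ (z, z.2) ≤ Φ (z', y) := hmx hzK
    have h2 : u z' - Ψ z' - f z'.2 ≤ u z - Ψ z - f z.2 :=
      hball z' (Metric.mem_ball.2 ((Metric.mem_closedBall.1 hz'K).trans_lt hrr0))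
    have h3 := (abs_le.1 (hf z'.2 y)).2
    simp only [Φ] at h1
    rw [hd, sq_abs]
    nlinarith
  have hdN : d ≤ 2 * C / N := by
    rw [le_div_iff₀ hN0]
    by_contra! hcon
    have : 0 < d := by
      rcases hd0.eq_or_lt with h | h
      · rw [← h] at hcon; linarith
      · exact h
    nlinarith [sq_nonneg (z'.1 - z.1), sq_nonneg (z'.2 - z.2)]
  have hsq : (z'.1 - z.1) ^ 2 + (z'.2 - z.2) ^ 2 < (r / 2) ^ 2 := by
    have h1 : C * d ≤ C * (2 * C / N) := mul_le_mul_of_nonneg_left hdN hC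
    have h2 : C * (2 * C / N) = 2 * C ^ 2 / N := by ring
    have h3 : 0 ≤ N / 2 * d ^ 2 := by positivity
    linarith
  have hx1 : |z'.1 - z.1| < r / 2 := abs_lt_of_sq_lt_sq (by nlinarith [sq_nonneg (z'.2 - z.2)]) (by linarith)
  have hx2 : |z'.2 - z.2| < r / 2 := abs_lt_of_sq_lt_sq (by nlinarith [sq_nonneg (z'.1 - z.1)]) (by linarith)
  have hdist : dist z' z < r := by
    rw [Prod.dist_eq, Real.dist_eq, Real.dist_eq]
    exact max_lt (by linarith) (by linarith)
  have hy : |y - z.2| < r := by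
    have : |y - z.2| ≤ |y - z'.2| + |z'.2 - z.2| := abs_sub_le _ _ _
    rw [abs_sub_comm y z'.2] at this
    linarith
  refine ⟨z', y, N * (z'.2 - y), hdist.le.trans hrη, hy.le.trans hrη, ?_, ?_, ?_⟩
  · rw [abs_mul, abs_of_pos hN0, mul_comm]
    exact (le_div_iff₀ hN0).1 hdN
  · have hz'1 : 0 < z'.1 := by have := (abs_lt.1 hx1).1; linarith
    let φ : ℝ × ℝ → ℝ := fun q =>
      Ψ q + ((q.1 - z.1) ^ 2 + (q.2 - z.2) ^ 2) + N / 2 * (q.2 - y) ^ 2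
    have hφ : ContDiff ℝ 1 φ := by simp only [φ]; fun_prop
    have hm : IsLocalMax (fun q => u q - φ q) z' := by
      filter_upwards [Metric.isOpen_ball.mem_nhds (Metric.mem_ball.2 hdist)] with q hq
      have h1 : Φ (q, y) ≤ Φ (z', y) := hmx ⟨Metric.ball_subset_closedBall hq, hyK⟩
      simp only [Φ] at h1
      simp only [φ]
      linarith
    have := hsub.le_of_hasDerivAt hφ hz'1 hm
      (a := fderiv ℝ Ψ z' (1, 0) + 2 * (z'.1 - z.1))
      (b := fderiv ℝ Ψ z' (0, 1) + 2 * (z'.2 - z.2) + N * (z'.2 - y)) ?_ ?_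
    · exact this
    · have h := (((hasDerivAt_fst_of_contDiff hΨ z').add
        ((((hasDerivAt_id z'.1).sub_const z.1).pow 2).add_const ((z'.2 - z.2) ^ 2))).add_const
          (N / 2 * (z'.2 - y) ^ 2))
      refine h.congr_deriv ?_
      simp
    · have h := ((hasDerivAt_snd_of_contDiff hΨ z').add
        ((((hasDerivAt_id z'.2).sub_const z.2).pow 2).const_add ((z'.1 - z.1) ^ 2))).add
          ((((hasDerivAt_id z'.2).sub_const y).pow 2).const_mul (N / 2))
      refine h.congr_deriv ?_
      simp; ring
  · refine hf' y _ ⟨N / 2, ?_⟩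
    have hyo : y ∈ Ioo (z.2 - r) (z.2 + r) := by
      rw [abs_lt] at hy; constructor <;> linarith
    filter_upwards [isOpen_Ioo.mem_nhds hyo] with x hx
    have h1 : Φ (z', x) ≤ Φ (z', y) := hmx ⟨hz'K, Ioo_subset_Icc_self hx⟩
    simp only [Φ] at h1
    nlinarith

/-- Let the approximation error tend to 0 and extract a limit of the slopes, which are bounded by `2
* C`. Both inequalities are closed, so one slope satisfies both at the same point. -/
lemma exists_slope_of_isLocalMax {G w f : ℝ → ℝ} {u Ψ : ℝ × ℝ → ℝ} {C Λ : ℝ}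
    (hG : Continuous G) (hw : Continuous w) (hu : ContinuousOn u halfPlane)
    (hsub : IsViscositySubsolution (fun x p => G p + w x) u) (hΨ : ContDiff ℝ 1 Ψ) (hC : 0 ≤ C)
    (hf : ∀ x y, |f x - f y| ≤ C * |x - y|)
    (hf' : ∀ y p, IsProxSubgradient f y p → Λ ≤ G p + w y) {z : ℝ × ℝ} (hz : 0 < z.1)
    (hmax : IsLocalMax (fun y => u y - Ψ y - f y.2) z) :
    ∃ p : ℝ, |p| ≤ 2 * C ∧
      fderiv ℝ Ψ z (1, 0) + (G (fderiv ℝ Ψ z (0, 1) + p) + w z.2) ≤ 0 ∧ Λ ≤ G p + w z.2 := by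
  have h0 : ∀ n : ℕ, (0 : ℝ) < 1 / ((n : ℝ) + 1) := fun n => Nat.one_div_pos_of_nat
  choose z' y p hz' hy hp h1 h2 using fun n : ℕ =>
    exists_approx_slope_of_isLocalMax hu hsub hΨ hC hf hf' hz hmax (h0 n)
  have hlim := tendsto_one_div_add_atTop_nhds_zero_nat (𝕜 := ℝ)
  have hz't : Tendsto z' atTop (𝓝 z) := tendsto_iff_dist_tendsto_zero.2
    (squeeze_zero (fun _ => dist_nonneg) hz' hlim)
  have hyt : Tendsto y atTop (𝓝 z.2) := tendsto_iff_dist_tendsto_zero.2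
    (squeeze_zero (fun _ => dist_nonneg) hy hlim)
  obtain ⟨p0, hp0, σ, hσ, hσp⟩ := (isCompact_Icc (a := -(2 * C)) (b := 2 * C)).tendsto_subseq
    (fun n => mem_Icc.2 (abs_le.1 (hp n)))
  have hz'' := hz't.comp hσ.tendsto_atTop
  have hy'' := hyt.comp hσ.tendsto_atTop
  have hfd : Continuous (fun q => fderiv ℝ Ψ q) := hΨ.continuous_fderiv one_ne_zero
  refine ⟨p0, abs_le.2 hp0, ?_, ?_⟩
  · have hc : Continuous (fun q : (ℝ × ℝ) × ℝ => (fderiv ℝ Ψ q.1 (1, 0) + 2 * (q.1.1 - z.1)) +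
        (G (fderiv ℝ Ψ q.1 (0, 1) + 2 * (q.1.2 - z.2) + q.2) + w q.1.2)) := by fun_prop
    have := le_of_tendsto ((hc.tendsto (z, p0)).comp (hz''.prodMk_nhds hσp))
      (Eventually.of_forall fun n => h1 (σ n))
    simpa using this
  · have hc : Continuous (fun q : ℝ × ℝ => G q.2 + w q.1) := by fun_prop
    exact ge_of_tendsto ((hc.tendsto (z.2, p0)).comp (hy''.prodMk_nhds hσp))
      (Eventually.of_forall fun n => h2 (σ n))

end DoubleWellHJ

/-! ### Growth bounds and barriers -/

namespace DoubleWellHJ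

/-- Chain along the segment: steps shorter than `δ` change `u` by at most 1 each, and at most 1 +
(2/δ) dist of them are needed. -/
lemma exists_affine_bound_of_uniformContinuousOn {E : Type*} [NormedAddCommGroup E]
    [NormedSpace ℝ E] {s : Set E} (hs : Convex ℝ s) {u : E → ℝ} (hu : UniformContinuousOn u s) :
    ∃ B : ℝ, 0 ≤ B ∧ ∀ z ∈ s, ∀ z' ∈ s, |u z - u z'| ≤ 1 + B * dist z z' := by
  obtain ⟨δ, hδ, h⟩ := Metric.uniformContinuousOn_iff.1 hu 1 one_pos
  refine ⟨2 / δ, by positivity, fun z hz z' hz' => ?_⟩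
  set n : ℕ := ⌊2 / δ * dist z z'⌋₊ + 1 with hn
  have hn0 : (0 : ℝ) < n := by rw [hn]; positivity
  have hn1 : 2 / δ * dist z z' < n := by rw [hn]; push_cast; exact Nat.lt_floor_add_one _
  have hn2 : (n : ℝ) ≤ 1 + 2 / δ * dist z z' := by
    rw [hn]; push_cast
    have := Nat.floor_le (show 0 ≤ 2 / δ * dist z z' by positivity)
    linarith
  have hmem : ∀ k : ℕ, k ≤ n → AffineMap.lineMap z z' ((k : ℝ) / n) ∈ s := fun k hk =>
    hs.lineMap_mem hz hz' ⟨by positivity, div_le_one_of_le₀ (by exact_mod_cast hk) hn0.le⟩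
  have hstep : ∀ k : ℕ, k ≤ n → |u z - u (AffineMap.lineMap z z' ((k : ℝ) / n))| ≤ k := by
    intro k
    induction k with
    | zero => intro; simp
    | succ k ih =>
      intro hk
      have h1 := ih (by omega)
      have h2 : dist (AffineMap.lineMap z z' ((k : ℝ) / n) : E)
          (AffineMap.lineMap z z' (((k + 1 : ℕ) : ℝ) / n)) < δ := by
        rw [dist_lineMap_lineMap, Real.dist_eq]
        have : (k : ℝ) / n - ((k + 1 : ℕ) : ℝ) / n = -(1 / n) := by push_cast; field_simp; ring
        rw [this, abs_neg, abs_of_pos (by positivity), one_div, inv_mul_lt_iff₀ hn0]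
        have h3 : 2 / δ * dist z z' * δ < n * δ := mul_lt_mul_of_pos_right hn1 hδ
        have h4 : 2 / δ * dist z z' * δ = 2 * dist z z' := by field_simp
        have h5 : 0 ≤ dist z z' := dist_nonneg
        linarith
      have h3 := h _ (hmem k (by omega)) _ (hmem (k + 1) hk) h2
      rw [Real.dist_eq] at h3
      have h4 := abs_sub_le (u z) (u (AffineMap.lineMap z z' ((k : ℝ) / n)))
        (u (AffineMap.lineMap z z' (((k + 1 : ℕ) : ℝ) / n)))
      push_cast at *
      linarith
  have := hstep n le_rfl
  rw [div_self hn0.ne', AffineMap.lineMap_apply_one] at this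
  linarith

lemma convex_halfPlane : Convex ℝ halfPlane := (convex_Ici 0).prod convex_univ

lemma isClosed_halfPlane : IsClosed halfPlane := isClosed_Ici.prod isClosed_univ

lemma mem_halfPlane {z : ℝ × ℝ} : z ∈ halfPlane ↔ 0 ≤ z.1 := by simp [halfPlane]

lemma halfPlane_mem_nhds {z : ℝ × ℝ} (hz : 0 < z.1) : halfPlane ∈ 𝓝 z := by
  have : IsOpen {y : ℝ × ℝ | 0 < y.1} := isOpen_lt continuous_const continuous_fst
  filter_upwards [this.mem_nhds hz] with y hy using mem_halfPlane.2 (le_of_lt hy)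

lemma exists_isMaxOn_of_superlevel_subset {X : Type*} [TopologicalSpace X] {s K : Set X}
    (hs : IsClosed s) (hK : IsCompact K) {Φ : X → ℝ} (hΦ : ContinuousOn Φ s) {z₀ : X}
    (hz₀ : z₀ ∈ s) (h : ∀ z ∈ s, Φ z₀ ≤ Φ z → z ∈ K) : ∃ z ∈ s, z ∈ K ∧ IsMaxOn Φ s z := by
  obtain ⟨z, ⟨hzK, hzs⟩, hz⟩ := (hK.inter_right hs).exists_isMaxOn ⟨z₀, h z₀ hz₀ le_rfl, hz₀⟩
    (hΦ.mono inter_subset_right)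
  refine ⟨z, hzs, hzK, fun y hy => ?_⟩
  have h0 : Φ z₀ ≤ Φ z := hz ⟨h z₀ hz₀ le_rfl, hz₀⟩
  by_cases hy' : Φ z₀ ≤ Φ y
  · exact hz ⟨h y hy hy', hy⟩
  · exact (not_le.1 hy').le.trans h0

/-- The smooth convex function `x ↦ √(1 + x ^ 2)`, with slopes in `(-1, 1)`. -/
noncomputable def japanese (x : ℝ) : ℝ := √(1 + x ^ 2)

lemma contDiff_japanese : ContDiff ℝ 1 japanese := by
  unfold japanese
  exact ContDiff.sqrt (by fun_prop) fun x => by positivity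

lemma exists_hasDerivAt_japanese (x : ℝ) : ∃ q, |q| ≤ 1 ∧ HasDerivAt japanese q x := by
  have h0 : (0 : ℝ) < 1 + x ^ 2 := by positivity
  have h1 : HasDerivAt (fun x : ℝ => 1 + x ^ 2) (2 * x) x := by
    simpa using (hasDerivAt_pow 2 x).const_add 1
  refine ⟨_, ?_, h1.sqrt h0.ne'⟩
  rw [abs_div, abs_mul, abs_two, abs_of_pos (show 0 < 2 * √(1 + x ^ 2) by positivity),
    div_le_one (by positivity)]
  have : |x| ≤ √(1 + x ^ 2) := Real.abs_le_sqrt (by linarith)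
  linarith

lemma abs_le_japanese (x : ℝ) : |x| ≤ japanese x := Real.abs_le_sqrt (by linarith)

lemma one_le_japanese (x : ℝ) : 1 ≤ japanese x := by
  unfold japanese
  rw [Real.one_le_sqrt]; nlinarith [sq_nonneg x]

lemma japanese_zero : japanese 0 = 1 := by simp [japanese]

lemma japanese_le (x : ℝ) : japanese x ≤ 1 + |x| := by
  unfold japanese
  rw [Real.sqrt_le_left (by positivity)]
  nlinarith [abs_nonneg x, sq_abs x]

/-- Slope c is admissible as soon as |x| ≥ 2c / (1 - c²); for c = ρ / (ρ + 2) this threshold is at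
most ρ. -/
lemma add_mul_le_japanese {ρ x : ℝ} (hρ : 0 < ρ) (hx : ρ ≤ |x|) :
    1 + ρ / (ρ + 2) * |x| ≤ japanese x := by
  refine Real.le_sqrt_of_sq_le ?_
  rw [← sq_abs x]
  set d := |x|
  have h1 : (1 + ρ / (ρ + 2) * d) ^ 2 = ((ρ + 2) + ρ * d) ^ 2 / (ρ + 2) ^ 2 := by field_simp
  rw [h1, div_le_iff₀ (by positivity)]
  nlinarith [mul_nonneg hρ.le (sub_nonneg.2 hx), mul_nonneg (hρ.le.trans hx) (sub_nonneg.2 hx),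
    mul_pos hρ hρ, hρ.trans_le hx]

lemma exists_abs_le_on_Icc {G : ℝ → ℝ} (hG : Continuous G) (K : ℝ) :
    ∃ C : ℝ, 0 ≤ C ∧ ∀ p, |p| ≤ K → |G p| ≤ C := by
  obtain ⟨C, hC⟩ := (isCompact_Icc (a := -K) (b := K)).exists_bound_of_continuousOn hG.continuousOn
  exact ⟨max C 0, le_max_right _ _, fun p hp => (hC p (abs_le.1 hp)).trans (le_max_left _ _)⟩

lemma linear_sub_sq_le {A κ t : ℝ} (hκ : 0 < κ) : A * t - κ * t ^ 2 ≤ A ^ 2 / (4 * κ) := by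
  rw [le_div_iff₀ (by positivity)]
  nlinarith [sq_nonneg (2 * κ * t - A)]

/-- Subsolutions stay below a time-linear barrier, uniformly over bounded potentials. -/
lemma exists_barrier {G g : ℝ → ℝ} (hG : Continuous G) (hg : UniformContinuous g) (Wb : ℝ)
    {η : ℝ} (hη : 0 < η) :
    ∃ C : ℝ, 0 ≤ C ∧ ∀ (w : ℝ → ℝ) (u : ℝ × ℝ → ℝ), (∀ x, |w x| ≤ Wb) →
      UniformContinuousOn u halfPlane → (∀ x, u (0, x) = g x) →
      IsViscositySubsolution (fun x p => G p + w x) u →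
      ∀ t x, 0 ≤ t → u (t, x) ≤ g x + η + C * t := by
  obtain ⟨B, hB0, hB⟩ := exists_affine_bound_of_uniformContinuousOn convex_univ
    (uniformContinuousOn_univ.2 hg)
  obtain ⟨ρ, hρ, hgρ⟩ := Metric.uniformContinuous_iff.1 hg η hη
  set c := ρ / (ρ + 2) with hc
  have hc0 : 0 < c := by positivity
  -- For |x - y| ≥ ρ the term K (⟨x - y⟩ - 1) ≥ K c |x - y| then dominates the affine bound 1 + B |x
  -- - y| of the oscillation of `g`: the summand 1/ρ pays for the 1, and the last summand leaves -|x
  -- - y| for compactness.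
  set K := (1 / ρ + B + 1) / c with hK
  have hK0 : 0 < K := by positivity
  have hKc : K * c = 1 / ρ + B + 1 := by rw [hK]; field_simp
  obtain ⟨C, hC0, hC⟩ := exists_abs_le_on_Icc hG K
  have hgK : ∀ x y : ℝ, g x - g y - K * (japanese (x - y) - 1) ≤ η + ρ - |x - y| := by
    intro x y
    rcases lt_or_ge |x - y| ρ with h | h
    · have h1 := hgρ (a := x) (b := y) (by rwa [Real.dist_eq])
      rw [Real.dist_eq] at h1
      have := (abs_lt.1 h1).2
      nlinarith [one_le_japanese (x - y)]
    · have h1 := (abs_le.1 (hB x (mem_univ _) y (mem_univ _))).2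
      rw [Real.dist_eq] at h1
      have h2 := add_mul_le_japanese hρ h
      have h3 : K * (c * |x - y|) ≤ K * (japanese (x - y) - 1) :=
        mul_le_mul_of_nonneg_left (by linarith) hK0.le
      have h4 : K * (c * |x - y|) = (1 / ρ + B + 1) * |x - y| := by rw [← hKc]; ring
      have h5 : 1 ≤ 1 / ρ * |x - y| := by
        rw [one_div, ← div_eq_inv_mul, le_div_iff₀ hρ]; linarith
      nlinarith
  have hgK' : ∀ x y : ℝ, g x - g y - K * (japanese (x - y) - 1) ≤ η := by
    intro x y
    rcases lt_or_ge |x - y| ρ with h | h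
    · have h1 := hgρ (a := x) (b := y) (by rwa [Real.dist_eq])
      rw [Real.dist_eq] at h1
      have := (abs_lt.1 h1).2
      nlinarith [one_le_japanese (x - y)]
    · linarith [hgK x y]
  refine ⟨C + |Wb| + 1, by positivity, fun w u hw hu hu0 hsub t₁ y ht₁ => ?_⟩
  by_contra! hcon
  obtain ⟨A, hA0, hA⟩ := exists_affine_bound_of_uniformContinuousOn convex_halfPlane hu
  -- The quadratic penalty in time beats the at most linear growth of `u`, so that a maximum is
  -- attained, and is small enough to keep the assumed violation positive.
  obtain ⟨κ, hκ, hκt⟩ : ∃ κ > 0, 0 < u (t₁, y) - (g y + η + (C + |Wb| + 1) * t₁) - κ * t₁ ^ 2 := by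
    have : Tendsto (fun κ : ℝ => u (t₁, y) - (g y + η + (C + |Wb| + 1) * t₁) - κ * t₁ ^ 2)
        (𝓝[>] 0) (𝓝 (u (t₁, y) - (g y + η + (C + |Wb| + 1) * t₁) - 0 * t₁ ^ 2)) :=
      (Continuous.tendsto (by fun_prop) 0).mono_left nhdsWithin_le_nhds
    have h := (this.eventually_const_lt (show (0 : ℝ) < _ by linarith)).and self_mem_nhdsWithin
    obtain ⟨κ, h1, h2⟩ := h.exists
    exact ⟨κ, h2, h1⟩
  let φ : ℝ × ℝ → ℝ := fun z => g y + η + K * (japanese (z.2 - y) - 1) +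
    (C + |Wb| + 1) * z.1 + κ * z.1 ^ 2
  have hφ : ContDiff ℝ 1 φ := by
    have : ContDiff ℝ 1 (fun z : ℝ × ℝ => japanese (z.2 - y)) :=
      contDiff_japanese.comp (by fun_prop)
    simp only [φ]; fun_prop
  set R := 1 + ρ + (A + 1) ^ 2 / (4 * κ) with hR
  have hbound : ∀ z ∈ halfPlane, 0 < u z - φ z → z.1 + |z.2 - y| ≤ R := by
    intro z hz hpos
    have hz1 := mem_halfPlane.1 hz
    have h1 := (abs_le.1 (hA z hz (0, z.2) (mem_halfPlane.2 le_rfl))).2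
    rw [hu0, Prod.dist_eq, Real.dist_eq, dist_self, sub_zero, abs_of_nonneg hz1,
      max_eq_left hz1] at h1
    have h2 := hgK z.2 y
    have h3 := linear_sub_sq_le (A := A + 1) (t := z.1) hκ
    simp only [φ] at hpos
    have h4 : 0 ≤ (C + |Wb| + 1) * z.1 := by positivity
    rw [hR]
    linarith
  have hpos1 : 0 < u (t₁, y) - φ (t₁, y) := by
    simp only [φ, sub_self, japanese_zero]; linarith
  obtain ⟨z, hz, -, hmax⟩ := exists_isMaxOn_of_superlevel_subset (z₀ := ((t₁, y) : ℝ × ℝ))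
    (K := Icc 0 R ×ˢ Icc (y - R) (y + R)) isClosed_halfPlane
    (isCompact_Icc.prod isCompact_Icc) (hu.continuousOn.sub hφ.continuous.continuousOn)
    (mem_halfPlane.2 ht₁) (by
      intro z hz hle
      have h1 := hbound z hz (hpos1.trans_le hle)
      have hz1 := mem_halfPlane.1 hz
      have h2 := abs_nonneg (z.2 - y)
      have h3 := abs_le.1 (show |z.2 - y| ≤ R by linarith)
      exact ⟨⟨hz1, by linarith⟩, ⟨by linarith, by linarith⟩⟩)
  have hzpos : 0 < u z - φ z := hpos1.trans_le (hmax (mem_halfPlane.2 ht₁))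
  have hz1 : 0 < z.1 := by
    rcases (mem_halfPlane.1 hz).eq_or_lt with h | h
    · exfalso
      have h1 := hgK' z.2 y
      have h2 : u z = g z.2 := by rw [← hu0, h]
      simp only [φ, ← h] at hzpos
      rw [h2] at hzpos
      linarith
    · exact h
  obtain ⟨q, hq, hqd⟩ := exists_hasDerivAt_japanese (z.2 - y)
  have hfin := hsub.le_of_hasDerivAt hφ hz1 (hmax.isLocalMax (halfPlane_mem_nhds hz1))
    (a := C + |Wb| + 1 + κ * (2 * z.1)) (b := K * q) (by
      have h := (((hasDerivAt_id z.1).const_mul (C + |Wb| + 1)).const_add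
        (g y + η + K * (japanese (z.2 - y) - 1))).add
        (((hasDerivAt_id z.1).pow 2).const_mul κ)
      refine h.congr_deriv ?_
      simp) (by
      have h := (((((hqd.comp_sub_const z.2 y).sub_const 1).const_mul K).const_add
        (g y + η)).add_const ((C + |Wb| + 1) * z.1)).add_const (κ * z.1 ^ 2)
      exact h)
  have h1 : |G (K * q)| ≤ C := hC _ (by
    rw [abs_mul, abs_of_pos hK0]; nlinarith)
  have h2 := (hw z.2).trans (le_abs_self Wb)
  have h3 := (abs_le.1 h1).1
  have h4 := (abs_le.1 h2).1
  have h5 : 0 < κ * (2 * z.1) := by positivity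
  linarith

end DoubleWellHJ

/-! ### The perturbed test function argument -/

namespace DoubleWellHJ

/-- Approximate correctors, from the supersolution side, at every slope. -/
def HasSuperCorrectors (G W H : ℝ → ℝ) : Prop :=
  ∀ Θ : ℝ, ∃ C : ℝ, 0 ≤ C ∧ ∀ θ, |θ| ≤ Θ → ∀ δ > 0, ∀ R > 0, ∃ ε₀ > 0, ∀ ε, 0 < ε → ε < ε₀ →
    ∃ f : ℝ → ℝ, (∀ x y, |f x - f y| ≤ C * |x - y|) ∧ (∀ x, |x| ≤ R → |f x - θ * x| ≤ δ) ∧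
      ∀ y p, IsProxSubgradient f y p → H θ - δ ≤ G p + W (y / ε)

lemma exists_modulus_on_Icc {G : ℝ → ℝ} (hG : Continuous G) (K : ℝ) {κ : ℝ} (hκ : 0 < κ) :
    ∃ r : ℝ, 0 < r ∧ ∀ p p', |p| ≤ K → |p'| ≤ r → |G (p' + p) - G p| ≤ κ := by
  have huc := (isCompact_Icc (a := -(K + 1)) (b := K + 1)).uniformContinuousOn_of_continuous
    hG.continuousOn
  obtain ⟨δ, hδ, h⟩ := Metric.uniformContinuousOn_iff.1 huc κ hκ
  refine ⟨min (δ / 2) 1, by positivity, fun p p' hp hp' => ?_⟩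
  have h1 := hp'.trans (min_le_left _ _)
  have h2 := hp'.trans (min_le_right _ _)
  have h3 := abs_add_le p' p
  have := h (p' + p) (mem_Icc.2 (abs_le.1 (by linarith))) p (mem_Icc.2 (abs_le.1 (by linarith)))
    (by rw [Real.dist_eq, add_sub_cancel_right]; linarith)
  rw [Real.dist_eq] at this
  exact this.le

/-- Perturbed test function method. In the limit the doubled maximum makes `ubar` satisfy its
equation with slope θ at w₀; adding a corrector of slope θ to the test function for `u n` near z₀
gives the opposite inequality with a surplus coming from the time penalty `κ₁`. -/
lemma false_of_doubled_max {G W H : ℝ → ℝ} (hG : Continuous G) (hW : Continuous W)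
    {u : ℕ → ℝ × ℝ → ℝ} {ubar : ℝ × ℝ → ℝ} {ε : ℕ → ℝ}
    (hε : ∀ n, 0 < ε n) (hε0 : Tendsto ε atTop (𝓝 0))
    (hu : ∀ n, ContinuousOn (u n) halfPlane)
    (hsub : ∀ n, IsViscositySubsolution (fun x p => G p + W (x / ε n)) (u n))
    (hubar : ContinuousOn ubar halfPlane)
    (hsup : IsViscositySupersolution (fun _ p => H p) ubar)
    {N κ₁ κ₂ C r₁ : ℝ} (hN : 0 < N) (hκ₁ : 0 < κ₁) (hκ₂ : 0 < κ₂) (hC : 0 ≤ C) (hr₁ : 0 < r₁)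
    (hmod : ∀ p p', |p| ≤ 2 * C → |p'| ≤ r₁ → |G (p' + p) - G p| ≤ κ₁ / 4) (hκr : κ₂ ≤ r₁ / 2)
    {z w : ℕ → ℝ × ℝ} {z₀ w₀ : ℝ × ℝ} (hz₀ : 0 < z₀.1) (hw₀ : 0 < w₀.1)
    (hz : Tendsto z atTop (𝓝 z₀)) (hw : Tendsto w atTop (𝓝 w₀))
    (hzh : ∀ n, z n ∈ halfPlane) (hwh : ∀ n, w n ∈ halfPlane)
    (hmax : ∀ n, ∀ a ∈ halfPlane, ∀ b ∈ halfPlane,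
      u n a - ubar b - N * ((a.2 - b.2) ^ 2 + (a.1 - b.1) ^ 2) -
        (κ₁ * (a.1 + a.1 ^ 2) + κ₂ * japanese a.2) ≤
      u n (z n) - ubar (w n) - N * (((z n).2 - (w n).2) ^ 2 + ((z n).1 - (w n).1) ^ 2) -
        (κ₁ * ((z n).1 + (z n).1 ^ 2) + κ₂ * japanese (z n).2))
    (hcorr : ∀ δ > 0, ∀ R > 0, ∃ ε₀ > 0, ∀ ε, 0 < ε → ε < ε₀ →
      ∃ f : ℝ → ℝ, (∀ x y, |f x - f y| ≤ C * |x - y|) ∧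
        (∀ x, |x| ≤ R → |f x - (2 * N * (z₀.2 - w₀.2)) * x| ≤ δ) ∧
        ∀ y p, IsProxSubgradient f y p →
          H (2 * N * (z₀.2 - w₀.2)) - δ ≤ G p + W (y / ε)) : False := by
  set θ := 2 * N * (z₀.2 - w₀.2) with hθ
  have hw₀h : w₀ ∈ halfPlane := mem_halfPlane.2 hw₀.le
  have hubw : Tendsto (fun n => ubar (w n)) atTop (𝓝 (ubar w₀)) :=
    (hubar w₀ hw₀h).tendsto.comp (tendsto_nhdsWithin_iff.2 ⟨hw, Eventually.of_forall hwh⟩)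
  have hz1 : Tendsto (fun n => (z n).1) atTop (𝓝 z₀.1) := (continuous_fst.tendsto z₀).comp hz
  have hz2 : Tendsto (fun n => (z n).2) atTop (𝓝 z₀.2) := (continuous_snd.tendsto z₀).comp hz
  have hw1 : Tendsto (fun n => (w n).1) atTop (𝓝 w₀.1) := (continuous_fst.tendsto w₀).comp hw
  have hw2 : Tendsto (fun n => (w n).2) atTop (𝓝 w₀.2) := (continuous_snd.tendsto w₀).comp hw
  have hsq : ∀ b : ℝ × ℝ, Tendsto (fun n => N * (((z n).2 - b.2) ^ 2 + ((z n).1 - b.1) ^ 2)) atTop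
      (𝓝 (N * ((z₀.2 - b.2) ^ 2 + (z₀.1 - b.1) ^ 2))) := fun b =>
    (((hz2.sub_const b.2).pow 2).add ((hz1.sub_const b.1).pow 2)).const_mul N
  have hsq' : Tendsto (fun n => N * (((z n).2 - (w n).2) ^ 2 + ((z n).1 - (w n).1) ^ 2)) atTop
      (𝓝 (N * ((z₀.2 - w₀.2) ^ 2 + (z₀.1 - w₀.1) ^ 2))) :=
    (((hz2.sub hw2).pow 2).add ((hz1.sub hw1).pow 2)).const_mul N
  -- With the first variable frozen at `z n` the values of `u n` cancel, so maximality in the second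
  -- variable passes to the limit although the `u n` are not known to converge.
  have hstepA : 0 ≤ 2 * N * (z₀.1 - w₀.1) + H θ := by
    let φ : ℝ × ℝ → ℝ := fun b => -(N * ((z₀.2 - b.2) ^ 2 + (z₀.1 - b.1) ^ 2))
    have hφ : ContDiff ℝ 1 φ := by simp only [φ]; fun_prop
    have hmin : IsLocalMin (fun b => ubar b - φ b) w₀ := by
      filter_upwards [halfPlane_mem_nhds hw₀] with b hb
      have h1 : ∀ n, ubar (w n) + N * (((z n).2 - (w n).2) ^ 2 + ((z n).1 - (w n).1) ^ 2) ≤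
          ubar b + N * (((z n).2 - b.2) ^ 2 + ((z n).1 - b.1) ^ 2) := fun n => by
        have := hmax n (z n) (hzh n) b hb
        linarith
      have h2 := le_of_tendsto_of_tendsto' (hubw.add hsq') (tendsto_const_nhds.add (hsq b)) h1
      simp only [φ]
      linarith
    refine hsup.le_of_hasDerivAt hφ hw₀ hmin ?_ ?_
    · have h := ((((hasDerivAt_id w₀.1).const_sub z₀.1).pow 2).const_add
        ((z₀.2 - w₀.2) ^ 2)).const_mul (-N)
      refine (h.congr_deriv (g' := 2 * N * (z₀.1 - w₀.1)) (by simp; ring)).congr_of_eventuallyEq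
        (Eventually.of_forall fun t => ?_)
      simp [φ]
    · have h := ((((hasDerivAt_id w₀.2).const_sub z₀.2).pow 2).add_const
        ((z₀.1 - w₀.1) ^ 2)).const_mul (-N)
      refine (h.congr_deriv (g' := θ) (by simp [hθ]; ring)).congr_of_eventuallyEq
        (Eventually.of_forall fun t => ?_)
      simp [φ]
  obtain ⟨r, hr, hr1, hrz, hrκ, hrr⟩ : ∃ r > 0, r ≤ 1 ∧ r < z₀.1 ∧ (2 * N + 2) * r ≤ κ₁ / 4 ∧
      (2 * N + 2) * r ≤ r₁ / 2 := by
    have hN2 : 0 < 2 * N + 2 := by positivity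
    refine ⟨min (min 1 (z₀.1 / 2)) (min (κ₁ / 4 / (2 * N + 2)) (r₁ / 2 / (2 * N + 2))),
      by positivity, (min_le_left _ _).trans (min_le_left _ _),
      ((min_le_left _ _).trans (min_le_right _ _)).trans_lt (by linarith), ?_, ?_⟩
    · rw [mul_comm, ← le_div_iff₀ hN2]
      exact (min_le_right _ _).trans (min_le_left _ _)
    · rw [mul_comm, ← le_div_iff₀ hN2]
      exact (min_le_right _ _).trans (min_le_right _ _)
  -- Replacing θx by the corrector costs at most 2δ ≤ r²/4, which the added squared distance to z₀
  -- outweighs: the perturbed maximum stays inside the ball of radius r.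
  set δ := min (κ₁ / 8) (r ^ 2 / 8) with hδ
  have hδ0 : 0 < δ := by positivity
  have hδκ : δ ≤ κ₁ / 8 := min_le_left _ _
  have hδr : δ ≤ r ^ 2 / 8 := min_le_right _ _
  obtain ⟨ε₀, hε₀, hc⟩ := hcorr δ hδ0 (|z₀.2| + 1) (by positivity)
  have he : Tendsto (fun n => ubar w₀ - ubar (w n) +
      N * (((z n).2 - w₀.2) ^ 2 + ((z n).1 - w₀.1) ^ 2) -
      N * (((z n).2 - (w n).2) ^ 2 + ((z n).1 - (w n).1) ^ 2)) atTop (𝓝 0) := by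
    have := ((hubw.const_sub (ubar w₀)).add (hsq w₀)).sub hsq'
    simpa using this
  have he' : Tendsto (fun n => ((z n).1 - z₀.1) ^ 2 + ((z n).2 - z₀.2) ^ 2) atTop (𝓝 0) := by
    have := ((hz1.sub_const z₀.1).pow 2).add ((hz2.sub_const z₀.2).pow 2)
    simpa using this
  obtain ⟨n, hn1, hn2, hn3, hn4⟩ := ((he.eventually_lt_const
      (show (0 : ℝ) < r ^ 2 / 8 by positivity)).and
    ((he'.eventually_lt_const (show (0 : ℝ) < r ^ 2 / 8 by positivity)).and
    ((hε0.eventually_lt_const hε₀).and (hz.eventually (Metric.closedBall_mem_nhds z₀ hr))))).exists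
  obtain ⟨f, hf1, hf2, hf3⟩ := hc (ε n) (hε n) hn3
  let Ψ : ℝ × ℝ → ℝ := fun a => N * ((a.2 - w₀.2) ^ 2 + (a.1 - w₀.1) ^ 2) +
    (κ₁ * (a.1 + a.1 ^ 2) + κ₂ * japanese a.2) + ((a.1 - z₀.1) ^ 2 + (a.2 - z₀.2) ^ 2) - θ * a.2
  have hΨ : ContDiff ℝ 1 Ψ := by
    have : ContDiff ℝ 1 (fun z : ℝ × ℝ => japanese z.2) := contDiff_japanese.comp contDiff_snd
    simp only [Ψ]; fun_prop
  have hball : Metric.closedBall z₀ r ⊆ halfPlane := by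
    intro p hp
    have h1 : dist p.1 z₀.1 ≤ r := (le_max_left _ _).trans (Metric.mem_closedBall.1 hp)
    rw [Real.dist_eq, abs_le] at h1
    exact mem_halfPlane.2 (by linarith)
  have hfc := continuous_of_abs_sub_le hf1
  have hJ : ContinuousOn (fun a => u n a - Ψ a - f a.2) (Metric.closedBall z₀ r) :=
    (((hu n).mono hball).sub hΨ.continuous.continuousOn).sub
      (hfc.comp continuous_snd).continuousOn
  obtain ⟨a, haB, hamax⟩ := (isCompact_closedBall z₀ r).exists_isMaxOn
    ⟨z₀, Metric.mem_closedBall_self hr.le⟩ hJ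
  have hcoord : ∀ b ∈ Metric.closedBall z₀ r, |b.1 - z₀.1| ≤ r ∧ |b.2 - z₀.2| ≤ r := by
    intro b hb
    have h := Metric.mem_closedBall.1 hb
    rw [Prod.dist_eq, Real.dist_eq, Real.dist_eq] at h
    exact ⟨(le_max_left _ _).trans h, (le_max_right _ _).trans h⟩
  have hfθ : ∀ b ∈ Metric.closedBall z₀ r, |f b.2 - θ * b.2| ≤ δ := by
    intro b hb
    refine hf2 b.2 ?_
    have h1 := (hcoord b hb).2
    have h2 := abs_sub_abs_le_abs_sub b.2 z₀.2
    linarith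
  have hnear : (a.1 - z₀.1) ^ 2 + (a.2 - z₀.2) ^ 2 < r ^ 2 := by
    have h1 : u n (z n) - Ψ (z n) - f (z n).2 ≤ u n a - Ψ a - f a.2 := hamax hn4
    have h2 := hmax n a (hball haB) w₀ hw₀h
    have h3 := abs_le.1 (hfθ a haB)
    have h4 := abs_le.1 (hfθ (z n) hn4)
    simp only [Ψ] at h1
    linarith
  have ha1 : |a.1 - z₀.1| < r := abs_lt_of_sq_lt_sq (by have := sq_nonneg (a.2 - z₀.2); linarith) hr.le
  have ha2 : |a.2 - z₀.2| < r := abs_lt_of_sq_lt_sq (by have := sq_nonneg (a.1 - z₀.1); linarith) hr.le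
  have hain : a ∈ Metric.ball z₀ r := by
    rw [Metric.mem_ball, Prod.dist_eq, Real.dist_eq, Real.dist_eq]
    exact max_lt ha1 ha2
  have ha0 : 0 < a.1 := by have := (abs_lt.1 ha1).1; linarith
  have hlm : IsLocalMax (fun b => u n b - Ψ b - f b.2) a := by
    filter_upwards [Metric.isOpen_ball.mem_nhds hain] with b hb
    exact hamax (Metric.ball_subset_closedBall hb)
  obtain ⟨p, hp, hp1, hp2⟩ := exists_slope_of_isLocalMax hG
    (hW.comp (continuous_id.div_const (ε n))) (hu n) (hsub n) hΨ hC hf1 hf3 ha0 hlm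
  obtain ⟨q, hq, hqd⟩ := exists_hasDerivAt_japanese a.2
  have hd1 : fderiv ℝ Ψ a (1, 0) =
      2 * N * (a.1 - w₀.1) + κ₁ * (1 + 2 * a.1) + 2 * (a.1 - z₀.1) := by
    refine (hasDerivAt_fst_of_contDiff hΨ a).unique ?_
    have h := (((((((hasDerivAt_id a.1).sub_const w₀.1).pow 2).const_add
      ((a.2 - w₀.2) ^ 2)).const_mul N).add ((((hasDerivAt_id a.1).add
      ((hasDerivAt_id a.1).pow 2)).const_mul κ₁).add_const (κ₂ * japanese a.2))).add
      ((((hasDerivAt_id a.1).sub_const z₀.1).pow 2).add_const ((a.2 - z₀.2) ^ 2))).sub_const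
      (θ * a.2)
    refine h.congr_deriv ?_
    simp; ring
  have hd2 : fderiv ℝ Ψ a (0, 1) =
      2 * N * (a.2 - w₀.2) + κ₂ * q + 2 * (a.2 - z₀.2) - θ := by
    refine (hasDerivAt_snd_of_contDiff hΨ a).unique ?_
    have h := (((((((hasDerivAt_id a.2).sub_const w₀.2).pow 2).add_const
      ((a.1 - w₀.1) ^ 2)).const_mul N).add
      ((hqd.const_mul κ₂).const_add (κ₁ * (a.1 + a.1 ^ 2)))).add
      ((((hasDerivAt_id a.2).sub_const z₀.2).pow 2).const_add ((a.1 - z₀.1) ^ 2))).sub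
      ((hasDerivAt_id a.2).const_mul θ)
    refine h.congr_deriv ?_
    simp; ring
  have hslope : |fderiv ℝ Ψ a (0, 1)| ≤ r₁ := by
    rw [hd2]
    have h3 : 2 * N * (a.2 - w₀.2) + κ₂ * q + 2 * (a.2 - z₀.2) - θ =
      (2 * N + 2) * (a.2 - z₀.2) + κ₂ * q := by rw [hθ]; ring
    have h1 : |(2 * N + 2) * (a.2 - z₀.2)| ≤ (2 * N + 2) * r := by
      rw [abs_mul, abs_of_pos (show 0 < 2 * N + 2 by positivity)]
      exact mul_le_mul_of_nonneg_left ha2.le (by positivity)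
    have h2 : |κ₂ * q| ≤ κ₂ := by
      rw [abs_mul, abs_of_pos hκ₂]
      exact mul_le_of_le_one_right hκ₂.le hq
    rw [h3]
    exact (abs_add_le _ _).trans (by linarith)
  -- The surplus κ₁ exceeds the losses: κ₁/4 from the modulus of `G`, (2N + 2) r ≤ κ₁/4 from the
  -- distance between a and z₀, and δ ≤ κ₁/8 from the corrector.
  have hm := (abs_le.1 (hmod p _ hp hslope)).1
  rw [hd1] at hp1
  have h1 : (2 * N + 2) * (-r) ≤ (2 * N + 2) * (a.1 - z₀.1) :=
    mul_le_mul_of_nonneg_left (abs_lt.1 ha1).1.le (by positivity)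
  have h2 : 2 * N * (a.1 - w₀.1) + 2 * (a.1 - z₀.1) =
    2 * N * (z₀.1 - w₀.1) + (2 * N + 2) * (a.1 - z₀.1) := by ring
  have h3 : 0 ≤ κ₁ * (2 * a.1) := by positivity
  simp only [Function.comp_apply, id_eq] at hp1 hp2
  rw [mul_neg] at h1
  rw [mul_add, mul_one] at hp1
  linarith

end DoubleWellHJ

/-! ### The one-sided comparison -/

namespace DoubleWellHJ

/-- The upper half of homogenization. If it failed along a sequence of scales, the doubled and
penalised differences would have maximisers in a fixed compact set, away from time 0, and a
convergent subsequence would contradict `false_of_doubled_max`. -/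
theorem exists_forall_le_add_of_superCorrectors {G W H g : ℝ → ℝ} (hG : Continuous G)
    (hW : Continuous W) {Wb : ℝ} (hWb : ∀ x, |W x| ≤ Wb) (hcorr : HasSuperCorrectors G W H)
    {u : ℝ → ℝ × ℝ → ℝ} {ubar : ℝ × ℝ → ℝ}
    (hu : ∀ ε, 0 < ε → UniformContinuousOn (u ε) halfPlane)
    (hu0 : ∀ ε, 0 < ε → ∀ x, u ε (0, x) = g x)
    (hsub : ∀ ε, 0 < ε → IsViscositySubsolution (fun x p => G p + W (x / ε)) (u ε))
    (hub : UniformContinuousOn ubar halfPlane) (hub0 : ∀ x, ubar (0, x) = g x)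
    (hsup : IsViscositySupersolution (fun _ p => H p) ubar)
    {ρ₀ η : ℝ} (hρ₀ : 0 < ρ₀) (hη : 0 < η) :
    ∃ ε₀ > 0, ∀ ε, 0 < ε → ε < ε₀ → ∀ z ∈ halfPlane, dist z 0 ≤ ρ₀ →
      u ε z ≤ ubar z + 2 * η := by
  have hg : UniformContinuous g := by
    rw [Metric.uniformContinuous_iff]
    intro e he
    obtain ⟨δ, hδ, h⟩ := Metric.uniformContinuousOn_iff.1 hub e he
    refine ⟨δ, hδ, fun {x y} hxy => ?_⟩
    have := h (0, x) (mem_halfPlane.2 le_rfl) (0, y) (mem_halfPlane.2 le_rfl)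
      (by rw [Prod.dist_eq, dist_self]; exact max_lt hδ hxy)
    rwa [hub0, hub0] at this
  obtain ⟨C, hC0, hC⟩ := exists_barrier hG hg Wb (show 0 < η / 4 by positivity)
  obtain ⟨B, hB0, hB⟩ := exists_affine_bound_of_uniformContinuousOn convex_halfPlane hub
  obtain ⟨ρ', hρ', hmodu⟩ := Metric.uniformContinuousOn_iff.1 hub (η / 4) (by positivity)
  -- Before time ρ the barrier and the modulus of `ubar` leave an excess below 3η/4, so a maximiser
  -- with excess η occurs later.
  obtain ⟨ρ, hρ, hρρ', hCρ⟩ : ∃ ρ > 0, 2 * ρ ≤ ρ' ∧ C * ρ ≤ η / 4 := by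
    refine ⟨min (ρ' / 2) (η / 4 / (C + 1)), by positivity, ?_, ?_⟩
    · have := min_le_left (ρ' / 2) (η / 4 / (C + 1)); linarith
    · have h1 := min_le_right (ρ' / 2) (η / 4 / (C + 1))
      rw [le_div_iff₀ (by positivity)] at h1
      have : 0 < min (ρ' / 2) (η / 4 / (C + 1)) := by positivity
      linarith
  set r := ρ / 2 with hr
  have hr0 : 0 < r := by positivity
  -- A coupling of this strength keeps the two maximising points within distance r of each other, so
  -- the limiting slope is at most 2Nr in absolute value.
  obtain ⟨N, hN, hN0⟩ : ∃ N : ℝ, 1 / r ^ 2 + B / r < N ∧ 0 < N :=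
    ⟨1 / r ^ 2 + B / r + 1, by linarith, by positivity⟩
  set κ₁ := η / (2 * (ρ₀ + ρ₀ ^ 2)) with hκ₁
  have hκ₁0 : 0 < κ₁ := by positivity
  have hκ₁ρ : κ₁ * (ρ₀ + ρ₀ ^ 2) = η / 2 := by rw [hκ₁]; field_simp
  -- Only a bound on the slope is known here, and `κ₂` must be fixed from the Lipschitz constant
  -- before the limiting slope is known. This is why the corrector constant has to be uniform over
  -- bounded slopes.
  obtain ⟨C₀, hC₀, hcor⟩ := hcorr (2 * N * r)
  obtain ⟨r₁, hr₁, hmod⟩ := exists_modulus_on_Icc hG (2 * C₀) (show 0 < κ₁ / 4 by positivity)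
  set κ₂ := min (r₁ / 2) (η / (2 * (1 + ρ₀))) with hκ₂
  have hκ₂0 : 0 < κ₂ := by positivity
  have hκ₂ρ : κ₂ * (1 + ρ₀) ≤ η / 2 := by
    have h1 : κ₂ ≤ η / (2 * (1 + ρ₀)) := min_le_right _ _
    have h2 : η / (2 * (1 + ρ₀)) * (1 + ρ₀) = η / 2 := by field_simp
    rw [← h2]
    exact mul_le_mul_of_nonneg_right h1 (by positivity)
  by_contra! hcon
  have h0 : ∀ n : ℕ, (0 : ℝ) < 1 / ((n : ℝ) + 1) := fun n => Nat.one_div_pos_of_nat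
  choose ε hε hεn b hb hbρ hbad using fun n : ℕ => hcon _ (h0 n)
  have hε0 : Tendsto ε atTop (𝓝 0) := squeeze_zero (fun n => (hε n).le) (fun n => (hεn n).le)
    (tendsto_one_div_add_atTop_nhds_zero_nat (𝕜 := ℝ))
  let Φ : ℕ → (ℝ × ℝ) × (ℝ × ℝ) → ℝ := fun n Z => u (ε n) Z.1 - ubar Z.2 -
    N * ((Z.1.2 - Z.2.2) ^ 2 + (Z.1.1 - Z.2.1) ^ 2) -
      (κ₁ * (Z.1.1 + Z.1.1 ^ 2) + κ₂ * japanese Z.1.2)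
  have hΦc : ∀ n, ContinuousOn (Φ n) (halfPlane ×ˢ halfPlane) := by
    intro n
    have h1 : ContinuousOn (fun Z : (ℝ × ℝ) × (ℝ × ℝ) => u (ε n) Z.1) (halfPlane ×ˢ halfPlane) :=
      (hu _ (hε n)).continuousOn.comp continuous_fst.continuousOn fun Z hZ => hZ.1
    have h2 : ContinuousOn (fun Z : (ℝ × ℝ) × (ℝ × ℝ) => ubar Z.2) (halfPlane ×ˢ halfPlane) :=
      hub.continuousOn.comp continuous_snd.continuousOn fun Z hZ => hZ.2
    have hj : Continuous japanese := contDiff_japanese.continuous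
    have h3 : Continuous (fun Z : (ℝ × ℝ) × (ℝ × ℝ) =>
        N * ((Z.1.2 - Z.2.2) ^ 2 + (Z.1.1 - Z.2.1) ^ 2)) := by fun_prop
    have h4 : Continuous (fun Z : (ℝ × ℝ) × (ℝ × ℝ) =>
        κ₁ * (Z.1.1 + Z.1.1 ^ 2) + κ₂ * japanese Z.1.2) := by fun_prop
    exact ((h1.sub h2).sub h3.continuousOn).sub h4.continuousOn
  have hΦb : ∀ n, η < Φ n (b n, b n) := by
    intro n
    have h1 := mem_halfPlane.1 (hb n)
    have h2 := hbρ n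
    rw [Prod.dist_eq, Real.dist_eq, Real.dist_eq] at h2
    simp only [Prod.fst_zero, Prod.snd_zero, sub_zero] at h2
    have h3 : (b n).1 ≤ ρ₀ := (le_abs_self _).trans ((le_max_left _ _).trans h2)
    have h4 : |(b n).2| ≤ ρ₀ := (le_max_right _ _).trans h2
    have h5 : κ₁ * ((b n).1 + (b n).1 ^ 2) ≤ κ₁ * (ρ₀ + ρ₀ ^ 2) := by gcongr
    have h6 : κ₂ * japanese (b n).2 ≤ κ₂ * (1 + ρ₀) :=
      mul_le_mul_of_nonneg_left ((japanese_le _).trans (by linarith)) hκ₂0.le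
    have h7 := hbad n
    simp only [Φ, sub_self]
    linarith
  -- The three fractions are the largest values of the linear growth terms in t, x - y and t - s
  -- against their quadratic penalties.
  set c₁ := η / 4 + 1 + (C + B + 1) ^ 2 / (4 * κ₁) + (B + 1) ^ 2 / (4 * N) +
    (B + 1) ^ 2 / (4 * N) with hc₁
  have hbound : ∀ n, ∀ Z ∈ halfPlane ×ˢ halfPlane, 0 < Φ n Z →
      Z.1.1 + |Z.1.2 - Z.2.2| + |Z.1.1 - Z.2.1| + κ₂ * |Z.1.2| ≤ c₁ := by
    rintro n ⟨⟨t, x⟩, ⟨s, y⟩⟩ ⟨hz, hw⟩ hpos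
    have ht : 0 ≤ t := mem_halfPlane.1 hz
    have hs : 0 ≤ s := mem_halfPlane.1 hw
    have h1 := hC (fun x => W (x / ε n)) (u (ε n)) (fun x => hWb _) (hu _ (hε n)) (hu0 _ (hε n))
      (hsub _ (hε n)) t x ht
    have h2 := (abs_le.1 (hB (0, x) (mem_halfPlane.2 le_rfl) (s, y) hw)).2
    rw [hub0, Prod.dist_eq, Real.dist_eq, Real.dist_eq, zero_sub, abs_neg, abs_of_nonneg hs] at h2
    have h3 : max s |x - y| ≤ t + |t - s| + |x - y| := by
      have := neg_abs_le (t - s)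
      have h5 := abs_nonneg (x - y)
      exact max_le (by linarith) (by linarith [abs_nonneg (t - s)])
    have h4 := mul_le_mul_of_nonneg_left h3 hB0
    have h5 := linear_sub_sq_le (A := C + B + 1) (t := t) hκ₁0
    have h6 := linear_sub_sq_le (A := B + 1) (t := |x - y|) hN0
    have h7 := linear_sub_sq_le (A := B + 1) (t := |t - s|) hN0
    have h8 := mul_le_mul_of_nonneg_left (abs_le_japanese x) hκ₂0.le
    simp only [Φ] at hpos
    rw [sq_abs] at h6 h7
    have h9 : 0 ≤ κ₁ * t := by positivity
    simp only
    rw [hc₁]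
    linarith
  set M₀ := c₁ + c₁ / κ₂ with hM₀
  have hK : ∀ n, ∀ Z ∈ halfPlane ×ˢ halfPlane, 0 < Φ n Z →
      Z ∈ (Icc 0 M₀ ×ˢ Icc (-M₀) M₀) ×ˢ (Icc 0 M₀ ×ˢ Icc (-M₀) M₀) := by
    rintro n ⟨⟨t, x⟩, ⟨s, y⟩⟩ hZ hpos
    have h1 := hbound n _ hZ hpos
    have ht : 0 ≤ t := mem_halfPlane.1 hZ.1
    have hs : 0 ≤ s := mem_halfPlane.1 hZ.2
    simp only at h1
    have h2 := abs_nonneg (x - y)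
    have h3 := abs_nonneg (t - s)
    have h4 : 0 ≤ κ₂ * |x| := by positivity
    have h5 : |x| ≤ c₁ / κ₂ := by rw [le_div_iff₀ hκ₂0]; linarith
    have h6 := neg_abs_le (t - s)
    have h7 : 0 ≤ c₁ / κ₂ := (abs_nonneg x).trans h5
    have h8 := abs_le.1 h5
    have h9 := neg_abs_le (x - y)
    have h10 := le_abs_self (x - y)
    refine ⟨⟨⟨ht, ?_⟩, ⟨?_, ?_⟩⟩, ⟨hs, ?_⟩, ⟨?_, ?_⟩⟩ <;> simp only <;> linarith
  have hKc : IsCompact ((Icc 0 M₀ ×ˢ Icc (-M₀) M₀) ×ˢ (Icc 0 M₀ ×ˢ Icc (-M₀) M₀) :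
      Set ((ℝ × ℝ) × (ℝ × ℝ))) :=
    (isCompact_Icc.prod isCompact_Icc).prod (isCompact_Icc.prod isCompact_Icc)
  choose Z hZ hZK hZmax using fun n => exists_isMaxOn_of_superlevel_subset
    (isClosed_halfPlane.prod isClosed_halfPlane) hKc (hΦc n) (z₀ := (b n, b n))
    ⟨hb n, hb n⟩ (fun Z hZ hle => hK n Z hZ ((hη.trans (hΦb n)).trans_le hle))
  have hZpos : ∀ n, η < Φ n (Z n) := fun n => (hΦb n).trans_le (hZmax n ⟨hb n, hb n⟩)
  have hpen : ∀ n, η < u (ε n) (Z n).1 - ubar (Z n).2 := by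
    intro n
    have h1 := hZpos n
    have h2 : 0 ≤ (Z n).1.1 := mem_halfPlane.1 (hZ n).1
    have h3 := one_le_japanese (Z n).1.2
    have h4 : 0 ≤ N * (((Z n).1.2 - (Z n).2.2) ^ 2 + ((Z n).1.1 - (Z n).2.1) ^ 2) := by positivity
    have h5 : 0 ≤ κ₁ * ((Z n).1.1 + (Z n).1.1 ^ 2) + κ₂ * japanese (Z n).1.2 := by positivity
    simp only [Φ] at h1
    linarith
  have hdist : ∀ n, dist (Z n).1 (Z n).2 ≤ r := by
    intro n
    have h1 : Φ n ((Z n).1, (Z n).1) ≤ Φ n (Z n) := hZmax n ⟨(hZ n).1, (hZ n).1⟩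
    have h2 := (abs_le.1 (hB _ (hZ n).1 _ (hZ n).2)).2
    simp only [Φ, sub_self] at h1
    set d := dist (Z n).1 (Z n).2 with hd
    have h3 : d ^ 2 ≤ ((Z n).1.2 - (Z n).2.2) ^ 2 + ((Z n).1.1 - (Z n).2.1) ^ 2 := by
      rw [hd, Prod.dist_eq, Real.dist_eq, Real.dist_eq]
      rcases max_choice |(Z n).1.1 - (Z n).2.1| |(Z n).1.2 - (Z n).2.2| with h | h <;>
        rw [h, sq_abs] <;> nlinarith [sq_nonneg ((Z n).1.1 - (Z n).2.1),
          sq_nonneg ((Z n).1.2 - (Z n).2.2)]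
    by_contra! hlt
    have h4 : N * d ^ 2 ≤ 1 + B * d := by
      have := mul_le_mul_of_nonneg_left h3 hN0.le
      linarith
    have hd0 : 0 < d := hr0.trans hlt
    have h5 : 1 ≤ 1 / r ^ 2 * d ^ 2 := by
      rw [one_div, ← div_eq_inv_mul, le_div_iff₀ (by positivity), one_mul]
      exact pow_le_pow_left₀ hr0.le hlt.le 2
    have h6 : B * d ≤ B / r * d ^ 2 := by
      have : B / r * d ^ 2 = B * d * (d / r) := by ring
      rw [this]
      exact le_mul_of_one_le_right (by positivity) ((one_le_div hr0).2 hlt.le)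
    have h7 : (1 / r ^ 2 + B / r) * d ^ 2 < N * d ^ 2 :=
      mul_lt_mul_of_pos_right hN (by positivity)
    rw [add_mul] at h7
    linarith
  have htime : ∀ n, ρ ≤ (Z n).1.1 := by
    intro n
    by_contra! hlt
    have ht : 0 ≤ (Z n).1.1 := mem_halfPlane.1 (hZ n).1
    have hs : 0 ≤ (Z n).2.1 := mem_halfPlane.1 (hZ n).2
    have h1 := hC (fun x => W (x / ε n)) (u (ε n)) (fun x => hWb _) (hu _ (hε n)) (hu0 _ (hε n))
      (hsub _ (hε n)) (Z n).1.1 (Z n).1.2 ht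
    have hd := hdist n
    rw [Prod.dist_eq, Real.dist_eq, Real.dist_eq] at hd
    have hd1 := abs_le.1 ((le_max_left _ _).trans hd)
    have hd2 := (le_max_right _ _).trans hd
    have h2 := hmodu (0, (Z n).1.2) (mem_halfPlane.2 le_rfl) (Z n).2 (hZ n).2 (by
      rw [Prod.dist_eq, Real.dist_eq, Real.dist_eq, zero_sub, abs_neg, abs_of_nonneg hs]
      exact max_lt (by linarith) (by linarith))
    rw [hub0, Real.dist_eq] at h2
    have h3 := (abs_lt.1 h2).2
    have h4 := hpen n
    have h5 := mul_le_mul_of_nonneg_left hlt.le hC0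
    rw [Prod.mk.eta] at h1
    linarith
  obtain ⟨Z₀, -, σ, hσ, hσZ⟩ := hKc.tendsto_subseq hZK
  have hz : Tendsto (fun n => (Z (σ n)).1) atTop (𝓝 Z₀.1) := (continuous_fst.tendsto Z₀).comp hσZ
  have hw : Tendsto (fun n => (Z (σ n)).2) atTop (𝓝 Z₀.2) := (continuous_snd.tendsto Z₀).comp hσZ
  have hZ₀1 : ρ ≤ Z₀.1.1 := ge_of_tendsto ((continuous_fst.tendsto Z₀.1).comp hz)
    (Eventually.of_forall fun n => htime (σ n))
  have hZ₀d : dist Z₀.1 Z₀.2 ≤ r := le_of_tendsto (hz.dist hw)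
    (Eventually.of_forall fun n => hdist (σ n))
  rw [Prod.dist_eq, Real.dist_eq, Real.dist_eq] at hZ₀d
  have hd1 := abs_le.1 ((le_max_left _ _).trans hZ₀d)
  have hd2 := (le_max_right _ _).trans hZ₀d
  refine false_of_doubled_max hG hW (u := fun n => u (ε (σ n))) (ε := fun n => ε (σ n))
    (fun n => hε _) (hε0.comp hσ.tendsto_atTop) (fun n => (hu _ (hε _)).continuousOn)
    (fun n => hsub _ (hε _)) hub.continuousOn hsup hN0 hκ₁0 hκ₂0 hC₀ hr₁ hmod
    (min_le_left _ _) (z₀ := Z₀.1) (w₀ := Z₀.2) (by linarith) (by linarith) hz hw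
    (fun n => (hZ _).1) (fun n => (hZ _).2) (fun n a ha c hc => ?_) (hcor _ ?_)
  · exact hZmax (σ n) (show (a, c) ∈ halfPlane ×ˢ halfPlane from ⟨ha, hc⟩)
  · rw [abs_mul, abs_of_pos (show 0 < 2 * N by positivity)]
    exact mul_le_mul_of_nonneg_left hd2 (by positivity)

end DoubleWellHJ

/-! ### From slope functions to homogenization -/

namespace DoubleWellHJ

/-- The slope function `q` has one-sided limits everywhere and its primitive solves
`G (f') + W = lam` up to an error `δ`, in the viscosity sense. -/
def IsSlope (G W : ℝ → ℝ) (lam δ : ℝ) (q : ℝ → ℝ) : Prop :=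
  ∀ y, ∃ l r, Tendsto q (𝓝[<] y) (𝓝 l) ∧ Tendsto q (𝓝[>] y) (𝓝 r) ∧
    (∀ p ∈ Icc l r, lam - δ ≤ G p + W y) ∧ (∀ p ∈ Icc r l, G p + W y ≤ lam + δ)

/-- At every mean slope `θ` there are, on large windows, approximate correctors at height `H θ`. -/
def HasSlopes (G W H : ℝ → ℝ) : Prop :=
  ∀ Θ : ℝ, ∃ C : ℝ, 0 ≤ C ∧ ∀ θ, |θ| ≤ Θ → ∀ δ > 0, ∃ X₀ > 0, ∀ L, X₀ ≤ L →
    ∃ q : ℝ → ℝ, Measurable q ∧ (∀ x, |q x| ≤ C) ∧ IsSlope G W (H θ) δ q ∧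
      ∀ x, |x| ≤ L → |(∫ t in (0 : ℝ)..x, q t) - θ * x| ≤ δ * L

lemma intervalIntegrable_of_bound {q : ℝ → ℝ} (hq : Measurable q) {C : ℝ} (hC : ∀ x, |q x| ≤ C)
    (a b : ℝ) : IntervalIntegrable q volume a b := by
  refine (intervalIntegrable_const (c := C)).mono_fun hq.aestronglyMeasurable ?_
  exact Eventually.of_forall fun x => by
    rw [Real.norm_eq_abs]; exact (hC x).trans (le_abs_self C)

lemma abs_intervalIntegral_le {q : ℝ → ℝ} {C : ℝ} (hC : ∀ x, |q x| ≤ C) (a b : ℝ) :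
    |∫ t in a..b, q t| ≤ C * |b - a| :=
  intervalIntegral.norm_integral_le_of_norm_le_const (f := q) (C := C) fun x _ => hC x

/-- The primitive of `q` has one-sided derivatives l and r at y, and a proximal subgradient lies
between them. When l > r the interval is empty: a concave kink has no subgradient. -/
lemma IsProxSubgradient.mem_Icc {q : ℝ → ℝ} (hq : Measurable q) {C : ℝ} (hC : ∀ x, |q x| ≤ C)
    {y p l r : ℝ} (hl : Tendsto q (𝓝[<] y) (𝓝 l)) (hr : Tendsto q (𝓝[>] y) (𝓝 r))
    (hp : IsProxSubgradient (fun x => ∫ t in (0 : ℝ)..x, q t) y p) : p ∈ Icc l r := by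
  obtain ⟨K, hK⟩ := hp
  have hmeas : ∀ t : Set ℝ, StronglyMeasurableAtFilter q (𝓝[t] y) := fun t =>
    hq.stronglyMeasurable.stronglyMeasurableAtFilter
  have hR : HasDerivWithinAt (fun x => ∫ t in (0 : ℝ)..x, q t) r (Ici y) y :=
    intervalIntegral.integral_hasDerivWithinAt_of_tendsto_ae_right
      (intervalIntegrable_of_bound hq hC _ _) (t := Ioi y) (hmeas _) (hr.mono_left inf_le_left)
  have hL : HasDerivWithinAt (fun x => ∫ t in (0 : ℝ)..x, q t) l (Iic y) y := by
    refine intervalIntegral.integral_hasDerivWithinAt_of_tendsto_ae_right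
      (intervalIntegrable_of_bound hq hC _ _) (t := Iic y) (hmeas _) (hl.mono_left ?_)
    have h1 : {y}ᶜ ∈ ae (volume : Measure ℝ) := by
      rw [mem_ae_iff, compl_compl]; exact measure_singleton y
    calc 𝓝[≤] y ⊓ ae volume ≤ 𝓝[≤] y ⊓ 𝓟 {y}ᶜ := inf_le_inf_left _ (le_principal_iff.2 h1)
      _ = 𝓝[<] y := by
        rw [nhdsWithin, inf_assoc, inf_principal, nhdsWithin]
        congr 2
        ext x
        simp [lt_iff_le_and_ne]
  constructor
  · have h := (hasDerivWithinAt_iff_tendsto_slope.1 hL)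
    have hset : (Iic y \ {y} : Set ℝ) = Iio y := by ext x; simp [lt_iff_le_and_ne]
    rw [hset] at h
    have h2 : Tendsto (fun x => p - K * (x - y)) (𝓝[<] y) (𝓝 (p - K * (y - y))) :=
      (Continuous.tendsto (by fun_prop) y).mono_left nhdsWithin_le_nhds
    rw [sub_self, mul_zero, sub_zero] at h2
    refine le_of_tendsto_of_tendsto h h2 ?_
    filter_upwards [self_mem_nhdsWithin, nhdsWithin_le_nhds hK] with x hx hxK
    rw [slope_def_field, div_le_iff_of_neg (sub_neg.2 hx)]
    nlinarith
  · have h := (hasDerivWithinAt_iff_tendsto_slope.1 hR)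
    have hset : (Ici y \ {y} : Set ℝ) = Ioi y := by
      ext x; simp only [Set.mem_sdiff, mem_Ici, mem_singleton_iff, mem_Ioi, lt_iff_le_and_ne]
      exact and_congr_right fun _ => ne_comm
    rw [hset] at h
    have h2 : Tendsto (fun x => p - K * (x - y)) (𝓝[>] y) (𝓝 (p - K * (y - y))) :=
      (Continuous.tendsto (by fun_prop) y).mono_left nhdsWithin_le_nhds
    rw [sub_self, mul_zero, sub_zero] at h2
    refine le_of_tendsto_of_tendsto h2 h ?_
    filter_upwards [self_mem_nhdsWithin, nhdsWithin_le_nhds hK] with x hx hxK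
    rw [slope_def_field, le_div_iff₀ (sub_pos.2 hx)]
    nlinarith

/-- Rescale the primitive to x ↦ ε ∫₀^{x/ε} q on the window L = R/ε. Relative precision δ/R on that
window becomes absolute precision δ on [-R, R]. -/
lemma HasSlopes.hasSuperCorrectors {G W H : ℝ → ℝ} (h : HasSlopes G W H) :
    HasSuperCorrectors G W H := by
  intro Θ
  obtain ⟨C, hC, h⟩ := h Θ
  refine ⟨C, hC, fun θ hθ δ hδ R hR => ?_⟩
  obtain ⟨X₀, hX₀, h⟩ := h θ hθ (min δ (δ / R)) (by positivity)
  refine ⟨R / X₀, by positivity, fun ε hε hεR => ?_⟩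
  have hL : X₀ ≤ R / ε := by
    rw [le_div_iff₀ hε]; rw [lt_div_iff₀ hX₀] at hεR; linarith
  obtain ⟨q, hq, hqC, hqs, hqθ⟩ := h (R / ε) hL
  refine ⟨fun x => ε * ∫ t in (0 : ℝ)..(x / ε), q t, fun x y => ?_, fun x hx => ?_,
    fun y p hp => ?_⟩
  · rw [← mul_sub, intervalIntegral.integral_interval_sub_left
      (intervalIntegrable_of_bound hq hqC _ _) (intervalIntegrable_of_bound hq hqC _ _), abs_mul,
      abs_of_pos hε]
    have h1 := abs_intervalIntegral_le hqC (y / ε) (x / ε)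
    have h2 : |x / ε - y / ε| = |x - y| / ε := by
      rw [← sub_div, abs_div, abs_of_pos hε]
    rw [h2] at h1
    calc ε * |∫ t in (y / ε)..(x / ε), q t| ≤ ε * (C * (|x - y| / ε)) :=
          mul_le_mul_of_nonneg_left h1 hε.le
      _ = C * |x - y| := by field_simp
  · have h1 := hqθ (x / ε) (by rw [abs_div, abs_of_pos hε]; gcongr)
    have h2 : (ε * ∫ t in (0 : ℝ)..(x / ε), q t) - θ * x =
      ε * ((∫ t in (0 : ℝ)..(x / ε), q t) - θ * (x / ε)) := by field_simp
    rw [h2, abs_mul, abs_of_pos hε]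
    calc _ ≤ ε * (min δ (δ / R) * (R / ε)) := mul_le_mul_of_nonneg_left h1 hε.le
      _ ≤ ε * (δ / R * (R / ε)) := by gcongr; exact min_le_right _ _
      _ = δ := by field_simp
  · obtain ⟨l, r, hl, hr, h1, -⟩ := hqs (y / ε)
    have hp' : IsProxSubgradient (fun x => ∫ t in (0 : ℝ)..x, q t) (y / ε) p := by
      obtain ⟨K, hK⟩ := hp
      refine ⟨K * ε, ?_⟩
      have ht : Tendsto (fun X : ℝ => X * ε) (𝓝 (y / ε)) (𝓝 y) := by
        have := (continuous_mul_const ε).tendsto (y / ε)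
        rwa [div_mul_cancel₀ _ hε.ne'] at this
      filter_upwards [ht.eventually hK] with X hX
      rw [mul_div_cancel_right₀ _ hε.ne'] at hX
      have h3 : X * ε - y = ε * (X - y / ε) := by field_simp
      rw [h3] at hX
      refine le_of_mul_le_mul_left ?_ hε
      linarith
    have := h1 p (hp'.mem_Icc hq hqC hl hr)
    have h3 := min_le_left δ (δ / R)
    linarith

/-- The two conditions in `IsSlope` are exchanged by q ↦ -q. Since u ↦ -u exchanges sub- and
supersolutions, the one-sided comparison applied twice yields both halves of the convergence. -/
lemma HasSlopes.neg {G W H : ℝ → ℝ} (h : HasSlopes G W H) :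
    HasSlopes (fun p => -G (-p)) (fun x => -W x) (fun θ => -H (-θ)) := by
  intro Θ
  obtain ⟨C, hC, h⟩ := h Θ
  refine ⟨C, hC, fun θ hθ δ hδ => ?_⟩
  obtain ⟨X₀, hX₀, h⟩ := h (-θ) (by rwa [abs_neg]) δ hδ
  refine ⟨X₀, hX₀, fun L hL => ?_⟩
  obtain ⟨q, hq, hqC, hqs, hqθ⟩ := h L hL
  refine ⟨fun x => -q x, hq.neg, fun x => by rw [abs_neg]; exact hqC x, fun y => ?_,
    fun x hx => ?_⟩
  · obtain ⟨l, r, hl, hr, h1, h2⟩ := hqs y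
    refine ⟨-l, -r, hl.neg, hr.neg, fun p hp => ?_, fun p hp => ?_⟩
    · have := h2 (-p) ⟨by linarith [hp.2], by linarith [hp.1]⟩
      linarith
    · have := h1 (-p) ⟨by linarith [hp.2], by linarith [hp.1]⟩
      linarith
  · have := hqθ x hx
    rw [intervalIntegral.integral_neg, ← abs_neg]
    convert this using 2
    ring

lemma isViscositySubsolution_neg {F : ℝ → ℝ → ℝ} {u : ℝ × ℝ → ℝ}
    (h : IsViscositySupersolution F u) :
    IsViscositySubsolution (fun x p => -F x (-p)) (fun z => -u z) := by
  intro φ hφ z hz hmax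
  have h1 := h (fun y => -φ y) hφ.neg z hz (by
    have := hmax.neg
    refine this.congr (Eventually.of_forall fun y => ?_)
    simp; ring)
  rw [fderiv_fun_neg] at h1
  simp only [neg_apply] at h1
  linarith

lemma isViscositySupersolution_neg {F : ℝ → ℝ → ℝ} {u : ℝ × ℝ → ℝ}
    (h : IsViscositySubsolution F u) :
    IsViscositySupersolution (fun x p => -F x (-p)) (fun z => -u z) := by
  intro φ hφ z hz hmin
  have h1 := h (fun y => -φ y) hφ.neg z hz (by
    have := hmin.neg
    refine this.congr (Eventually.of_forall fun y => ?_)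
    simp; ring)
  rw [fderiv_fun_neg] at h1
  simp only [neg_apply] at h1
  linarith

/-- Approximate correctors at every slope imply homogenization. -/
theorem HasSlopes.homogenizes {G W H : ℝ → ℝ} (h : HasSlopes G W H) (hG : Continuous G)
    (hW : Continuous W) {Wb : ℝ} (hWb : ∀ x, |W x| ≤ Wb) {g : ℝ → ℝ} {u : ℝ → ℝ × ℝ → ℝ}
    (hu : ∀ ε, 0 < ε → IsSolution (fun x p => G p + W (x / ε)) g (u ε)) {ubar : ℝ × ℝ → ℝ}
    (hubar : IsSolution (fun _ p => H p) g ubar) :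
    TendstoLocallyUniformlyOn u ubar (𝓝[>] 0) halfPlane := by
  rw [Metric.tendstoLocallyUniformlyOn_iff]
  intro e he z hz
  have hη : 0 < e / 4 := by positivity
  have hρ₀ : 0 < dist z 0 + 1 := by positivity
  obtain ⟨ε₁, hε₁, h1⟩ := exists_forall_le_add_of_superCorrectors hG hW hWb
    h.hasSuperCorrectors (fun ε hε => (hu ε hε).uniformContinuousOn) (fun ε hε => (hu ε hε).initial)
    (fun ε hε => (hu ε hε).subsolution) hubar.uniformContinuousOn hubar.initial
    hubar.supersolution hρ₀ hη
  obtain ⟨ε₂, hε₂, h2⟩ := exists_forall_le_add_of_superCorrectors (g := fun x => -g x)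
    (u := fun ε z => -u ε z) (ubar := fun z => -ubar z)
    (show Continuous fun p => -G (-p) by fun_prop) (W := fun x => -W x) hW.neg (Wb := Wb)
    (fun x => by simpa using hWb x) h.neg.hasSuperCorrectors
    (fun ε hε => uniformContinuous_neg.comp_uniformContinuousOn (hu ε hε).uniformContinuousOn)
    (fun ε hε x => by simp only [(hu ε hε).initial])
    (fun ε hε => by
      have := isViscositySubsolution_neg (hu ε hε).supersolution
      refine cast ?_ this
      congr 1
      funext x p; ring)
    (uniformContinuous_neg.comp_uniformContinuousOn hubar.uniformContinuousOn) (fun x => by simp only [hubar.initial])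
    (isViscositySupersolution_neg hubar.subsolution) hρ₀ hη
  refine ⟨Metric.closedBall z 1 ∩ halfPlane,
    inter_mem (nhdsWithin_le_nhds (Metric.closedBall_mem_nhds z one_pos)) self_mem_nhdsWithin, ?_⟩
  have hmem : Ioo 0 (min ε₁ ε₂) ∈ 𝓝[>] (0 : ℝ) := Ioo_mem_nhdsGT (by positivity)
  filter_upwards [hmem] with ε hε y hy
  have hy0 : dist y 0 ≤ dist z 0 + 1 := by
    have h3 := dist_triangle y z 0
    have h4 := Metric.mem_closedBall.1 hy.1
    linarith
  have h3 := h1 ε hε.1 (hε.2.trans_le (min_le_left _ _)) y hy.2 hy0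
  have h4 := h2 ε hε.1 (hε.2.trans_le (min_le_right _ _)) y hy.2 hy0
  rw [Real.dist_eq, abs_lt]
  constructor <;> linarith

end DoubleWellHJ

/-! ### Means, small gaps and gluing of slope functions -/

namespace DoubleWellHJ

/-- The primitive of `q` grows linearly with slope `θ` in both directions. -/
def HasMean (q : ℝ → ℝ) (θ : ℝ) : Prop :=
  ∀ η > 0, ∃ X₀ > 0, ∀ L, X₀ ≤ L → ∀ x, |x| ≤ L → |(∫ t in (0 : ℝ)..x, q t) - θ * x| ≤ η * L

/-- The gaps of `Z` in the window `[-L, L]` have size `o(L)`. -/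
def HasSmallGaps (Z : Set ℝ) : Prop :=
  ∀ η > 0, ∃ X₀ > 0, ∀ L, X₀ ≤ L → ∀ x, |x| ≤ L → ∃ z ∈ Z, x ≤ z ∧ z ≤ x + η * L

/-- At `z` one may pass from the slope function `q₁` to `q₂`. -/
def CanSwitch (G W : ℝ → ℝ) (lam δ : ℝ) (q₁ q₂ : ℝ → ℝ) (z : ℝ) : Prop :=
  ∃ l r, Tendsto q₁ (𝓝[<] z) (𝓝 l) ∧ Tendsto q₂ (𝓝[>] z) (𝓝 r) ∧
    (∀ p ∈ Icc l r, lam - δ ≤ G p + W z) ∧ (∀ p ∈ Icc r l, G p + W z ≤ lam + δ)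

lemma IsSlope.mono {G W : ℝ → ℝ} {lam δ lam' δ' : ℝ} {q : ℝ → ℝ} (h : IsSlope G W lam δ q)
    (h1 : lam' - δ' ≤ lam - δ) (h2 : lam + δ ≤ lam' + δ') : IsSlope G W lam' δ' q := by
  intro y
  obtain ⟨l, r, hl, hr, h3, h4⟩ := h y
  exact ⟨l, r, hl, hr, fun p hp => h1.trans (h3 p hp), fun p hp => (h4 p hp).trans h2⟩

lemma HasSlopes.translate {G W H : ℝ → ℝ} (h : HasSlopes G W H) (c : ℝ) :
    HasSlopes G (fun x => W (x + c)) H := by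
  intro Θ
  obtain ⟨C, hC, h⟩ := h Θ
  refine ⟨C, hC, fun θ hθ δ hδ => ?_⟩
  obtain ⟨X₀, hX₀, h⟩ := h θ hθ (δ / 4) (by positivity)
  refine ⟨max X₀ |c|, by positivity, fun L hL => ?_⟩
  have hL1 := (le_max_left _ _).trans hL
  have hL2 := (le_max_right _ _).trans hL
  obtain ⟨q, hq, hqC, hqs, hqθ⟩ := h (L + |c|) (by linarith [abs_nonneg c])
  refine ⟨fun x => q (x + c), by fun_prop, fun x => hqC _, fun y => ?_, fun x hx => ?_⟩
  · obtain ⟨l, r, hl, hr, h1, h2⟩ := hqs (y + c)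
    have ht : Tendsto (fun x => x + c) (𝓝 y) (𝓝 (y + c)) := (continuous_add_const c).tendsto y
    refine ⟨l, r, hl.comp (ht.inf (tendsto_principal_principal.2 fun x hx => ?_)),
      hr.comp (ht.inf (tendsto_principal_principal.2 fun x hx => ?_)),
      fun p hp => ?_, fun p hp => ?_⟩
    · simpa using hx
    · simpa using hx
    · have := h1 p hp; linarith
    · have := h2 p hp; linarith
  · rw [intervalIntegral.integral_comp_add_right (fun t => q t), zero_add,
      ← intervalIntegral.integral_interval_sub_left (intervalIntegrable_of_bound hq hqC 0 _)
        (intervalIntegrable_of_bound hq hqC 0 _)]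
    have h1 := hqθ (x + c) ((abs_add_le _ _).trans (by linarith))
    have h2 := hqθ c (by linarith [abs_nonneg x])
    have h3 : δ / 4 * (L + |c|) ≤ δ / 4 * (2 * L) := by
      apply mul_le_mul_of_nonneg_left _ (by positivity)
      linarith
    rw [abs_le] at *
    constructor <;> linarith

/-- On an interval of length ηL free of points of `Z` the integral of `q` would be nonpositive,
while the mean predicts θηL with an error of at most θηL/4 at each end. -/
lemma HasMean.hasSmallGaps {q : ℝ → ℝ} (hq : Measurable q) {C : ℝ} (hC : ∀ x, |q x| ≤ C)
    {θ : ℝ} (hθ : 0 < θ) (h : HasMean q θ) {Z : Set ℝ} (hZ : ∀ x, 0 < q x → x ∈ Z) :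
    HasSmallGaps Z := by
  intro η hη
  obtain ⟨X₀, hX₀, h⟩ := h (θ * η / (4 * (1 + η))) (by positivity)
  refine ⟨X₀, hX₀, fun L hL x hx => ?_⟩
  have hL0 : 0 < L := hX₀.trans_le hL
  by_contra! hcon
  have hle : X₀ ≤ (1 + η) * L := hL.trans (by nlinarith)
  have h1 := h _ hle x (hx.trans (by nlinarith))
  have h2 := h _ hle (x + η * L) ((abs_add_le _ _).trans (by
    rw [abs_of_pos (show 0 < η * L by positivity)]; linarith))
  have h3 : (∫ t in x..(x + η * L), q t) ≤ 0 := by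
    rw [← neg_nonneg, ← intervalIntegral.integral_neg]
    refine intervalIntegral.integral_nonneg (by nlinarith) fun t ht => ?_
    rw [neg_nonneg]
    by_contra! hlt
    exact absurd ht.2 (not_le.2 (hcon t (hZ t hlt) ht.1))
  rw [← intervalIntegral.integral_interval_sub_left (intervalIntegrable_of_bound hq hC 0 _)
        (intervalIntegrable_of_bound hq hC 0 _)] at h3
  have h4 : θ * η / (4 * (1 + η)) * ((1 + η) * L) = θ * η * L / 4 := by field_simp
  rw [h4, abs_le] at h1 h2
  have h5 : 0 < θ * η * L := by positivity
  linarith [h1.1, h1.2, h2.1, h2.2]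

/-- Use q₂ on [z k, z' k) and q₁ on the rest of the k-th cell of length h. A cell with z k = z' k
contains no switch, and z' k < (k + 1) h puts q₁ back in force before the cell ends, so neighbouring
cells need no matching. -/
lemma exists_glued_slope {G W : ℝ → ℝ} {lam δ C : ℝ} {q₁ q₂ : ℝ → ℝ} {Z : Set ℝ}
    (hq₁ : Measurable q₁) (hq₂ : Measurable q₂) (hC₁ : ∀ x, |q₁ x| ≤ C) (hC₂ : ∀ x, |q₂ x| ≤ C)
    (hs₁ : IsSlope G W lam δ q₁) (hs₂ : IsSlope G W lam δ q₂)
    (hZ₁ : ∀ z ∈ Z, CanSwitch G W lam δ q₁ q₂ z) (hZ₂ : ∀ z ∈ Z, CanSwitch G W lam δ q₂ q₁ z)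
    {h : ℝ} (hh : 0 < h) (z z' : ℤ → ℝ) (hz : ∀ k, k * h ≤ z k) (hzz : ∀ k, z k ≤ z' k)
    (hz' : ∀ k, z' k < (k + 1) * h) (hzZ : ∀ k, z k ≠ z' k → z k ∈ Z ∧ z' k ∈ Z) :
    ∃ q : ℝ → ℝ, Measurable q ∧ (∀ x, |q x| ≤ C) ∧ IsSlope G W lam δ q ∧
      ∀ k : ℤ, ∫ t in (k * h)..((k + 1) * h), q t =
        (∫ t in (k * h)..(z k), q₁ t) + (∫ t in (z k)..(z' k), q₂ t) +
          ∫ t in (z' k)..((k + 1) * h), q₁ t := by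
  classical
  let χ : ℝ → Prop := fun x => z ⌊x / h⌋ ≤ x ∧ x < z' ⌊x / h⌋
  let q : ℝ → ℝ := fun x => if χ x then q₂ x else q₁ x
  have hfl : Measurable fun x : ℝ => ⌊x / h⌋ := Int.measurable_floor.comp (by fun_prop)
  have hχ : MeasurableSet {x | χ x} := by
    have h1 : Measurable fun x : ℝ => z ⌊x / h⌋ := (measurable_from_top (f := z)).comp hfl
    have h2 : Measurable fun x : ℝ => z' ⌊x / h⌋ := (measurable_from_top (f := z')).comp hfl
    exact (measurableSet_le h1 measurable_id).inter (measurableSet_lt measurable_id h2)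
  have hq : Measurable q := Measurable.ite hχ hq₂ hq₁
  have hC : ∀ x, |q x| ≤ C := fun x => by
    simp only [q]; split_ifs
    exacts [hC₂ x, hC₁ x]
  have hfloor : ∀ (k : ℤ) (x : ℝ), k * h ≤ x → x < (k + 1) * h → ⌊x / h⌋ = k := by
    intro k x h1 h2
    rw [Int.floor_eq_iff]
    exact ⟨(le_div_iff₀ hh).2 h1, (div_lt_iff₀ hh).2 h2⟩
  refine ⟨q, hq, hC, fun y => ?_, fun k => ?_⟩
  · set k := ⌊y / h⌋ with hk
    have hk1 : k * h ≤ y := (le_div_iff₀ hh).1 (Int.floor_le _)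
    have hk2 : y < (k + 1) * h := (div_lt_iff₀ hh).1 (Int.lt_floor_add_one _)
    have hright : ∀ᶠ x in 𝓝[>] y, (χ x ↔ (z k ≤ y ∧ y < z' k)) := by
      have e1 : ∀ᶠ x in 𝓝[>] y, x < (k + 1) * h := nhdsWithin_le_nhds (Iio_mem_nhds hk2)
      have e2 : ∀ᶠ x in 𝓝[>] y, (z k ≤ x ↔ z k ≤ y) := by
        rcases le_or_gt (z k) y with h3 | h3
        · filter_upwards [self_mem_nhdsWithin] with x hx
          exact iff_of_true (h3.trans (le_of_lt hx)) h3
        · filter_upwards [nhdsWithin_le_nhds (Iio_mem_nhds h3)] with x hx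
          exact iff_of_false (not_le.2 hx) (not_le.2 h3)
      have e3 : ∀ᶠ x in 𝓝[>] y, (x < z' k ↔ y < z' k) := by
        rcases lt_or_ge y (z' k) with h3 | h3
        · filter_upwards [nhdsWithin_le_nhds (Iio_mem_nhds h3)] with x hx
          exact iff_of_true hx h3
        · filter_upwards [self_mem_nhdsWithin] with x hx
          exact iff_of_false (not_lt.2 (h3.trans (le_of_lt hx))) (not_lt.2 h3)
      filter_upwards [e1, e2, e3, self_mem_nhdsWithin] with x h1 h2 h3 h4
      have : ⌊x / h⌋ = k := hfloor k x (hk1.trans (le_of_lt h4)) h1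
      simp only [χ, this, h2, h3]
    have hleft : ∀ᶠ x in 𝓝[<] y, (χ x ↔ (z k < y ∧ y ≤ z' k)) := by
      -- At a cell boundary the left neighbourhood lies in the preceding cell, after its last
      -- switch.
      rcases hk1.eq_or_lt with h0 | h0
      · have h3 : z' (k - 1) < y := by
          have := hz' (k - 1); push_cast at this; rw [sub_add_cancel] at this; linarith
        have h5 : ((k - 1 : ℤ) : ℝ) * h < y := ((hz (k - 1)).trans (hzz (k - 1))).trans_lt h3
        filter_upwards [self_mem_nhdsWithin, nhdsWithin_le_nhds (Ioi_mem_nhds h3),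
          nhdsWithin_le_nhds (Ioi_mem_nhds h5)] with x hx hx1 hx2
        have : ⌊x / h⌋ = k - 1 := hfloor (k - 1) x (le_of_lt hx2) (by
          push_cast; rw [sub_add_cancel, h0]; exact hx)
        refine iff_of_false ?_ ?_
        · simp only [χ, this]
          exact fun hc => absurd hc.2 (not_lt.2 (le_of_lt hx1))
        · exact fun hc => absurd (hz k) (by rw [h0]; exact not_le.2 hc.1)
      · have e1 : ∀ᶠ x in 𝓝[<] y, k * h < x := nhdsWithin_le_nhds (Ioi_mem_nhds h0)
        have e2 : ∀ᶠ x in 𝓝[<] y, (z k ≤ x ↔ z k < y) := by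
          rcases lt_or_ge (z k) y with h3 | h3
          · filter_upwards [nhdsWithin_le_nhds (Ioi_mem_nhds h3)] with x hx
            exact iff_of_true (le_of_lt hx) h3
          · filter_upwards [self_mem_nhdsWithin] with x hx
            exact iff_of_false (not_le.2 (lt_of_lt_of_le hx h3)) (not_lt.2 h3)
        have e3 : ∀ᶠ x in 𝓝[<] y, (x < z' k ↔ y ≤ z' k) := by
          rcases le_or_gt y (z' k) with h3 | h3
          · filter_upwards [self_mem_nhdsWithin] with x hx
            exact iff_of_true (lt_of_lt_of_le hx h3) h3
          · filter_upwards [nhdsWithin_le_nhds (Ioi_mem_nhds h3)] with x hx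
            exact iff_of_false (not_lt.2 (le_of_lt hx)) (not_le.2 h3)
        filter_upwards [e1, e2, e3, self_mem_nhdsWithin] with x h1 h2 h3 h4
        have : ⌊x / h⌋ = k := hfloor k x (le_of_lt h1) (lt_trans h4 hk2)
        simp only [χ, this, h2, h3]
    have hR : ∀ {b : Prop} (q' : ℝ → ℝ) {F : Filter ℝ} {a : ℝ}, (∀ᶠ x in F, (χ x ↔ b)) →
        (b → q' = q₂) → (¬b → q' = q₁) → Tendsto q' F (𝓝 a) → Tendsto q F (𝓝 a) := by
      intro b q' F a hb h1 h2 ht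
      refine ht.congr' ?_
      filter_upwards [hb] with x hx
      by_cases hbb : b
      · simp only [q, if_pos (hx.2 hbb), h1 hbb]
      · simp only [q, if_neg (fun hc => hbb (hx.1 hc)), h2 hbb]
    by_cases hbl : z k < y ∧ y ≤ z' k <;> by_cases hbr : z k ≤ y ∧ y < z' k
    · obtain ⟨l, r, hl, hr, h1, h2⟩ := hs₂ y
      exact ⟨l, r, hR q₂ hleft (fun _ => rfl) (fun hn => absurd hbl hn) hl,
        hR q₂ hright (fun _ => rfl) (fun hn => absurd hbr hn) hr, h1, h2⟩
    · have hy : y = z' k := by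
        rcases hbl.2.eq_or_lt with h1 | h1
        · exact h1
        · exact absurd ⟨hbl.1.le, h1⟩ hbr
      have hyZ : y ∈ Z := by
        rw [hy]; exact (hzZ k (by rw [hy] at hbl; exact hbl.1.ne)).2
      obtain ⟨l, r, hl, hr, h1, h2⟩ := hZ₂ y hyZ
      exact ⟨l, r, hR q₂ hleft (fun _ => rfl) (fun hn => absurd hbl hn) hl,
        hR q₁ hright (fun hn => absurd hn hbr) (fun _ => rfl) hr, h1, h2⟩
    · have hy : y = z k := by
        rcases hbr.1.eq_or_lt with h1 | h1
        · exact h1.symm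
        · exact absurd ⟨h1, hbr.2.le⟩ hbl
      have hyZ : y ∈ Z := by
        rw [hy]; exact (hzZ k (by rw [hy] at hbr; exact hbr.2.ne)).1
      obtain ⟨l, r, hl, hr, h1, h2⟩ := hZ₁ y hyZ
      exact ⟨l, r, hR q₁ hleft (fun hn => absurd hn hbl) (fun _ => rfl) hl,
        hR q₂ hright (fun _ => rfl) (fun hn => absurd hbr hn) hr, h1, h2⟩
    · obtain ⟨l, r, hl, hr, h1, h2⟩ := hs₁ y
      exact ⟨l, r, hR q₁ hleft (fun hn => absurd hn hbl) (fun _ => rfl) hl,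
        hR q₁ hright (fun hn => absurd hn hbr) (fun _ => rfl) hr, h1, h2⟩
  · have hi := fun a b => intervalIntegrable_of_bound hq hC a b
    rw [← intervalIntegral.integral_add_adjacent_intervals (hi (k * h) (z' k)) (hi _ _),
      ← intervalIntegral.integral_add_adjacent_intervals (hi (k * h) (z k)) (hi _ _)]
    congr 1
    · congr 1
      · refine intervalIntegral.integral_congr_ae ?_
        have hne : ∀ᵐ x : ℝ, x ≠ z k := by simp [ae_iff]
        filter_upwards [hne] with x hxne hx
        rw [uIoc_of_le (hz k)] at hx
        have hlt : x < z k := lt_of_le_of_ne hx.2 hxne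
        have : ⌊x / h⌋ = k := hfloor k x hx.1.le (hlt.trans_le (hzz k) |>.trans (hz' k))
        simp only [q, χ, this, not_le.2 hlt, false_and, if_false]
      · refine intervalIntegral.integral_congr_ae ?_
        have hne : ∀ᵐ x : ℝ, x ≠ z' k := by simp [ae_iff]
        filter_upwards [hne] with x hxne hx
        rw [uIoc_of_le (hzz k)] at hx
        have hlt : x < z' k := lt_of_le_of_ne hx.2 hxne
        have : ⌊x / h⌋ = k := hfloor k x ((hz k).trans hx.1.le) (hlt.trans (hz' k))
        simp only [q, χ, this, hx.1.le, hlt, and_self, if_true]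
    · refine intervalIntegral.integral_congr_ae ?_
      have hne : ∀ᵐ x : ℝ, x ≠ (k + 1) * h := by simp [ae_iff]
      filter_upwards [hne] with x hxne hx
      rw [uIoc_of_le (hz' k).le] at hx
      have hlt : x < (k + 1) * h := lt_of_le_of_ne hx.2 hxne
      have : ⌊x / h⌋ = k := hfloor k x (((hz k).trans (hzz k)).trans hx.1.le) hlt
      simp only [q, χ, this, not_lt.2 hx.1.le, and_false, if_false]

/-- Slope functions with means `θ₁` and `θ₂` that can be switched on a set with small gaps can be
glued to reach every intermediate mean. -/
lemma exists_interpolated_slope {G W : ℝ → ℝ} {lam δ C θ₁ θ₂ τ : ℝ} {q₁ q₂ : ℝ → ℝ} {Z : Set ℝ}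
    (hq₁ : Measurable q₁) (hq₂ : Measurable q₂) (hC₁ : ∀ x, |q₁ x| ≤ C) (hC₂ : ∀ x, |q₂ x| ≤ C)
    (hs₁ : IsSlope G W lam δ q₁) (hs₂ : IsSlope G W lam δ q₂)
    (hZ₁ : ∀ z ∈ Z, CanSwitch G W lam δ q₁ q₂ z) (hZ₂ : ∀ z ∈ Z, CanSwitch G W lam δ q₂ q₁ z)
    (hm₁ : HasMean q₁ θ₁) (hm₂ : HasMean q₂ θ₂) (hgap : HasSmallGaps Z)
    (hτ0 : 0 ≤ τ) (hτ1 : τ ≤ 1) {η : ℝ} (hη : 0 < η) :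
    ∃ X₀ > 0, ∀ L, X₀ ≤ L → ∃ q : ℝ → ℝ, Measurable q ∧ (∀ x, |q x| ≤ C) ∧
      IsSlope G W lam δ q ∧
      ∀ x, |x| ≤ L → |(∫ t in (0 : ℝ)..x, q t) - (θ₁ + τ * (θ₂ - θ₁)) * x| ≤ η * L := by
  classical
  set θ := θ₁ + τ * (θ₂ - θ₁) with hθ
  have hC0 : 0 ≤ C := (abs_nonneg _).trans (hC₁ 0)
  obtain ⟨n, hn⟩ := exists_nat_gt ((C + |θ|) / (η / 3))
  have hn0 : (0 : ℝ) < n := lt_of_le_of_lt (by positivity) hn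
  have hnA : (C + |θ|) / n ≤ η / 3 := by
    rw [div_lt_iff₀ (by positivity)] at hn
    rw [div_le_iff₀ hn0]; linarith
  set B := |θ₂ - θ₁| with hB
  have hB0 : 0 ≤ B := abs_nonneg _
  -- `κ` is the fraction of a cell that may be lost while waiting for a switching point. Each of the
  -- three sources of error (this loss, the means of q₁ and q₂, the last incomplete cell) is given
  -- η/3.
  obtain ⟨κ, hκ, hκ4, hκB⟩ : ∃ κ > 0, κ ≤ 1 / 4 ∧ 3 * B * κ ≤ η / 3 := by
    refine ⟨min (1 / 4) (η / (9 * (B + 1))), by positivity, min_le_left _ _, ?_⟩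
    have h1 := min_le_right (1 / 4) (η / (9 * (B + 1)))
    have h0 : 0 < min (1 / 4) (η / (9 * (B + 1))) := by positivity
    rw [le_div_iff₀ (by positivity)] at h1
    nlinarith
  set ζ := η / (18 * n) with hζ
  have hζ0 : 0 < ζ := by positivity
  have hζn : n * (6 * ζ) = η / 3 := by rw [hζ]; field_simp; norm_num
  obtain ⟨X₁, hX₁, h₁⟩ := hm₁ ζ hζ0
  obtain ⟨X₂, hX₂, h₂⟩ := hm₂ ζ hζ0
  obtain ⟨X₃, hX₃, h₃⟩ := hgap (κ / n) (by positivity)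
  refine ⟨max X₁ (max X₂ X₃), by positivity, fun L hL => ?_⟩
  have hL1 : X₁ ≤ L := (le_max_left _ _).trans hL
  have hL2 : X₂ ≤ L := ((le_max_left _ _).trans (le_max_right _ _)).trans hL
  have hL3 : X₃ ≤ L := ((le_max_right _ _).trans (le_max_right _ _)).trans hL
  have hL0 : 0 < L := hX₁.trans_le hL1
  replace h₁ := h₁ L hL1
  replace h₂ := h₂ L hL2
  replace h₃ := h₃ L hL3
  set h := L / n with hh
  have hh0 : 0 < h := by positivity
  have hnh : n * h = L := by rw [hh]; field_simp
  have hκh : κ / n * L = κ * h := by rw [hh]; ring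
  rw [hκh] at h₃
  -- Shortening the share of q₂ leaves room for the waits: a is found in [kh, kh + κh] and b within
  -- κh after kh + κh + τ'h, hence a ≤ b < (k + 1) h and b - a differs from τh by at most 3κh.
  set τ' := τ * (1 - 3 * κ) with hτ'
  have hτ'0 : 0 ≤ τ' := mul_nonneg hτ0 (by linarith)
  have hτ'1 : τ' ≤ 1 - 3 * κ := mul_le_of_le_one_left (by linarith) hτ1
  have hτ'2 : τ' ≤ τ := mul_le_of_le_one_right hτ0 (by linarith)
  have hτ'3 : τ - 3 * κ ≤ τ' := by rw [hτ']; nlinarith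
  have hrange : ∀ k : ℤ, -(n : ℤ) ≤ k → k < n → -L ≤ k * h ∧ (k + 1) * h ≤ L := by
    intro k hk1 hk2
    have h1 : (-(n : ℝ)) ≤ k := by exact_mod_cast hk1
    have h2 : (k : ℝ) + 1 ≤ n := by exact_mod_cast hk2
    constructor
    · rw [← hnh]; nlinarith
    · rw [← hnh]; exact mul_le_mul_of_nonneg_right h2 hh0.le
  have hex : ∀ k : ℤ, ∃ a b : ℝ, k * h ≤ a ∧ a ≤ b ∧ b < (k + 1) * h ∧ (a ≠ b → a ∈ Z ∧ b ∈ Z) ∧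
      (-(n : ℤ) ≤ k → k < n → |b - a - τ * h| ≤ 3 * κ * h) := by
    intro k
    by_cases hk : -(n : ℤ) ≤ k ∧ k < n
    · obtain ⟨hr1, hr2⟩ := hrange k hk.1 hk.2
      have hκh0 : 0 < κ * h := by positivity
      have hτh0 : 0 ≤ τ' * h := by positivity
      have hτh1 : τ' * h ≤ (1 - 3 * κ) * h := mul_le_mul_of_nonneg_right hτ'1 hh0.le
      obtain ⟨a, haZ, ha1, ha2⟩ := h₃ (k * h) (abs_le.2 ⟨hr1, by linarith⟩)
      obtain ⟨b, hbZ, hb1, hb2⟩ := h₃ (k * h + κ * h + τ' * h) (abs_le.2 ⟨by linarith, by linarith⟩)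
      have h5 := mul_le_mul_of_nonneg_right hτ'2 hh0.le
      have h6 := mul_le_mul_of_nonneg_right hτ'3 hh0.le
      refine ⟨a, b, ha1, by linarith, by linarith, fun _ => ⟨haZ, hbZ⟩, fun _ _ => ?_⟩
      rw [abs_le]
      constructor <;> linarith
    · exact ⟨k * h, k * h, le_rfl, le_rfl, by linarith, fun hne => absurd rfl hne,
        fun h1 h2 => absurd ⟨h1, h2⟩ hk⟩
  choose z z' hz hzz hz' hzZ hzτ using hex
  obtain ⟨q, hq, hqC, hqs, hqi⟩ := exists_glued_slope hq₁ hq₂ hC₁ hC₂ hs₁ hs₂ hZ₁ hZ₂ hh0 z z' hz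
    hzz hz' hzZ
  refine ⟨q, hq, hqC, hqs, ?_⟩
  have hi := fun a b => intervalIntegrable_of_bound hq hqC a b
  have hi₁ := fun a b => intervalIntegrable_of_bound hq₁ hC₁ a b
  have hi₂ := fun a b => intervalIntegrable_of_bound hq₂ hC₂ a b
  -- Error per cell: the wrong share of q₂ costs at most 3Bκh, and the six primitives evaluated at
  -- the switching points and at the ends cost ζL each.
  set e := 3 * B * κ * h + 6 * ζ * L with he
  have he0 : 0 ≤ e := by positivity
  have hne : n * e ≤ η / 3 * L + η / 3 * L := by
    have h1 : n * e = 3 * B * κ * (n * h) + n * (6 * ζ) * L := by rw [he]; ring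
    rw [h1, hnh, hζn]
    have := mul_le_mul_of_nonneg_right hκB hL0.le
    linarith
  have hcell : ∀ k : ℤ, -(n : ℤ) ≤ k → k < n →
      |(∫ t in (k * h)..((k + 1) * h), q t) - θ * h| ≤ e := by
    intro k hk1 hk2
    obtain ⟨hr1, hr2⟩ := hrange k hk1 hk2
    have hz1 := hz k
    have hz2 := hzz k
    have hz3 := (hz' k).le
    rw [hqi k, ← intervalIntegral.integral_interval_sub_left (hi₁ 0 (z k)) (hi₁ 0 (k * h)),
      ← intervalIntegral.integral_interval_sub_left (hi₂ 0 (z' k)) (hi₂ 0 (z k)),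
      ← intervalIntegral.integral_interval_sub_left (hi₁ 0 ((k + 1) * h)) (hi₁ 0 (z' k))]
    have a1 := abs_le.1 (h₁ (z k) (abs_le.2 ⟨by linarith, by linarith⟩))
    have a2 := abs_le.1 (h₁ (k * h) (abs_le.2 ⟨by linarith, by linarith⟩))
    have a3 := abs_le.1 (h₁ (z' k) (abs_le.2 ⟨by linarith, by linarith⟩))
    have a4 := abs_le.1 (h₁ ((k + 1) * h) (abs_le.2 ⟨by linarith, by linarith⟩))
    have a5 := abs_le.1 (h₂ (z k) (abs_le.2 ⟨by linarith, by linarith⟩))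
    have a6 := abs_le.1 (h₂ (z' k) (abs_le.2 ⟨by linarith, by linarith⟩))
    have a7 : |(θ₂ - θ₁) * (z' k - z k - τ * h)| ≤ B * (3 * κ * h) := by
      rw [abs_mul]; exact mul_le_mul_of_nonneg_left (hzτ k hk1 hk2) hB0
    rw [abs_le] at a7 ⊢
    rw [he, hθ]
    constructor <;> linarith [a1.1, a1.2, a2.1, a2.2, a3.1, a3.2, a4.1, a4.2, a5.1, a5.2, a6.1,
      a6.2, a7.1, a7.2]
  have hnode : ∀ j : ℕ, j ≤ n →
      |(∫ t in (0 : ℝ)..(j * h), q t) - θ * (j * h)| ≤ j * e ∧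
      |(∫ t in (0 : ℝ)..(-(j : ℝ) * h), q t) - θ * (-(j : ℝ) * h)| ≤ j * e := by
    intro j
    induction j with
    | zero => intro _; simp
    | succ j ih =>
      intro hj
      obtain ⟨i1, i2⟩ := ih (by omega)
      have c1 := hcell j (by omega) (by omega)
      have c2 := hcell (-(j + 1 : ℕ)) (by omega) (by omega)
      have e1 : ((-(j + 1 : ℕ) : ℤ) : ℝ) = -((j : ℝ) + 1) := by push_cast; ring
      rw [e1, ← intervalIntegral.integral_interval_sub_left (hi 0 _) (hi 0 _),
        show -((j : ℝ) + 1) + 1 = -(j : ℝ) by ring] at c2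
      rw [Int.cast_natCast,
        ← intervalIntegral.integral_interval_sub_left (hi 0 _) (hi 0 _)] at c1
      push_cast
      simp only [abs_le] at i1 i2 c1 c2 ⊢
      constructor <;> constructor <;> linarith [i1.1, i1.2, i2.1, i2.2, c1.1, c1.2, c2.1, c2.2]
  intro x hx
  set k := ⌊x / h⌋ with hk
  have hk1 : k * h ≤ x := (le_div_iff₀ hh0).1 (Int.floor_le _)
  have hk2 : x < (k + 1) * h := (div_lt_iff₀ hh0).1 (Int.lt_floor_add_one _)
  have hkn : |(∫ t in (0 : ℝ)..(k * h), q t) - θ * (k * h)| ≤ n * e := by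
    have hx' := abs_le.1 hx
    have b1 : k ≤ (n : ℤ) := by
      have : (k : ℝ) ≤ n := le_of_mul_le_mul_right (by rw [hnh]; linarith) hh0
      exact_mod_cast this
    have b2 : -(n : ℤ) ≤ k := by
      have : -((n : ℝ) + 1) < k := lt_of_mul_lt_mul_right (a := h) (by linarith) hh0.le
      have : -((n : ℤ) + 1) < k := by exact_mod_cast this
      omega
    have b3 : k.natAbs ≤ n := by omega
    have b4 : (k.natAbs : ℝ) * e ≤ n * e := mul_le_mul_of_nonneg_right (by exact_mod_cast b3) he0
    obtain ⟨i1, i2⟩ := hnode k.natAbs b3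
    rcases Int.natAbs_eq k with hc | hc
    · have : (k : ℝ) = (k.natAbs : ℝ) := by
        have := congrArg (Int.cast : ℤ → ℝ) hc
        rwa [Int.cast_natCast] at this
      rw [this]; exact i1.trans b4
    · have : (k : ℝ) = -(k.natAbs : ℝ) := by
        have := congrArg (Int.cast : ℤ → ℝ) hc
        rwa [Int.cast_neg, Int.cast_natCast] at this
      rw [this]; exact i2.trans b4
  have hlast : |(∫ t in (k * h)..x, q t) - θ * (x - k * h)| ≤ (C + |θ|) * h := by
    refine (abs_sub _ _).trans ?_
    have d1 := abs_intervalIntegral_le hqC (k * h) x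
    rw [abs_mul, abs_of_nonneg (sub_nonneg.2 hk1)]
    rw [abs_of_nonneg (sub_nonneg.2 hk1)] at d1
    have d2 : x - k * h ≤ h := by linarith
    nlinarith [abs_nonneg θ]
  rw [← intervalIntegral.integral_interval_sub_left (hi 0 _) (hi 0 _)] at hlast
  have hA : (C + |θ|) * h ≤ η / 3 * L := by
    rw [hh, mul_div_assoc', mul_div_right_comm]
    exact mul_le_mul_of_nonneg_right hnA hL0.le
  rw [abs_le] at *
  constructor <;> linarith [hlast.1, hlast.2, hkn.1, hkn.2]

end DoubleWellHJ

/-! ### Inverse branches of `G` and the hysteresis slope -/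

namespace DoubleWellHJ

/-- The retraction `c` onto `s` extends `F` from `s` by slope 1 to an increasing bijection of the
line, which is inverted globally. The branches thus become continuous and strictly monotone on all
of ℝ, with no domains to carry along. -/
lemma exists_inverse_of_clamp {F c : ℝ → ℝ} (hF : Continuous F) (hc : Continuous c) {s : Set ℝ}
    (hmem : ∀ p, c p ∈ s) (hmono : Monotone c) (hlip : Monotone fun p => p - c p)
    (hFs : StrictMonoOn F s) (hid : ∀ p ∈ s, c p = p)
    (htop : Tendsto (fun p => F (c p) + (p - c p)) atTop atTop)
    (hbot : Tendsto (fun p => F (c p) + (p - c p)) atBot atBot) :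
    ∃ g : ℝ → ℝ, Continuous g ∧ StrictMono g ∧ ∀ p ∈ s, g (F p) = p := by
  have hm : StrictMono fun p => F (c p) + (p - c p) := by
    intro p q hpq
    have h2 := hlip hpq.le
    rcases (hmono hpq.le).eq_or_lt with h | h
    · simp only [h]; linarith
    · have := hFs (hmem p) (hmem q) h
      simp only at h2 ⊢; linarith
  have hcont : Continuous fun p => F (c p) + (p - c p) := by fun_prop
  let e := hm.orderIsoOfSurjective _ (hcont.surjective htop hbot)
  refine ⟨e.symm, e.symm.continuous, e.symm.strictMono, fun p hp => ?_⟩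
  have : e p = F p := by
    change F (c p) + (p - c p) = F p
    rw [hid p hp]; ring
  rw [← this, OrderIso.symm_apply_apply]

lemma exists_inverse_on_Ici {F : ℝ → ℝ} (hF : Continuous F) {a : ℝ}
    (hm : StrictMonoOn F (Ici a)) (ht : Tendsto F atTop atTop) :
    ∃ g : ℝ → ℝ, Continuous g ∧ StrictMono g ∧ (∀ p, a ≤ p → g (F p) = p) ∧
      ∀ s, F a ≤ s → a ≤ g s ∧ F (g s) = s := by
  obtain ⟨g, hg, hgm, hgF⟩ := exists_inverse_of_clamp (c := fun p => max a p) hF (by fun_prop)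
    (s := Ici a) (fun p => mem_Ici.2 (le_max_left _ _)) (fun p q h => max_le_max le_rfl h)
    (fun p q h => by
      rcases max_cases a p with ⟨h1, h2⟩ | ⟨h1, h2⟩ <;> rcases max_cases a q with ⟨h3, h4⟩ | ⟨h3, h4⟩ <;>
        simp only [h1, h3] <;> linarith) hm
    (fun p hp => max_eq_right hp)
    (by
      refine ht.congr' ?_
      filter_upwards [eventually_ge_atTop a] with p hp
      rw [max_eq_right hp]; ring)
    (by
      have : Tendsto (fun p : ℝ => F a - a + p) atBot atBot :=
        tendsto_atBot_add_const_left _ _ tendsto_id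
      refine this.congr' ?_
      filter_upwards [eventually_le_atBot a] with p hp
      rw [max_eq_left hp]; ring)
  refine ⟨g, hg, hgm, hgF, fun s hs => ?_⟩
  obtain ⟨b, hb1, hb2⟩ := ((eventually_ge_atTop a).and (ht.eventually_ge_atTop s)).exists
  obtain ⟨p, hp, hps⟩ := intermediate_value_Icc hb1 hF.continuousOn ⟨hs, hb2⟩
  rw [← hps, hgF p hp.1]
  exact ⟨hp.1, rfl⟩

lemma exists_inverse_on_Icc {F : ℝ → ℝ} (hF : Continuous F) {a b : ℝ} (hab : a ≤ b)
    (hm : StrictMonoOn F (Icc a b)) :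
    ∃ g : ℝ → ℝ, Continuous g ∧ StrictMono g ∧ (∀ p ∈ Icc a b, g (F p) = p) ∧
      ∀ s ∈ Icc (F a) (F b), g s ∈ Icc a b ∧ F (g s) = s := by
  have hcl : ∀ p, max a (min p b) ∈ Icc a b := fun p =>
    ⟨le_max_left _ _, max_le hab (min_le_right _ _)⟩
  obtain ⟨g, hg, hgm, hgF⟩ := exists_inverse_of_clamp (c := fun p => max a (min p b)) hF
    (by fun_prop) (s := Icc a b) hcl (fun p q h => max_le_max le_rfl (min_le_min h le_rfl))
    (fun p q h => by
      simp only
      rcases le_total p a with h1 | h1 <;> rcases le_total q a with h2 | h2 <;>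
      rcases le_total p b with h3 | h3 <;> rcases le_total q b with h4 | h4 <;>
      simp [*] <;> linarith) hm
    (fun p hp => by rw [min_eq_left hp.2, max_eq_right hp.1])
    (by
      have : Tendsto (fun p : ℝ => F b - b + p) atTop atTop :=
        tendsto_atTop_add_const_left _ _ tendsto_id
      refine this.congr' ?_
      filter_upwards [eventually_ge_atTop b] with p hp
      rw [min_eq_right hp, max_eq_right hab]; ring)
    (by
      have : Tendsto (fun p : ℝ => F a - a + p) atBot atBot :=
        tendsto_atBot_add_const_left _ _ tendsto_id
      refine this.congr' ?_
      filter_upwards [eventually_le_atBot a] with p hp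
      rw [min_eq_left (hp.trans hab), max_eq_left hp]; ring)
  refine ⟨g, hg, hgm, hgF, fun s hs => ?_⟩
  obtain ⟨p, hp, hps⟩ := intermediate_value_Icc hab hF.continuousOn hs
  rw [← hps, hgF p hp]
  exact ⟨hp, rfl⟩

/-- Continuous strictly monotone inverses `g₁`, `g₃`, `g₄` of `G` on `(-∞, pm]`, `[pM, 0]` and
`[0, ∞)`, extended to the whole line. -/
structure IsBranches (G : ℝ → ℝ) (m M pm pM : ℝ) (g₁ g₃ g₄ : ℝ → ℝ) : Prop where
  cont₁ : Continuous g₁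
  cont₃ : Continuous g₃
  cont₄ : Continuous g₄
  anti₁ : StrictAnti g₁
  anti₃ : StrictAnti g₃
  mono₄ : StrictMono g₄
  le₁ : ∀ s, m ≤ s → g₁ s ≤ pm
  map₁ : ∀ s, m ≤ s → G (g₁ s) = s
  mem₃ : ∀ s, 0 ≤ s → s ≤ M → pM ≤ g₃ s ∧ g₃ s ≤ 0
  map₃ : ∀ s, 0 ≤ s → s ≤ M → G (g₃ s) = s
  nonneg₄ : ∀ s, 0 ≤ s → 0 ≤ g₄ s
  map₄ : ∀ s, 0 ≤ s → G (g₄ s) = s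
  inv₁ : ∀ p, p ≤ pm → g₁ (G p) = p
  inv₃ : ∀ p, pM ≤ p → p ≤ 0 → g₃ (G p) = p
  inv₄ : ∀ p, 0 ≤ p → g₄ (G p) = p

lemma IsDoubleWell.exists_branches {G : ℝ → ℝ} {m M pm pM : ℝ} (h : IsDoubleWell G m M pm pM) :
    ∃ g₁ g₃ g₄, IsBranches G m M pm pM g₁ g₃ g₄ := by
  have hn : Continuous fun p => G (-p) := h.continuous.comp continuous_neg
  obtain ⟨g₁, c₁, m₁, i₁, f₁⟩ := exists_inverse_on_Ici hn (a := -pm)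
    (fun p hp q hq hpq => h.strictAnti_one (mem_Iic.2 (by linarith [mem_Ici.1 hq]))
      (mem_Iic.2 (by linarith [mem_Ici.1 hp])) (neg_lt_neg hpq))
    (h.coercive_bot.comp tendsto_neg_atTop_atBot)
  obtain ⟨g₃, c₃, m₃, i₃, f₃⟩ := exists_inverse_on_Icc hn (a := 0) (b := -pM)
    (by linarith [h.pM_neg])
    (fun p hp q hq hpq => h.strictAnti_three ⟨by linarith [hq.2], by linarith [hq.1]⟩
      ⟨by linarith [hp.2], by linarith [hp.1]⟩ (neg_lt_neg hpq))
  obtain ⟨g₄, c₄, m₄, i₄, f₄⟩ := exists_inverse_on_Ici h.continuous h.strictMono_four h.coercive_top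
  simp only [neg_neg, neg_zero, h.map_zero, h.map_pm, h.map_pM] at f₁ f₃ f₄
  refine ⟨fun s => -g₁ s, fun s => -g₃ s, g₄, c₁.neg, c₃.neg, c₄, m₁.neg, m₃.neg, m₄,
    fun s hs => by linarith [(f₁ s hs).1], fun s hs => (f₁ s hs).2,
    fun s h0 h1 => ⟨by linarith [(f₃ s ⟨h0, h1⟩).1.2], by linarith [(f₃ s ⟨h0, h1⟩).1.1]⟩,
    fun s h0 h1 => (f₃ s ⟨h0, h1⟩).2, fun s hs => (f₄ s hs).1, fun s hs => (f₄ s hs).2,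
    fun p hp => ?_, fun p hp hp' => ?_, i₄⟩
  · have := i₁ (-p) (by linarith)
    rw [neg_neg] at this; linarith
  · have := i₃ (-p) ⟨by linarith, by linarith⟩
    rw [neg_neg] at this; linarith

section Branches

variable {G : ℝ → ℝ} {m M pm pM : ℝ} {g₁ g₃ g₄ : ℝ → ℝ}

lemma IsDoubleWell.nonneg (h : IsDoubleWell G m M pm pM) (p : ℝ) : 0 ≤ G p := by
  have h1 := h.pM_neg
  have h2 := h.m_nonneg
  have h3 := h.m_lt_M
  have h4 := h.pm_lt_pM
  rcases le_total p pm with hp | hp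
  · have := h.strictAnti_one.antitoneOn (mem_Iic.2 hp) (mem_Iic.2 le_rfl) hp
    rw [h.map_pm] at this; linarith
  rcases le_total p pM with hp' | hp'
  · have := h.strictMono_two.monotoneOn ⟨le_rfl, h4.le⟩ ⟨hp, hp'⟩ hp
    rw [h.map_pm] at this; linarith
  rcases le_total p 0 with hp'' | hp''
  · have := h.strictAnti_three.antitoneOn ⟨hp', hp''⟩ ⟨h1.le, le_rfl⟩ hp''
    rwa [h.map_zero] at this
  · have := h.strictMono_four.monotoneOn (mem_Ici.2 le_rfl) (mem_Ici.2 hp'') hp''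
    rwa [h.map_zero] at this

/-- This is what permits the downward jump of the slope from g₃ to g₁ at level M: between the two
branches `G` does not exceed its local maximum. -/
lemma IsBranches.le_M_of_mem (hg : IsBranches G m M pm pM g₁ g₃ g₄)
    (h : IsDoubleWell G m M pm pM) {p : ℝ} (hp : p ∈ Icc (g₁ M) (g₃ M)) : G p ≤ M := by
  have h3 : g₃ M = pM := by rw [← h.map_pM, hg.inv₃ pM le_rfl h.pM_neg.le]
  rw [h3] at hp
  rcases le_total p pm with hp' | hp'
  · have := h.strictAnti_one.antitoneOn (mem_Iic.2 (hp.1.trans hp')) (mem_Iic.2 hp') hp.1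
    rwa [hg.map₁ M h.m_lt_M.le] at this
  · have := h.strictMono_two.monotoneOn ⟨hp', hp.2⟩ ⟨h.pm_lt_pM.le, le_rfl⟩ hp.2
    rwa [h.map_pM] at this

/-- This is what permits the upward jump from g₁ to g₃ at level m: between the two branches `G` does
not drop below its local minimum. -/
lemma IsBranches.m_le_of_mem (hg : IsBranches G m M pm pM g₁ g₃ g₄)
    (h : IsDoubleWell G m M pm pM) {p : ℝ} (hp : p ∈ Icc (g₁ m) (g₃ m)) : m ≤ G p := by
  have h3 : g₁ m = pm := by
    conv_lhs => rw [← h.map_pm]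
    exact hg.inv₁ pm le_rfl
  have h5 := hg.mem₃ m h.m_nonneg h.m_lt_M.le
  rw [h3] at hp
  rcases le_total p pM with hp' | hp'
  · have := h.strictMono_two.monotoneOn ⟨le_rfl, h.pm_lt_pM.le⟩ ⟨hp.1, hp'⟩ hp.1
    rwa [h.map_pm] at this
  · have := h.strictAnti_three.antitoneOn ⟨hp', hp.2.trans h5.2⟩ ⟨h5.1, h5.2⟩ hp.2
    rwa [hg.map₃ m h.m_nonneg h.m_lt_M.le] at this

/-- Across the well at 0 the oscillation of `G` is bounded by the level, so at small levels one may
switch between g₃ and g₄ in either direction with a small error. -/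
lemma IsBranches.le_of_mem_three_four (hg : IsBranches G m M pm pM g₁ g₃ g₄)
    (h : IsDoubleWell G m M pm pM) {s p : ℝ} (h0 : 0 ≤ s) (hM : s ≤ M)
    (hp : p ∈ Icc (g₃ s) (g₄ s)) : G p ≤ s := by
  have h3 := hg.mem₃ s h0 hM
  rcases le_total p 0 with hp' | hp'
  · have := h.strictAnti_three.antitoneOn ⟨h3.1, h3.2⟩ ⟨h3.1.trans hp.1, hp'⟩ hp.1
    rwa [hg.map₃ s h0 hM] at this
  · have := h.strictMono_four.monotoneOn (mem_Ici.2 hp') (mem_Ici.2 (hp'.trans hp.2)) hp.2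
    rwa [hg.map₄ s h0] at this

lemma IsBranches.mem_Icc_of_mem_one (hg : IsBranches G m M pm pM g₁ g₃ g₄)
    (h : IsDoubleWell G m M pm pM) {s s' p : ℝ} (hs : m ≤ s) (hss : s ≤ s')
    (hp : p ∈ Icc (g₁ s') (g₁ s)) : G p ∈ Icc s s' := by
  have h1 := hg.le₁ s hs
  have h2 := h.strictAnti_one.antitoneOn (mem_Iic.2 (hp.2.trans h1)) (mem_Iic.2 h1) hp.2
  have h3 := h.strictAnti_one.antitoneOn (mem_Iic.2 ((hp.1.trans hp.2).trans h1))
    (mem_Iic.2 (hp.2.trans h1)) hp.1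
  rw [hg.map₁ s hs] at h2
  rw [hg.map₁ s' (hs.trans hss)] at h3
  exact ⟨h2, h3⟩

lemma IsBranches.mem_Icc_of_mem_three (hg : IsBranches G m M pm pM g₁ g₃ g₄)
    (h : IsDoubleWell G m M pm pM) {s s' p : ℝ} (hs : 0 ≤ s) (hss : s ≤ s') (hM : s' ≤ M)
    (hp : p ∈ Icc (g₃ s') (g₃ s)) : G p ∈ Icc s s' := by
  have h1 := hg.mem₃ s hs (hss.trans hM)
  have h1' := hg.mem₃ s' (hs.trans hss) hM
  have h2 := h.strictAnti_three.antitoneOn ⟨h1'.1.trans hp.1, hp.2.trans h1.2⟩ h1 hp.2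
  have h3 := h.strictAnti_three.antitoneOn h1' ⟨h1'.1.trans hp.1, hp.2.trans h1.2⟩ hp.1
  rw [hg.map₃ s hs (hss.trans hM)] at h2
  rw [hg.map₃ s' (hs.trans hss) hM] at h3
  exact ⟨h2, h3⟩

lemma IsBranches.mem_Icc_of_mem_four (hg : IsBranches G m M pm pM g₁ g₃ g₄)
    (h : IsDoubleWell G m M pm pM) {s s' p : ℝ} (hs : 0 ≤ s) (hss : s ≤ s')
    (hp : p ∈ Icc (g₄ s) (g₄ s')) : G p ∈ Icc s s' := by
  have h1 := hg.nonneg₄ s hs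
  have h2 := h.strictMono_four.monotoneOn (mem_Ici.2 h1) (mem_Ici.2 (h1.trans hp.1)) hp.1
  have h3 := h.strictMono_four.monotoneOn (mem_Ici.2 (h1.trans hp.1))
    (mem_Ici.2 ((h1.trans hp.1).trans hp.2)) hp.2
  rw [hg.map₄ s hs] at h2
  rw [hg.map₄ s' (hs.trans hss)] at h3
  exact ⟨h2, h3⟩

end Branches

/-- The hysteresis state of the level `s`: the momentum lies in the left well at `x` if `s` was at
least `M` at some point on the left of `x` and has stayed above `m` since. -/
def InLeftWell (m M : ℝ) (s : ℝ → ℝ) (x : ℝ) : Prop :=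
  ∃ y ≤ x, M ≤ s y ∧ ∀ z ∈ Icc y x, m < s z

open Classical in
/-- The nonpositive slope at level `s`, on the branch selected by the hysteresis state. -/
noncomputable def wellSlope (g₁ g₃ : ℝ → ℝ) (m M : ℝ) (s : ℝ → ℝ) (x : ℝ) : ℝ :=
  if InLeftWell m M s x then g₁ (s x) else g₃ (s x)

section Hysteresis

variable {m M : ℝ} {s : ℝ → ℝ}

lemma InLeftWell.m_lt {x : ℝ} (h : InLeftWell m M s x) : m < s x := by
  obtain ⟨y, hy, -, h⟩ := h
  exact h x ⟨hy, le_rfl⟩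

lemma inLeftWell_of_le (hmM : m < M) {x : ℝ} (h : M ≤ s x) : InLeftWell m M s x :=
  ⟨x, le_rfl, h, fun z hz => by
    rw [le_antisymm hz.2 hz.1]; exact hmM.trans_le h⟩

lemma InLeftWell.of_forall_lt {x y : ℝ} (h : InLeftWell m M s x) (hxy : x ≤ y)
    (hz : ∀ z ∈ Icc x y, m < s z) : InLeftWell m M s y := by
  obtain ⟨w, hw, hwM, hwm⟩ := h
  refine ⟨w, hw.trans hxy, hwM, fun z hz' => ?_⟩
  rcases le_total z x with h1 | h1
  · exact hwm z ⟨hz'.1, h1⟩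
  · exact hz z ⟨h1, hz'.2⟩

lemma InLeftWell.of_forall_gt {x y : ℝ} (h : InLeftWell m M s y) (hxy : x ≤ y)
    (hz : ∀ z ∈ Ioc x y, s z < M) : InLeftWell m M s x := by
  obtain ⟨w, hw, hwM, hwm⟩ := h
  have hwx : w ≤ x := by
    by_contra! hc
    exact absurd hwM (not_le.2 (hz w ⟨hc, hw⟩))
  exact ⟨w, hwx, hwM, fun z hz' => hwm z ⟨hz'.1, hz'.2.trans hxy⟩⟩

/-- The state is right-continuous because leaving requires the level to come down to m and entering
requires it to reach M; a state already decided at y has strict room on the relevant side. -/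
lemma eventually_right_inLeftWell_iff (hmM : m < M) (hs : Continuous s) (y : ℝ) :
    ∀ᶠ x in 𝓝[>] y, (InLeftWell m M s x ↔ InLeftWell m M s y) := by
  have hIcc : ∀ {P : ℝ → Prop}, (∀ᶠ z in 𝓝 y, P z) → ∀ᶠ x in 𝓝[>] y, ∀ z ∈ Icc y x, P z := by
    intro P hP
    obtain ⟨ε, hε, hb⟩ := Metric.eventually_nhds_iff_ball.1 hP
    filter_upwards [Ioo_mem_nhdsGT (show y < y + ε by linarith)] with x hx z hz
    refine hb z ?_
    rw [Metric.mem_ball, Real.dist_eq, abs_of_nonneg (sub_nonneg.2 hz.1)]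
    linarith [hz.2, hx.2]
  by_cases hy : InLeftWell m M s y
  · filter_upwards [hIcc (hs.continuousAt.eventually (lt_mem_nhds hy.m_lt)), self_mem_nhdsWithin]
      with x hx hx'
    exact iff_of_true (hy.of_forall_lt (le_of_lt hx') hx) hy
  · have hM : s y < M := by
      by_contra! hc
      exact hy (inLeftWell_of_le hmM hc)
    filter_upwards [hIcc (hs.continuousAt.eventually (gt_mem_nhds hM)), self_mem_nhdsWithin]
      with x hx hx'
    refine iff_of_false (fun hc => hy ?_) hy
    exact hc.of_forall_gt (le_of_lt hx') fun z hz => hx z (Ioc_subset_Icc_self hz)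

/-- The state also has a left limit, and a change exactly at y is possible in two ways only:
entering at level M or leaving at level m. -/
lemma exists_left_inLeftWell_iff (hmM : m < M) (hs : Continuous s) (y : ℝ) :
    ∃ b : Prop, (∀ᶠ x in 𝓝[<] y, (InLeftWell m M s x ↔ b)) ∧
      ((b ↔ InLeftWell m M s y) ∨ (¬b ∧ InLeftWell m M s y ∧ s y = M) ∨
        (b ∧ ¬InLeftWell m M s y ∧ s y = m)) := by
  have hIoo : ∀ {P : ℝ → Prop}, (∀ᶠ z in 𝓝 y, P z) → ∃ a < y, ∀ z ∈ Ioc a y, P z := by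
    intro P hP
    obtain ⟨ε, hε, hb⟩ := Metric.eventually_nhds_iff_ball.1 hP
    refine ⟨y - ε, by linarith, fun z hz => hb z ?_⟩
    rw [Metric.mem_ball, Real.dist_eq, abs_sub_comm, abs_of_nonneg (sub_nonneg.2 hz.2)]
    linarith [hz.1]
  rcases lt_or_ge m (s y) with hm | hm
  · obtain ⟨a, ha, hP⟩ := hIoo (hs.continuousAt.eventually (lt_mem_nhds hm))
    by_cases hex : ∃ x ∈ Ioo a y, InLeftWell m M s x
    · obtain ⟨x, hx, hxL⟩ := hex
      have hall : ∀ z ∈ Icc x y, InLeftWell m M s z := fun z hz =>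
        hxL.of_forall_lt hz.1 fun w hw => hP w ⟨hx.1.trans_le hw.1, hw.2.trans hz.2⟩
      refine ⟨True, ?_, Or.inl (iff_of_true trivial (hall y ⟨hx.2.le, le_rfl⟩))⟩
      filter_upwards [Ioo_mem_nhdsLT hx.2] with z hz
      exact iff_of_true (hall z ⟨hz.1.le, hz.2.le⟩) trivial
    · push Not at hex
      refine ⟨False, ?_, ?_⟩
      · filter_upwards [Ioo_mem_nhdsLT ha] with z hz
        exact iff_of_false (hex z hz) id
      · by_cases hy : InLeftWell m M s y
        · refine Or.inr (Or.inl ⟨id, hy, le_antisymm ?_ ?_⟩)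
          · refine le_of_tendsto (hs.continuousAt.tendsto.mono_left
              (nhdsWithin_le_nhds (s := Iio y))) ?_
            filter_upwards [Ioo_mem_nhdsLT ha] with z hz
            by_contra! hc
            exact hex z hz (inLeftWell_of_le hmM hc.le)
          · by_contra! hc
            obtain ⟨a', ha', hP'⟩ := hIoo (hs.continuousAt.eventually (gt_mem_nhds hc))
            obtain ⟨z, hz1, hz2⟩ := exists_between (max_lt ha ha')
            exact hex z ⟨(le_max_left _ _).trans_lt hz1, hz2⟩ (hy.of_forall_gt hz2.le fun w hw =>
              hP' w ⟨((le_max_right _ _).trans_lt hz1).trans hw.1, hw.2⟩)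
        · exact Or.inl (iff_of_false id hy)
  · have hy : ¬InLeftWell m M s y := fun hc => absurd hc.m_lt (not_lt.2 hm)
    obtain ⟨a, ha, hP⟩ := hIoo (hs.continuousAt.eventually (gt_mem_nhds (hm.trans_lt hmM)))
    by_cases hex : ∃ x ∈ Ioo a y, ¬InLeftWell m M s x
    · obtain ⟨x, hx, hxL⟩ := hex
      refine ⟨False, ?_, Or.inl (iff_of_false id hy)⟩
      filter_upwards [Ioo_mem_nhdsLT hx.2] with z hz
      refine iff_of_false (fun hc => hxL ?_) id
      exact hc.of_forall_gt hz.1.le fun w hw => hP w ⟨hx.1.trans hw.1, hw.2.trans hz.2.le⟩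
    · push Not at hex
      refine ⟨True, ?_, Or.inr (Or.inr ⟨trivial, hy, le_antisymm hm ?_⟩)⟩
      · filter_upwards [Ioo_mem_nhdsLT ha] with z hz
        exact iff_of_true (hex z hz) trivial
      · refine ge_of_tendsto (hs.continuousAt.tendsto.mono_left
          (nhdsWithin_le_nhds (s := Iio y))) ?_
        filter_upwards [Ioo_mem_nhdsLT ha] with z hz
        exact (hex z hz).m_lt.le

lemma inLeftWell_iff_of_monotoneOn (hmM : m < M) {a x : ℝ} (hax : a ≤ x)
    (hs : MonotoneOn s (Icc a x) ∨ AntitoneOn s (Icc a x)) :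
    InLeftWell m M s x ↔ m < s x ∧ (M ≤ s x ∨ InLeftWell m M s a) := by
  constructor
  · intro h
    refine ⟨h.m_lt, ?_⟩
    obtain ⟨w, hw, hwM, hwm⟩ := h
    rcases le_total w a with h1 | h1
    · exact Or.inr ⟨w, h1, hwM, fun z hz => hwm z ⟨hz.1, hz.2.trans hax⟩⟩
    · rcases hs with hs | hs
      · exact Or.inl (hwM.trans (hs ⟨h1, hw⟩ ⟨hax, le_rfl⟩ hw))
      · exact Or.inr (inLeftWell_of_le hmM (hwM.trans (hs ⟨le_rfl, hax⟩ ⟨h1, hw⟩ h1)))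
  · rintro ⟨h1, h2 | h2⟩
    · exact inLeftWell_of_le hmM h2
    · refine h2.of_forall_lt hax fun z hz => ?_
      rcases hs with hs | hs
      · exact h2.m_lt.trans_le (hs ⟨le_rfl, hax⟩ hz hz.1)
      · exact h1.trans_le (hs hz ⟨hax, le_rfl⟩ hz.2)

lemma InLeftWell.mono {s' : ℝ → ℝ} (hss : ∀ x, s x ≤ s' x) {x : ℝ} (h : InLeftWell m M s x) :
    InLeftWell m M s' x := by
  obtain ⟨y, hy, hM, hm⟩ := h
  exact ⟨y, hy, hM.trans (hss y), fun z hz => (hm z hz).trans_le (hss z)⟩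

variable {G : ℝ → ℝ} {pm pM : ℝ} {g₁ g₃ g₄ : ℝ → ℝ}

lemma tendsto_wellSlope {F : Filter ℝ} {y : ℝ} (hF : F ≤ 𝓝 y) (hs : Continuous s)
    (c₁ : Continuous g₁) (c₃ : Continuous g₃) {b : Prop} [Decidable b]
    (hb : ∀ᶠ x in F, (InLeftWell m M s x ↔ b)) :
    Tendsto (wellSlope g₁ g₃ m M s) F (𝓝 (if b then g₁ (s y) else g₃ (s y))) := by
  by_cases h : b
  · rw [if_pos h]
    refine ((c₁.comp hs).tendsto y |>.mono_left hF).congr' ?_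
    filter_upwards [hb] with x hx
    rw [wellSlope, if_pos (hx.2 h)]; rfl
  · rw [if_neg h]
    refine ((c₃.comp hs).tendsto y |>.mono_left hF).congr' ?_
    filter_upwards [hb] with x hx
    rw [wellSlope, if_neg (fun hc => h (hx.1 hc))]; rfl

/-- Where the state does not change, both one-sided limits are the same root of G = level. At an
entry (level M) the slope jumps down and only the upper inequality is tested; at an exit (level m)
it jumps up and only the lower one is. -/
lemma isSlope_wellSlope (h : IsDoubleWell G m M pm pM) (hg : IsBranches G m M pm pM g₁ g₃ g₄)
    {W : ℝ → ℝ} {lam : ℝ} (hW : Continuous W) (h0 : ∀ x, 0 ≤ lam - W x) :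
    IsSlope G W lam 0 (wellSlope g₁ g₃ m M fun x => lam - W x) := by
  classical
  intro y
  have hs : Continuous fun x => lam - W x := by fun_prop
  obtain ⟨b, hb, hcase⟩ := exists_left_inLeftWell_iff h.m_lt_M hs y
  have hL := tendsto_wellSlope nhdsWithin_le_nhds hs hg.cont₁ hg.cont₃ hb
  have hR := tendsto_wellSlope nhdsWithin_le_nhds hs hg.cont₁ hg.cont₃
    (eventually_right_inLeftWell_iff h.m_lt_M hs y)
  refine ⟨_, _, hL, hR, ?_⟩
  have key1 : InLeftWell m M (fun x => lam - W x) y → G (g₁ (lam - W y)) = lam - W y :=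
    fun hy => hg.map₁ _ hy.m_lt.le
  have key3 : ¬InLeftWell m M (fun x => lam - W x) y → G (g₃ (lam - W y)) = lam - W y := by
    intro hy
    refine hg.map₃ _ (h0 y) ?_
    by_contra! hc
    exact hy (inLeftWell_of_le h.m_lt_M hc.le)
  rcases hcase with hc | ⟨hc1, hc2, hc3⟩ | ⟨hc1, hc2, hc3⟩
  · by_cases hy : InLeftWell m M (fun x => lam - W x) y
    · rw [if_pos hy, if_pos (hc.2 hy), Icc_self]
      constructor <;> rintro p rfl <;> rw [key1 hy] <;> linarith
    · rw [if_neg hy, if_neg (fun hb => hy (hc.1 hb)), Icc_self]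
      constructor <;> rintro p rfl <;> rw [key3 hy] <;> linarith
  · rw [if_pos hc2, if_neg hc1]
    have hc3' : lam - W y = M := hc3
    rw [hc3']
    have hlt : g₁ M < g₃ M := by
      have h1 := hg.le₁ M h.m_lt_M.le
      have h2 := (hg.mem₃ M (h.m_nonneg.trans h.m_lt_M.le) le_rfl).1
      linarith [h.pm_lt_pM]
    constructor
    · intro p hp
      exact absurd (hp.1.trans hp.2) (not_le.2 hlt)
    · intro p hp
      have := hg.le_M_of_mem h hp
      linarith
  · rw [if_neg hc2, if_pos hc1]
    have hc3' : lam - W y = m := hc3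
    rw [hc3']
    have hlt : g₁ m < g₃ m := by
      have h1 := hg.le₁ m le_rfl
      have h2 := (hg.mem₃ m h.m_nonneg h.m_lt_M.le).1
      linarith [h.pm_lt_pM]
    constructor
    · intro p hp
      have := hg.m_le_of_mem h hp
      linarith
    · intro p hp
      exact absurd (hp.1.trans hp.2) (not_le.2 hlt)

lemma tendsto_wellSlope_of_M_lt (hg : IsBranches G m M pm pM g₁ g₃ g₄) (hmM : m < M)
    (hs : Continuous s) {y : ℝ} (hy : M < s y) :
    Tendsto (wellSlope g₁ g₃ m M s) (𝓝 y) (𝓝 (g₁ (s y))) := by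
  have : ∀ᶠ x in 𝓝 y, (InLeftWell m M s x ↔ True) := by
    filter_upwards [hs.continuousAt.eventually (lt_mem_nhds hy)] with x hx
    exact iff_of_true (inLeftWell_of_le hmM (le_of_lt hx)) trivial
  simpa using tendsto_wellSlope le_rfl hs hg.cont₁ hg.cont₃ this

lemma tendsto_wellSlope_of_lt_m (hg : IsBranches G m M pm pM g₁ g₃ g₄)
    (hs : Continuous s) {y : ℝ} (hy : s y < m) :
    Tendsto (wellSlope g₁ g₃ m M s) (𝓝 y) (𝓝 (g₃ (s y))) := by
  have : ∀ᶠ x in 𝓝 y, (InLeftWell m M s x ↔ False) := by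
    filter_upwards [hs.continuousAt.eventually (gt_mem_nhds hy)] with x hx
    exact iff_of_false (fun hc => absurd hc.m_lt (not_lt.2 (le_of_lt hx))) id
  simpa using tendsto_wellSlope le_rfl hs hg.cont₁ hg.cont₃ this

/-- Raising the level decreases both branches, and it can only move the state into the left well,
where slopes are at most pm, below every value of g₃. -/
lemma wellSlope_anti (h : IsDoubleWell G m M pm pM) (hg : IsBranches G m M pm pM g₁ g₃ g₄)
    {s' : ℝ → ℝ} (h0 : ∀ x, 0 ≤ s x) (hss : ∀ x, s x ≤ s' x) (x : ℝ) :
    wellSlope g₁ g₃ m M s' x ≤ wellSlope g₁ g₃ m M s x := by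
  rw [wellSlope, wellSlope]
  split_ifs with h1 h2 h2
  · exact hg.anti₁.antitone (hss x)
  · have h3 := hg.le₁ _ h1.m_lt.le
    have h4 : s x ≤ M := by
      by_contra! hc
      exact h2 (inLeftWell_of_le h.m_lt_M hc.le)
    have h5 := (hg.mem₃ _ (h0 x) h4).1
    linarith [h.pm_lt_pM]
  · exact absurd (h2.mono hss) h1
  · exact hg.anti₃.antitone (hss x)

lemma wellSlope_nonpos (h : IsDoubleWell G m M pm pM) (hg : IsBranches G m M pm pM g₁ g₃ g₄)
    (h0 : ∀ x, 0 ≤ s x) (x : ℝ) : wellSlope g₁ g₃ m M s x ≤ 0 := by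
  rw [wellSlope]
  split_ifs with h1
  · have h3 := hg.le₁ _ h1.m_lt.le
    linarith [h.pm_lt_pM, h.pM_neg]
  · have h4 : s x ≤ M := by
      by_contra! hc
      exact h1 (inLeftWell_of_le h.m_lt_M hc.le)
    exact (hg.mem₃ _ (h0 x) h4).2

end Hysteresis

end DoubleWellHJ

/-! ### Shifts and the strong law for blocks -/

namespace DoubleWellHJ

open ProbabilityTheory

/-- The shift of a sequence by `n`. -/
def shift (n : ℤ) (v : ℤ → unitInterval) : ℤ → unitInterval := fun i => v (i + n)

lemma measurable_shift (n : ℤ) : Measurable (shift n) :=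
  measurable_pi_iff.2 fun i => measurable_pi_apply (i + n)

lemma map_shift_infinitePi (P : ℤ → Measure unitInterval) [∀ i, IsProbabilityMeasure (P i)]
    (n : ℤ) : (Measure.infinitePi P).map (shift n) = Measure.infinitePi fun i => P (i + n) := by
  refine Measure.eq_infinitePi _ fun s t ht => ?_
  rw [Measure.map_apply (measurable_shift n) (MeasurableSet.pi s.countable_toSet fun i _ => ht i)]
  have h1 : shift n ⁻¹' Set.pi s t =
      Set.pi (s.map (Equiv.addRight n).toEmbedding : Finset ℤ) fun i => t (i - n) := by
    ext v
    simp only [shift, mem_preimage, Set.mem_pi, Finset.coe_map, mem_image, Finset.mem_coe,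
      Equiv.coe_toEmbedding, Equiv.coe_addRight]
    constructor
    · rintro h _ ⟨i, hi, rfl⟩
      rw [add_sub_cancel_right]; exact h i hi
    · intro h i hi
      simpa using h (i + n) ⟨i, hi, rfl⟩
  rw [h1, Measure.infinitePi_pi _ fun i _ => ht (i - n), Finset.prod_map]
  simp

lemma measurePreserving_shift {P : ℤ → Measure unitInterval} [∀ i, IsProbabilityMeasure (P i)]
    {n : ℤ} (hP : ∀ i, P (i + n) = P i) :
    MeasurePreserving (shift n) (Measure.infinitePi P) (Measure.infinitePi P) := by
  refine ⟨measurable_shift n, ?_⟩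
  rw [map_shift_infinitePi]
  congr 1
  funext i
  exact hP i

/-- Strong law of large numbers for functions of disjoint blocks of independent coordinates. -/
lemma ae_tendsto_block_average {P : ℤ → Measure unitInterval} [∀ i, IsProbabilityMeasure (P i)]
    {N : ℤ} (hN : 0 < N) (hP : ∀ k i : ℤ, P (i + k * N) = P i) {h : (ℤ → unitInterval) → ℝ}
    (hm : Measurable h) {C : ℝ} (hC : ∀ v, |h v| ≤ C)
    (hdep : ∀ v v', (∀ i, 0 ≤ i → i < N → v i = v' i) → h v = h v') {a : ℕ → ℤ}
    (ha : Function.Injective a) :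
    ∀ᵐ v ∂Measure.infinitePi P, Tendsto
      (fun n : ℕ => (∑ k ∈ Finset.range n, h (shift (a k * N) v)) / n) atTop
      (𝓝 (∫ v, h v ∂Measure.infinitePi P)) := by
  classical
  set ν := Measure.infinitePi P
  have hmp : ∀ k : ℤ, MeasurePreserving (shift (k * N)) ν ν := fun k =>
    measurePreserving_shift (hP k)
  have hint : ∀ k : ℤ, Integrable (fun v => h (shift (k * N) v)) ν := fun k =>
    Integrable.of_bound (hm.comp (measurable_shift _)).aestronglyMeasurable C
      (Eventually.of_forall fun v => hC _)
  have hind : iIndepFun (fun (i : ℤ) (v : ℤ → unitInterval) => v i) ν :=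
    iIndepFun_infinitePi (X := fun (_ : ℤ) (x : unitInterval) => x) fun _ => measurable_id
  have hpair : Pairwise fun j k => IndepFun (fun v => h (shift (a j * N) v))
      (fun v => h (shift (a k * N) v)) ν := by
    intro j k hjk
    let S : ℕ → Finset ℤ := fun j => Finset.Ico (a j * N) (a j * N + N)
    -- Padding a block by 0 exhibits each summand as a function of its own coordinates; independence
    -- of disjoint coordinate sets then gives pairwise independence.
    let ext : ∀ S : Finset ℤ, (S → unitInterval) → (ℤ → unitInterval) :=
      fun S z i => if hi : i ∈ S then z ⟨i, hi⟩ else 0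
    have hext : ∀ S, Measurable (ext S) := by
      intro S
      refine measurable_pi_iff.2 fun i => ?_
      by_cases hi : i ∈ S
      · simp only [ext, hi, dif_pos]; exact measurable_pi_apply _
      · simp only [ext, hi, dif_neg, not_false_eq_true]; exact measurable_const
    have hdisj : Disjoint (S j) (S k) := by
      rw [Finset.disjoint_left]
      intro i hi hi'
      simp only [S, Finset.mem_Ico] at hi hi'
      have hne : a j ≠ a k := fun hc => hjk (ha hc)
      rcases lt_or_gt_of_ne hne with hlt | hlt
      · have : (a j + 1) * N ≤ a k * N := mul_le_mul_of_nonneg_right (by omega) hN.le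
        rw [add_mul, one_mul] at this
        omega
      · have : (a k + 1) * N ≤ a j * N := mul_le_mul_of_nonneg_right (by omega) hN.le
        rw [add_mul, one_mul] at this
        omega
    have hI := hind.indepFun_finset (S j) (S k) hdisj fun i => measurable_pi_apply i
    have hcomp : ∀ j, (fun v => h (shift (a j * N) v)) =
        (fun z => h (shift (a j * N) (ext (S j) z))) ∘ fun v (i : S j) => v i := by
      intro j
      funext v
      refine hdep _ _ fun i hi0 hiN => ?_
      have : i + a j * N ∈ S j := by simp only [S, Finset.mem_Ico]; omega
      simp only [shift, ext, this, dif_pos]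
    rw [hcomp j, hcomp k]
    exact hI.comp ((hm.comp (measurable_shift _)).comp (hext _))
      ((hm.comp (measurable_shift _)).comp (hext _))
  have hid : ∀ k : ℕ, IdentDistrib (fun v => h (shift (a k * N) v)) (fun v => h (shift (a 0 * N) v))
      ν ν := by
    have key : ∀ k : ℤ, ν.map (fun v => h (shift (k * N) v)) = ν.map h := by
      intro k
      have := Measure.map_map (μ := ν) hm (measurable_shift (k * N))
      rw [(hmp k).map_eq] at this
      exact this.symm
    intro k
    exact ⟨(hm.comp (measurable_shift _)).aemeasurable, (hm.comp (measurable_shift _)).aemeasurable,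
      by rw [key, key]⟩
  have := strong_law_ae_real (fun (k : ℕ) v => h (shift (a k * N) v)) (hint _) hpair hid
  have hE : ∫ v, h (shift (a 0 * N) v) ∂ν = ∫ v, h v ∂ν := by
    have h1 := integral_map (μ := ν) (measurable_shift (a 0 * N)).aemeasurable
      hm.aestronglyMeasurable
    rw [(hmp (a 0)).map_eq] at h1
    exact h1.symm
  rw [hE] at this
  exact this

end DoubleWellHJ

/-! ### The ergodic theorem for environments with resets -/

namespace DoubleWellHJ

open ProbabilityTheory

/-- The map x ↦ ∫₀ˣ q - θx is Lipschitz with constant C + |θ|, so its values at multiples of N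
decide. The constant `D` covers both the first n₀ blocks and an incomplete last block, and is
absorbed by η L / 2 for large L. -/
lemma hasMean_of_blocks {q : ℝ → ℝ} (hq : Measurable q) {C θ : ℝ} (hC : ∀ x, |q x| ≤ C)
    (h : ∀ η > 0, ∃ N > 0, ∃ n₀ : ℕ, ∀ n : ℕ, n₀ ≤ n →
      |(∫ t in (0 : ℝ)..(n * N), q t) - θ * (n * N)| ≤ η * (n * N) ∧
      |(∫ t in (0 : ℝ)..(-(n * N)), q t) - θ * (-(n * N))| ≤ η * (n * N)) :
    HasMean q θ := by
  intro η hη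
  obtain ⟨N, hN, n₀, h⟩ := h (η / 2) (by positivity)
  have hC0 : 0 ≤ C := (abs_nonneg _).trans (hC 0)
  set D := (C + |θ|) * ((n₀ + 1) * N)
  have hD : 0 ≤ D := by positivity
  refine ⟨2 * D / η + 1, by positivity, fun L hL x hx => ?_⟩
  have hDL : D ≤ η / 2 * L := by
    have : 2 * D / η ≤ L := by linarith
    rw [div_le_iff₀ hη] at this
    linarith
  have hdiff : ∀ y, |((∫ t in (0 : ℝ)..x, q t) - θ * x) - ((∫ t in (0 : ℝ)..y, q t) - θ * y)| ≤
      (C + |θ|) * |x - y| := by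
    intro y
    have h1 := abs_intervalIntegral_le hC y x
    rw [← intervalIntegral.integral_interval_sub_left (intervalIntegrable_of_bound hq hC 0 _)
      (intervalIntegrable_of_bound hq hC 0 _)] at h1
    calc _ = |((∫ t in (0 : ℝ)..x, q t) - ∫ t in (0 : ℝ)..y, q t) - θ * (x - y)| := by
          congr 1; ring
      _ ≤ C * |x - y| + |θ| * |x - y| := (abs_sub _ _).trans (add_le_add h1 (abs_mul _ _).le)
      _ = _ := by ring
  set n := ⌊|x| / N⌋₊
  have hn1 : n * N ≤ |x| := by
    rw [← le_div_iff₀ hN]; exact Nat.floor_le (by positivity)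
  have hn2 : |x| < (n + 1) * N := by
    rw [← div_lt_iff₀ hN]; exact Nat.lt_floor_add_one _
  rcases lt_or_ge n n₀ with hn | hn
  · have h1 := hdiff 0
    simp only [intervalIntegral.integral_same, mul_zero, sub_zero] at h1
    have h2 : (n : ℝ) + 1 ≤ n₀ + 1 := by exact_mod_cast (by omega : n + 1 ≤ n₀ + 1)
    have h3 : (C + |θ|) * |x| ≤ D :=
      mul_le_mul_of_nonneg_left (hn2.le.trans (mul_le_mul_of_nonneg_right h2 hN.le)) (by positivity)
    linarith
  · have key : ∀ y, |x - y| ≤ N → |(∫ t in (0 : ℝ)..y, q t) - θ * y| ≤ η / 2 * (n * N) →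
        |(∫ t in (0 : ℝ)..x, q t) - θ * x| ≤ η * L := by
      intro y hxy hy
      have h1 := hdiff y
      have h3 : (C + |θ|) * |x - y| ≤ D := by
        refine mul_le_mul_of_nonneg_left (hxy.trans ?_) (by positivity)
        nlinarith [(Nat.cast_nonneg n₀ : (0 : ℝ) ≤ n₀)]
      have h4 : η / 2 * (n * N) ≤ η / 2 * L := by gcongr; exact hn1.trans hx
      have h5 := abs_add_le (((∫ t in (0 : ℝ)..x, q t) - θ * x) -
        ((∫ t in (0 : ℝ)..y, q t) - θ * y)) ((∫ t in (0 : ℝ)..y, q t) - θ * y)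
      rw [sub_add_cancel] at h5
      linarith
    rcases abs_cases x with ⟨hx1, hx2⟩ | ⟨hx1, hx2⟩
    · refine key _ ?_ (h n hn).1
      rw [abs_le]; constructor <;> linarith
    · refine key _ ?_ (h n hn).2
      rw [abs_le]; constructor <;> linarith

lemma periodic_measure {P : ℤ → Measure unitInterval} (hP : ∀ i, P (i + 2) = P i) (k i : ℤ) : P (i + k * 2) = P i := by
  induction k using Int.induction_on with
  | zero => simp
  | succ n ih => rw [← ih, ← hP (i + n * 2)]; congr 1; ring
  | pred n ih => rw [← ih, ← hP (i + (-n - 1) * 2)]; congr 1; ring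

section Recurrence

variable {P : ℤ → Measure unitInterval} [∀ i, IsProbabilityMeasure (P i)]

/-- If `A` were never hit, the averages of its indicator would vanish, contradicting their limit P r
A ≠ 0. -/
lemma ae_exists_mem_of_injective (hP : ∀ i, P (i + 2) = P i) {A : Set unitInterval}
    (hA : MeasurableSet A) {r : ℤ} (hr : P r A ≠ 0) {a : ℕ → ℤ} (ha : Function.Injective a) :
    ∀ᵐ v ∂Measure.infinitePi P, ∃ k, v (r + a k * 2) ∈ A := by
  classical
  have hPr : ∀ i, (fun i => P (i + r)) (i + 2) = P (i + r) := fun i => by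
    simp only [← hP (i + r)]; congr 1; ring
  have hae := ae_tendsto_block_average (P := fun i => P (i + r)) two_pos (periodic_measure (P := fun i => P (i + r)) hPr)
    (h := fun v => A.indicator 1 (v 0))
    ((measurable_const.indicator hA).comp (measurable_pi_apply 0)) (C := 1)
    (fun v => by
      by_cases h : v 0 ∈ A <;> simp [h]) (fun v v' h => by rw [h 0 le_rfl two_pos]) ha
  rw [← map_shift_infinitePi] at hae
  have hae := ae_of_ae_map (measurable_shift r).aemeasurable hae
  filter_upwards [hae] with v hv
  by_contra! hcon
  have h0 : ∀ k, A.indicator (1 : unitInterval → ℝ) (shift (a k * 2) (shift r v) 0) = 0 := by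
    intro k
    refine indicator_of_notMem ?_ _
    have := hcon k
    simpa [shift, add_comm] using this
  simp only [h0, Finset.sum_const_zero, zero_div] at hv
  have h1 := tendsto_nhds_unique hv tendsto_const_nhds
  rw [map_shift_infinitePi] at h1
  have h2 := (measurePreserving_eval_infinitePi (fun i => P (i + r)) 0)
  have h3 := integral_map (μ := Measure.infinitePi fun i => P (i + r)) h2.measurable.aemeasurable
    (f := A.indicator (1 : unitInterval → ℝ))
    (measurable_const.indicator hA : Measurable _).aestronglyMeasurable
  rw [h2.map_eq] at h3
  simp only [Function.eval] at h3
  rw [h1, integral_indicator_one hA, zero_add, measureReal_eq_zero_iff] at h3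
  exact hr h3

lemma ae_exists_mem (hP : ∀ i, P (i + 2) = P i) {A : Set unitInterval}
    (hA : MeasurableSet A) {r : ℤ} (hr : P r A ≠ 0) :
    ∀ᵐ v ∂Measure.infinitePi P, ∀ n : ℤ, (∃ j ≥ n, v j ∈ A) ∧ ∃ j ≤ n, v j ∈ A := by
  rw [ae_all_iff]
  intro n
  have h1 := ae_exists_mem_of_injective hP hA hr (a := fun k : ℕ => |n| + |r| + k)
    fun i j h => by simpa using h
  have h2 := ae_exists_mem_of_injective hP hA hr (a := fun k : ℕ => -(|n| + |r| + k))
    fun i j h => by simpa using h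
  filter_upwards [h1, h2] with v h1 h2
  obtain ⟨k, hk⟩ := h1
  obtain ⟨l, hl⟩ := h2
  have e1 := neg_abs_le n
  have e2 := neg_abs_le r
  have e3 := le_abs_self n
  have e4 := le_abs_self r
  exact ⟨⟨_, by omega, hk⟩, ⟨_, by omega, hl⟩⟩

lemma measurable_intervalIntegral {q : (ℤ → unitInterval) → ℝ → ℝ}
    (hq : Measurable (Function.uncurry q)) {a b : ℝ} (hab : a ≤ b) :
    Measurable fun v => ∫ x in a..b, q v x := by
  simp only [intervalIntegral.integral_of_le hab]
  exact (hq.stronglyMeasurable.integral_prod_right (ν := volume.restrict (Ioc a b))).measurable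

/-- Ergodic theorem for functions of the environment that are determined by the values of the
sequence from any site of `A` on. -/
theorem ae_hasMean (hP : ∀ i, P (i + 2) = P i) {q : (ℤ → unitInterval) → ℝ → ℝ}
    (hq : Measurable (Function.uncurry q)) {C : ℝ} (hC : ∀ v x, |q v x| ≤ C)
    (hsh : ∀ (n : ℤ) v x, q (shift n v) x = q v (x + n)) {A : Set unitInterval}
    (hA : MeasurableSet A)
    (hloc : ∀ v v' (j k : ℤ), (∀ i, j ≤ i → i ≤ k → v i = v' i) → v j ∈ A →
      ∀ x, (j : ℝ) ≤ x → x < k → q v x = q v' x)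
    {r : ℤ} (hr : P r A ≠ 0) :
    ∀ᵐ v ∂Measure.infinitePi P,
      HasMean (q v) ((∫ v, (∫ x in (0 : ℝ)..2, q v x) ∂Measure.infinitePi P) / 2) := by
  classical
  set ν := Measure.infinitePi P
  set θ := (∫ v, (∫ x in (0 : ℝ)..2, q v x) ∂ν) / 2 with hθ
  have hqv : ∀ v, Measurable (q v) := fun v => hq.comp measurable_prodMk_left
  have hC0 : 0 ≤ C := (abs_nonneg _).trans (hC 0 0)
  have hii : ∀ v a b, IntervalIntegrable (q v) volume a b := fun v a b =>
    intervalIntegrable_of_bound (hqv v) (hC v) a b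
  have hshint : ∀ (n : ℤ) v (a b : ℝ), ∫ x in a..b, q (shift n v) x =
      ∫ x in (a + n)..(b + n), q v x := by
    intro n v a b
    simp only [hsh]
    rw [intervalIntegral.integral_comp_add_right (fun t => q v t)]
  -- no site of `A` among the first `K` sites
  let R : ℕ → (ℤ → unitInterval) → ℝ := fun K v => if ∀ j : ℕ, j < K → v j ∉ A then 1 else 0
  have hR01 : ∀ K v, 0 ≤ R K v ∧ R K v ≤ 1 := fun K v => by simp only [R]; split_ifs <;> norm_num
  have hRm : ∀ K, Measurable (R K) := by
    intro K
    refine Measurable.ite ?_ measurable_const measurable_const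
    simp only [ofPred_forall]
    exact MeasurableSet.iInter fun j => MeasurableSet.iInter fun _ =>
      (measurable_pi_apply (X := fun _ => unitInterval) (j : ℤ)) hA.compl
  have hRlim : Tendsto (fun K => ∫ v, R K v ∂ν) atTop (𝓝 0) := by
    have : Tendsto (fun K => ∫ v, R K v ∂ν) atTop (𝓝 (∫ _, (0 : ℝ) ∂ν)) := by
      refine tendsto_integral_of_dominated_convergence (fun _ => 1)
        (fun K => (hRm K).aestronglyMeasurable) (integrable_const _)
        (fun K => Eventually.of_forall fun v => ?_) ?_
      · rw [Real.norm_eq_abs, abs_of_nonneg (hR01 K v).1]; exact (hR01 K v).2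
      · filter_upwards [ae_exists_mem hP hA hr] with v hv
        obtain ⟨j, hj, hjA⟩ := (hv 0).1
        refine tendsto_const_nhds.congr' ?_
        filter_upwards [eventually_gt_atTop j.toNat] with K hK
        rw [eq_comm]
        refine if_neg fun h => h _ hK ?_
        rwa [Int.toNat_of_nonneg hj]
    simpa using this
  -- Truncation to the sites of one block turns a block integral into a function of independent
  -- data.
  let T : ℤ → (ℤ → unitInterval) → ℤ → unitInterval := fun N v i =>
    if 0 ≤ i ∧ i < N then v i else 0
  have hTm : ∀ N, Measurable (T N) := by
    intro N
    refine measurable_pi_iff.2 fun i => ?_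
    by_cases hi : 0 ≤ i ∧ i < N
    · simp only [T, hi]; exact measurable_pi_apply i
    · simp only [T, hi, if_false]; exact measurable_const
  let B : ℤ → (ℤ → unitInterval) → ℝ := fun N v => ∫ x in (0 : ℝ)..N, q v x
  have hBm : ∀ N : ℤ, 0 < N → Measurable (B N) := fun N hN =>
    measurable_intervalIntegral hq (by exact_mod_cast hN.le)
  have hBC : ∀ N : ℤ, 0 < N → ∀ v, |B N v| ≤ C * N := fun N hN v => by
    have := abs_intervalIntegral_le (hC v) 0 N
    rwa [sub_zero, abs_of_pos (show (0 : ℝ) < N by exact_mod_cast hN)] at this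
  -- Truncation is harmless from the first site of `A` on. What is lost is [0, j] with j < K, and
  -- the last unit [N - 1, N], since locality on it would need agreement at the site N outside the
  -- block. If there is no site of `A` among the first K, the whole block is given up.
  have hBT : ∀ (N : ℤ) (K : ℕ), (K : ℤ) < N → ∀ v,
      |B N v - B N (T N v)| ≤ 2 * C * (K + 1) + 2 * C * N * R K v := by
    intro N K hKN v
    have hN : (0 : ℝ) < N := by exact_mod_cast (by omega : (0 : ℤ) < N)
    have hd : ∀ x, |q v x - q (T N v) x| ≤ 2 * C := fun x =>
      (abs_sub _ _).trans (by linarith [hC v x, hC (T N v) x])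
    have hdm : Measurable fun x => q v x - q (T N v) x := (hqv v).sub (hqv _)
    have e : B N v - B N (T N v) = ∫ x in (0 : ℝ)..N, (q v x - q (T N v) x) :=
      (intervalIntegral.integral_sub (hii _ _ _) (hii _ _ _)).symm
    rw [e]
    by_cases h : ∀ j : ℕ, j < K → v j ∉ A
    · have h1 := abs_intervalIntegral_le hd 0 N
      rw [sub_zero, abs_of_pos hN] at h1
      simp only [R, if_pos h]
      have : 0 ≤ 2 * C * ((K : ℝ) + 1) := by positivity
      linarith
    · simp only [R, if_neg h]
      push Not at h
      obtain ⟨j, hj, hjA⟩ := h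
      rw [← intervalIntegral.integral_add_adjacent_intervals
          (intervalIntegrable_of_bound hdm hd 0 j) (intervalIntegrable_of_bound hdm hd j N),
        ← intervalIntegral.integral_add_adjacent_intervals
          (intervalIntegrable_of_bound hdm hd j (N - 1))
          (intervalIntegrable_of_bound hdm hd (N - 1) N)]
      have h2 : ∫ x in (j : ℝ)..(N - 1), (q v x - q (T N v) x) = 0 := by
        rw [← intervalIntegral.integral_zero (a := (j : ℝ)) (b := (N : ℝ) - 1) (μ := volume)]
        refine intervalIntegral.integral_congr_ae ?_
        have hne : ∀ᵐ x ∂(volume : Measure ℝ), x ≠ (N : ℝ) - 1 := by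
          rw [ae_iff]; simp
        filter_upwards [hne] with x hxne hx
        have hjN : (j : ℝ) ≤ N - 1 := by exact_mod_cast (by omega : (j : ℤ) ≤ N - 1)
        rw [uIoc_of_le hjN] at hx
        rw [sub_eq_zero]
        refine hloc v (T N v) j (N - 1) (fun i h1 h2 => ?_) hjA x (by exact_mod_cast hx.1.le) ?_
        · exact (if_pos ⟨by omega, by omega⟩).symm
        · push_cast
          exact lt_of_le_of_ne hx.2 hxne
      have h3 := abs_intervalIntegral_le hd 0 j
      have h4 := abs_intervalIntegral_le hd ((N : ℝ) - 1) N
      have hj' : (j : ℝ) ≤ K := by exact_mod_cast hj.le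
      rw [sub_zero, abs_of_nonneg (show (0 : ℝ) ≤ j from Nat.cast_nonneg j)] at h3
      rw [sub_sub_cancel, abs_one, mul_one] at h4
      rw [h2, zero_add, mul_zero, add_zero]
      refine (abs_add_le _ _).trans ((add_le_add h3 h4).trans ?_)
      nlinarith
  have hmp : ∀ k : ℤ, MeasurePreserving (shift (k * 2)) ν ν := fun k =>
    measurePreserving_shift (periodic_measure hP k)
  have hBint : ∀ N : ℤ, 0 < N → Integrable (B N) ν := fun N hN =>
    Integrable.of_bound (hBm N hN).aestronglyMeasurable (C * N)
      (Eventually.of_forall fun v => hBC N hN v)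
  have hEB : ∀ M : ℕ, 0 < M → ∫ v, B (M * 2) v ∂ν = M * 2 * θ := by
    intro M hM
    have h1 : ∀ v, B (M * 2) v = ∑ k ∈ Finset.range M, B 2 (shift (k * 2) v) := by
      intro v
      simp only [B, hshint]
      have := intervalIntegral.sum_integral_adjacent_intervals (f := q v) (μ := volume)
        (a := fun k : ℕ => ((k : ℝ) * 2)) (n := M) fun k _ => hii v _ _
      simp only [Nat.cast_zero, zero_mul] at this
      push_cast
      rw [← this]
      refine Finset.sum_congr rfl fun k _ => ?_
      congr 1
      · ring
      · push_cast; ring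
    simp only [h1]
    rw [integral_finsetSum (f := fun (k : ℕ) v => B 2 (shift (k * 2) v)) _ fun k _ =>
      (hmp k).integrable_comp_of_integrable (hBint 2 two_pos)]
    have h2 : ∀ k : ℕ, ∫ v, B 2 (shift (k * 2) v) ∂ν = 2 * θ := by
      intro k
      have h3 := integral_map (μ := ν) (hmp k).measurable.aemeasurable
        (hBm 2 two_pos).aestronglyMeasurable
      rw [(hmp k).map_eq] at h3
      rw [← h3, hθ]
      simp only [B]
      push_cast
      ring
    simp only [h2, Finset.sum_const, Finset.card_range, nsmul_eq_mul]
    ring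
  -- The strong law is applied to the truncated integrals and to the frequency of blocks without an
  -- early reset. The truncation error is paid once for each realisation and once in expectation,
  -- whence the factors 4.
  have key : ∀ a : ℕ → ℤ, Function.Injective a → ∀ᵐ v ∂ν, ∀ K M : ℕ, K < M → ∀ᶠ n : ℕ in atTop,
      |(∑ k ∈ Finset.range n, B (M * 2) (shift (a k * (M * 2)) v)) - n * (M * 2 * θ)| ≤
        n * (4 * C * (K + 1) + 4 * C * (M * 2) * (∫ v, R K v ∂ν) + 1) := by
    intro a ha
    rw [ae_all_iff]; intro K
    rw [ae_all_iff]; intro M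
    rw [ae_all_iff]; intro hKM
    set N : ℤ := M * 2 with hNdef
    have hN : 0 < N := by omega
    have hN' : (0 : ℝ) < N := by exact_mod_cast hN
    have hKN : (K : ℤ) < N := by omega
    have hPN : ∀ k i : ℤ, P (i + k * N) = P i := fun k i => by
      rw [hNdef, ← mul_assoc]; exact periodic_measure hP _ _
    have l1 := ae_tendsto_block_average hN hPN (h := fun v => B N (T N v)) ((hBm N hN).comp (hTm N))
      (C := C * N) (fun v => hBC N hN _) (fun v v' h => by
        congr 1
        funext i
        simp only [T]
        split_ifs with hi
        · exact h i hi.1 hi.2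
        · rfl) ha
    have l2 := ae_tendsto_block_average hN hPN (h := R K) (hRm K)
      (C := 1) (fun v => by rw [abs_of_nonneg (hR01 K v).1]; exact (hR01 K v).2) (fun v v' h => by
        simp only [R]
        congr 1
        refine propext (forall_congr' fun j => forall_congr' fun hj => ?_)
        rw [h j (by omega) (by omega)]) ha
    have hE : |(∫ v, B N (T N v) ∂ν) - M * 2 * θ| ≤
        2 * C * (K + 1) + 2 * C * N * ∫ v, R K v ∂ν := by
      have hi1 : Integrable (fun v => B N (T N v)) ν :=
        Integrable.of_bound ((hBm N hN).comp (hTm N)).aestronglyMeasurable (C * N)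
          (Eventually.of_forall fun v => hBC N hN _)
      have hi2 : Integrable (R K) ν := Integrable.of_bound (hRm K).aestronglyMeasurable 1
          (Eventually.of_forall fun v => by
            rw [Real.norm_eq_abs, abs_of_nonneg (hR01 K v).1]; exact (hR01 K v).2)
      rw [← hEB M (by omega), abs_sub_comm, ← integral_sub (hBint N hN) hi1]
      refine (abs_integral_le_integral_abs).trans ((integral_mono ((hBint N hN).sub hi1).abs
        ((integrable_const _).add (hi2.const_mul _)) fun v => hBT N K hKN v).trans ?_)
      rw [integral_add' (integrable_const _) (hi2.const_mul _), integral_const, integral_const_mul]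
      simp
    filter_upwards [l1, l2] with v l1 l2
    have l3 : Tendsto (fun n : ℕ => 2 * C * (K + 1) + 2 * C * N *
        ((∑ k ∈ Finset.range n, R K (shift (a k * N) v)) / n) +
        |(∑ k ∈ Finset.range n, B N (T N (shift (a k * N) v))) / n - M * 2 * θ|) atTop
        (𝓝 (2 * C * (K + 1) + 2 * C * N * (∫ v, R K v ∂ν) +
          |(∫ v, B N (T N v) ∂ν) - M * 2 * θ|)) :=
      (tendsto_const_nhds.add (l2.const_mul _)).add (l1.sub_const _).abs
    have hlt : 2 * C * (K + 1) + 2 * C * N * (∫ v, R K v ∂ν) +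
          |(∫ v, B N (T N v) ∂ν) - M * 2 * θ| <
          4 * C * (K + 1) + 4 * C * (M * 2) * (∫ v, R K v ∂ν) + 1 := by
      have : (N : ℝ) = M * 2 := by rw [hNdef]; push_cast; ring
      rw [this] at hE ⊢
      linarith
    filter_upwards [l3.eventually (gt_mem_nhds hlt), eventually_gt_atTop 0] with n hn hn0
    have hn0' : (0 : ℝ) < n := by exact_mod_cast hn0
    refine le_trans ?_ (mul_le_mul_of_nonneg_left (le_of_lt hn) hn0'.le)
    have s1 : |∑ k ∈ Finset.range n, (B N (shift (a k * N) v) - B N (T N (shift (a k * N) v)))| ≤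
        ∑ k ∈ Finset.range n, (2 * C * (K + 1) + 2 * C * N * R K (shift (a k * N) v)) :=
      (Finset.abs_sum_le_sum_abs _ _).trans (Finset.sum_le_sum fun k _ => hBT N K hKN _)
    rw [Finset.sum_sub_distrib, Finset.sum_add_distrib, Finset.sum_const,
      Finset.card_range, nsmul_eq_mul, ← Finset.mul_sum] at s1
    have s2 : (n : ℝ) * |(∑ k ∈ Finset.range n, B N (T N (shift (a k * N) v))) / n - M * 2 * θ| =
        |(∑ k ∈ Finset.range n, B N (T N (shift (a k * N) v))) - n * (M * 2 * θ)| := by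
      rw [← abs_of_pos hn0', ← abs_mul, abs_of_pos hn0']
      congr 1
      field_simp
    have s3 : (n : ℝ) * (2 * C * N * ((∑ k ∈ Finset.range n, R K (shift (a k * N) v)) / n)) =
        2 * C * N * ∑ k ∈ Finset.range n, R K (shift (a k * N) v) := by field_simp
    rw [mul_add, mul_add, s2, s3]
    have s4 := abs_add_le ((∑ k ∈ Finset.range n, B N (shift (a k * N) v)) -
      ∑ k ∈ Finset.range n, B N (T N (shift (a k * N) v)))
      ((∑ k ∈ Finset.range n, B N (T N (shift (a k * N) v))) - n * (M * 2 * θ))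
    rw [sub_add_sub_cancel] at s4
    linarith
  have k1 := key (fun k => k) fun i j h => by simpa using h
  have k2 := key (fun k => -(k + 1)) fun i j h => by simpa using h
  filter_upwards [k1, k2] with v k1 k2
  refine hasMean_of_blocks (hqv v) (hC v) fun η hη => ?_
  -- Order of choices: K makes blocks without reset among the first K sites rare; then M makes the
  -- boundary cost, of order K, negligible against the block length 2M.
  obtain ⟨K, hK⟩ := (hRlim.eventually (gt_mem_nhds
    (show 0 < η / (4 * (4 * C + 1)) by positivity))).exists
  obtain ⟨M, hM⟩ := exists_nat_gt (max (K : ℝ) ((4 * C * (K + 1) + 1) / η))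
  have hM1 : K < M := by exact_mod_cast (le_max_left _ _).trans_lt hM
  have hM2 : 4 * C * (K + 1) + 1 < M * η := by
    rw [← div_lt_iff₀ hη]; exact (le_max_right _ _).trans_lt hM
  have hM0 : (0 : ℝ) < M := by exact_mod_cast (by omega : 0 < M)
  have hbound : 4 * C * (K + 1) + 4 * C * (M * 2) * (∫ v, R K v ∂ν) + 1 ≤ η * (M * 2) := by
    have h1 : 4 * C * ∫ v, R K v ∂ν ≤ η / 4 := by
      have h2 : (4 * C) * ∫ v, R K v ∂ν ≤ (4 * C + 1) * (η / (4 * (4 * C + 1))) :=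
        mul_le_mul (by linarith) hK.le (integral_nonneg fun v => (hR01 K v).1) (by linarith)
      have h3 : (4 * C + 1) * (η / (4 * (4 * C + 1))) = η / 4 := by field_simp
      linarith
    have h4 := mul_le_mul_of_nonneg_left h1 (show (0 : ℝ) ≤ M * 2 by positivity)
    have h5 : 0 < M * η := by positivity
    linarith
  obtain ⟨n₁, hn₁⟩ := eventually_atTop.1 (k1 K M hM1)
  obtain ⟨n₂, hn₂⟩ := eventually_atTop.1 (k2 K M hM1)
  refine ⟨M * 2, by positivity, max n₁ n₂, fun n hn => ⟨?_, ?_⟩⟩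
  · have h1 := hn₁ n ((le_max_left _ _).trans hn)
    have h2 := intervalIntegral.sum_integral_adjacent_intervals (f := q v) (μ := volume)
      (a := fun k : ℕ => (k : ℝ) * (M * 2)) (n := n) fun k _ => hii v _ _
    have h3 : ∑ k ∈ Finset.range n, B (M * 2) (shift (k * (M * 2)) v) =
        ∫ t in (0 : ℝ)..(n * (M * 2)), q v t := by
      simp only [Nat.cast_zero, zero_mul] at h2
      rw [← h2]
      refine Finset.sum_congr rfl fun k _ => ?_
      simp only [B, hshint]
      congr 1 <;> push_cast <;> ring
    rw [h3] at h1
    calc _ = |(∫ t in (0 : ℝ)..(n * (M * 2)), q v t) - n * (M * 2 * θ)| := by congr 1; ring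
      _ ≤ _ := h1
      _ ≤ n * (η * (M * 2)) := by gcongr
      _ = _ := by ring
  · have h1 := hn₂ n ((le_max_right _ _).trans hn)
    have h2 := intervalIntegral.sum_integral_adjacent_intervals (f := q v) (μ := volume)
      (a := fun k : ℕ => -((k : ℝ) * (M * 2))) (n := n) fun k _ => hii v _ _
    have h3 : ∑ k ∈ Finset.range n, B (M * 2) (shift (-(k + 1) * (M * 2)) v) =
        -∫ t in (0 : ℝ)..(-(n * (M * 2))), q v t := by
      simp only [Nat.cast_zero, zero_mul, neg_zero] at h2
      rw [← h2, ← Finset.sum_neg_distrib]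
      refine Finset.sum_congr rfl fun k _ => ?_
      simp only [B, hshint]
      rw [intervalIntegral.integral_symm]
      congr 2 <;> push_cast <;> ring
    rw [h3] at h1
    calc _ = |-(∫ t in (0 : ℝ)..(-(n * (M * 2))), q v t) - n * (M * 2 * θ)| := by
          rw [← abs_neg]; congr 1; ring
      _ ≤ _ := h1
      _ ≤ n * (η * (M * 2)) := by gcongr
      _ = _ := by ring

end Recurrence

end DoubleWellHJ

/-! ### The interpolated potential and its levels -/

namespace DoubleWellHJ

/-- The piecewise linear interpolation of a sequence. -/
noncomputable def profile (v : ℤ → unitInterval) (x : ℝ) : ℝ :=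
  (1 - Int.fract x) * (v ⌊x⌋ : ℝ) + Int.fract x * (v (⌊x⌋ + 1) : ℝ)

lemma profile_shift (n : ℤ) (v : ℤ → unitInterval) (x : ℝ) :
    profile (shift n v) x = profile v (x + n) := by
  simp only [profile, shift, Int.fract_add_intCast, Int.floor_add_intCast]
  rw [add_right_comm]

lemma profile_intCast (v : ℤ → unitInterval) (i : ℤ) : profile v i = v i := by
  simp [profile]

lemma profile_eq (v : ℤ → unitInterval) {i : ℤ} {x : ℝ} (hx : x ∈ Icc (i : ℝ) (i + 1)) :
    profile v x = v i + (x - i) * (v (i + 1) - v i) := by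
  rcases hx.2.eq_or_lt with h | h
  · rw [h, show ((i : ℝ) + 1) = ((i + 1 : ℤ) : ℝ) by push_cast; ring, profile_intCast]
    push_cast; ring
  · have : ⌊x⌋ = i := Int.floor_eq_iff.2 ⟨hx.1, h⟩
    rw [profile, Int.fract, this]
    ring

lemma profile_mem (v : ℤ → unitInterval) (x : ℝ) : profile v x ∈ Icc (0 : ℝ) 1 := by
  have h1 := Int.fract_nonneg x
  have h2 := (Int.fract_lt_one x).le
  have h3 := (v ⌊x⌋).2
  have h4 := (v (⌊x⌋ + 1)).2
  rw [mem_Icc] at h3 h4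
  rw [profile, mem_Icc]
  constructor <;> nlinarith

lemma continuous_profile (v : ℤ → unitInterval) : Continuous (profile v) := by
  have key : ∀ (i : ℤ), ContinuousOn (profile v) (Icc (i : ℝ) (i + 1)) := fun i =>
    ContinuousOn.congr (f := fun x : ℝ => (v i : ℝ) + (x - i) * (v (i + 1) - v i)) (by fun_prop)
      fun x hx => profile_eq v hx
  rw [continuous_iff_continuousAt]
  intro y
  rw [continuousAt_iff_continuous_left_right]
  constructor
  · have h1 : ((⌈y⌉ - 1 : ℤ) : ℝ) < y := by
      push_cast; linarith [Int.ceil_lt_add_one y]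
    have h2 : y ≤ ((⌈y⌉ - 1 : ℤ) : ℝ) + 1 := by push_cast; linarith [Int.le_ceil y]
    refine (key (⌈y⌉ - 1) y ⟨h1.le, h2⟩).mono_of_mem_nhdsWithin ?_
    filter_upwards [self_mem_nhdsWithin, nhdsWithin_le_nhds (lt_mem_nhds h1)] with x hx hx'
    exact ⟨le_of_lt hx', (mem_Iic.1 hx).trans h2⟩
  · have h1 := Int.floor_le y
    have h2 := Int.lt_floor_add_one y
    refine (key ⌊y⌋ y ⟨h1, h2.le⟩).mono_of_mem_nhdsWithin ?_
    filter_upwards [self_mem_nhdsWithin, nhdsWithin_le_nhds (gt_mem_nhds h2)] with x hx hx'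
    exact ⟨h1.trans (mem_Ici.1 hx), le_of_lt hx'⟩

lemma measurable_profile : Measurable (Function.uncurry profile) := by
  have he : Measurable fun p : (ℤ → unitInterval) × ℤ => (p.1 p.2 : ℝ) :=
    measurable_from_prod_countable_left fun i =>
      (measurable_pi_apply i).subtype_val
  have h1 : Measurable fun p : (ℤ → unitInterval) × ℝ => (p.1 ⌊p.2⌋ : ℝ) :=
    he.comp (measurable_fst.prodMk (Int.measurable_floor.comp measurable_snd))
  have h2 : Measurable fun p : (ℤ → unitInterval) × ℝ => (p.1 (⌊p.2⌋ + 1) : ℝ) :=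
    he.comp (measurable_fst.prodMk ((measurable_from_top (f := fun i : ℤ => i + 1)).comp
      (Int.measurable_floor.comp measurable_snd)))
  have h3 : Measurable fun p : (ℤ → unitInterval) × ℝ => Int.fract p.2 :=
    measurable_fract.comp measurable_snd
  exact ((measurable_const.sub h3).mul h1).add (h3.mul h2)

/-- The inequality x < k is strict because the value at x also reads the site ⌊x⌋ + 1 ≤ k. -/
lemma profile_congr {v v' : ℤ → unitInterval} {j k : ℤ} (h : ∀ i, j ≤ i → i ≤ k → v i = v' i)
    {x : ℝ} (hj : (j : ℝ) ≤ x) (hk : x < k) : profile v x = profile v' x := by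
  have h1 : j ≤ ⌊x⌋ := Int.le_floor.2 hj
  have h2 : ⌊x⌋ < k := Int.floor_lt.2 hk
  rw [profile, profile, h _ h1 (by omega), h _ (by omega) (by omega)]

/-- The level `λ - β V` at which the momentum has to sit. -/
noncomputable def level (β lam : ℝ) (v : ℤ → unitInterval) (x : ℝ) : ℝ := lam - β * profile v x

section Level

variable {β lam m M : ℝ} {v : ℤ → unitInterval}

lemma level_intCast (i : ℤ) : level β lam v i = lam - β * v i := by
  rw [level, profile_intCast]

lemma level_shift (n : ℤ) (x : ℝ) :
    level β lam (shift n v) x = level β lam v (x + n) := by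
  rw [level, profile_shift, level]

lemma continuous_level : Continuous (level β lam v) :=
  continuous_const.sub (continuous_const.mul (continuous_profile v))

lemma measurable_level (β lam : ℝ) : Measurable (Function.uncurry (level β lam)) :=
  measurable_const.sub (measurable_const.mul measurable_profile)

lemma level_mem (hβ : 0 < β) (x : ℝ) : level β lam v x ∈ Icc (lam - β) lam := by
  have h := profile_mem v x
  rw [level]
  constructor <;> nlinarith [h.1, h.2]

lemma level_monotoneOn_or_antitoneOn (hβ : 0 < β) (i : ℤ) :
    MonotoneOn (level β lam v) (Icc (i : ℝ) (i + 1)) ∨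
      AntitoneOn (level β lam v) (Icc (i : ℝ) (i + 1)) := by
  rcases le_total (v i : ℝ) (v (i + 1)) with h | h
  · right
    intro x hx y hy hxy
    rw [level, level, profile_eq v hx, profile_eq v hy]
    have := mul_nonneg (sub_nonneg.2 hxy) (sub_nonneg.2 h)
    nlinarith
  · left
    intro x hx y hy hxy
    rw [level, level, profile_eq v hx, profile_eq v hy]
    have := mul_nonneg (sub_nonneg.2 hxy) (sub_nonneg.2 h)
    nlinarith

lemma inLeftWell_level_iff (hβ : 0 < β) (hmM : m < M) {i : ℤ} {x : ℝ}
    (hx : x ∈ Icc (i : ℝ) (i + 1)) :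
    InLeftWell m M (level β lam v) x ↔
      m < level β lam v x ∧ (M ≤ level β lam v x ∨ InLeftWell m M (level β lam v) i) := by
  refine inLeftWell_iff_of_monotoneOn hmM hx.1 ?_
  have hsub : Icc (i : ℝ) x ⊆ Icc (i : ℝ) (i + 1) := Icc_subset_Icc_right hx.2
  exact (level_monotoneOn_or_antitoneOn hβ i).imp (fun h => h.mono hsub) fun h => h.mono hsub

/-- The level is monotone between consecutive sites, so its extrema on an interval with integer ends
are attained at sites. The state at a site thus depends on countably many coordinates through
countable unions and intersections, which is what makes it measurable. -/
lemma inLeftWell_level_intCast_iff (hβ : 0 < β) (hmM : m < M) (i : ℤ) :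
    InLeftWell m M (level β lam v) i ↔
      ∃ j ≤ i, M ≤ lam - β * v j ∧ ∀ k, j ≤ k → k ≤ i → m < lam - β * v k := by
  constructor
  · rintro ⟨y, hy, hyM, hym⟩
    have hy' : y ∈ Icc ((⌊y⌋ : ℤ) : ℝ) (⌊y⌋ + 1) := ⟨Int.floor_le y, (Int.lt_floor_add_one y).le⟩
    have hm : ∀ k : ℤ, ⌊y⌋ + 1 ≤ k → k ≤ i → m < lam - β * v k := by
      intro k h1 h2
      have := hym k ⟨hy'.2.trans (by exact_mod_cast h1), by exact_mod_cast h2⟩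
      rwa [level_intCast] at this
    have hyi : ⌊y⌋ ≤ i := by
      have := (Int.floor_le y).trans hy
      exact_mod_cast this
    have hleft : M ≤ level β lam v ⌊y⌋ → ∃ j ≤ i, M ≤ lam - β * v j ∧
        ∀ k, j ≤ k → k ≤ i → m < lam - β * v k := by
      intro h
      rw [level_intCast] at h
      refine ⟨⌊y⌋, hyi, h, fun k h1 h2 => ?_⟩
      rcases h1.eq_or_lt with h3 | h3
      · rw [← h3]; linarith
      · exact hm k (by omega) h2
    rcases hyi.eq_or_lt with he | hlt
    · refine hleft ?_
      rw [he] at hy' ⊢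
      rwa [← le_antisymm hy hy'.1]
    · rcases level_monotoneOn_or_antitoneOn (lam := lam) (v := v) hβ ⌊y⌋ with h | h
      · refine ⟨⌊y⌋ + 1, by omega, ?_, fun k h1 h2 => hm k h1 h2⟩
        have := h hy' ⟨hy'.1.trans hy'.2, le_rfl⟩ hy'.2
        rw [show ((⌊y⌋ : ℝ) + 1) = ((⌊y⌋ + 1 : ℤ) : ℝ) by push_cast; ring, level_intCast] at this
        exact hyM.trans this
      · exact hleft (hyM.trans (h ⟨le_rfl, hy'.1.trans hy'.2⟩ hy' hy'.1))
  · rintro ⟨j, hj, hjM, hjm⟩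
    refine ⟨j, by exact_mod_cast hj, by rwa [level_intCast], fun z hz => ?_⟩
    have hz' : z ∈ Icc ((⌊z⌋ : ℤ) : ℝ) (⌊z⌋ + 1) := ⟨Int.floor_le z, (Int.lt_floor_add_one z).le⟩
    have h1 : j ≤ ⌊z⌋ := Int.le_floor.2 hz.1
    have h2 : ⌊z⌋ ≤ i := by
      have := (Int.floor_le z).trans hz.2
      exact_mod_cast this
    have h3 := hjm _ h1 h2
    rcases h2.eq_or_lt with he | hlt
    · have : z = i := le_antisymm hz.2 (by rw [← he]; exact hz'.1)
      rw [this, level_intCast, ← he]; exact h3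
    · have h4 := hjm (⌊z⌋ + 1) (by omega) (by omega)
      rcases level_monotoneOn_or_antitoneOn (lam := lam) (v := v) hβ ⌊z⌋ with h | h
      · have := h ⟨le_rfl, hz'.1.trans hz'.2⟩ hz' hz'.1
        rw [level_intCast] at this
        exact h3.trans_le this
      · have := h hz' ⟨hz'.1.trans hz'.2, le_rfl⟩ hz'.2
        rw [show ((⌊z⌋ : ℝ) + 1) = ((⌊z⌋ + 1 : ℤ) : ℝ) by push_cast; ring, level_intCast] at this
        exact h4.trans_le this

lemma measurableSet_inLeftWell (hβ : 0 < β) (hmM : m < M) :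
    MeasurableSet {p : (ℤ → unitInterval) × ℝ | InLeftWell m M (level β lam p.1) p.2} := by
  have hv : ∀ i : ℤ, Measurable fun v : ℤ → unitInterval => lam - β * (v i : ℝ) := fun i =>
    measurable_const.sub (measurable_const.mul (measurable_pi_apply i).subtype_val)
  have h1 : ∀ i : ℤ, MeasurableSet {v : ℤ → unitInterval | InLeftWell m M (level β lam v) i} := by
    intro i
    have he : {v : ℤ → unitInterval | InLeftWell m M (level β lam v) i} =
        ⋃ j ∈ Iic i, {v | M ≤ lam - β * (v j : ℝ)} ∩
          ⋂ k ∈ Icc j i, {v | m < lam - β * (v k : ℝ)} := by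
      ext v
      simpa [inLeftWell_level_intCast_iff hβ hmM] using exists_congr fun j => and_left_comm
    rw [he]
    exact MeasurableSet.biUnion (to_countable _) fun j _ =>
      (measurableSet_le measurable_const (hv j)).inter
        (MeasurableSet.biInter (to_countable _) fun k _ => measurableSet_lt measurable_const (hv k))
  have h2 : MeasurableSet {p : (ℤ → unitInterval) × ℤ |
      InLeftWell m M (level β lam p.1) p.2} := by
    have : Measurable fun p : (ℤ → unitInterval) × ℤ => InLeftWell m M (level β lam p.1) p.2 :=
      measurable_from_prod_countable_left fun i => measurable_mem.2 (h1 i)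
    exact measurableSet_setOfPred.2 this
  have h3 : MeasurableSet {p : (ℤ → unitInterval) × ℝ |
      InLeftWell m M (level β lam p.1) ⌊p.2⌋} :=
    (measurable_fst.prodMk (Int.measurable_floor.comp measurable_snd)) h2
  have h4 : {p : (ℤ → unitInterval) × ℝ | InLeftWell m M (level β lam p.1) p.2} =
      {p | m < level β lam p.1 p.2} ∩ ({p | M ≤ level β lam p.1 p.2} ∪
        {p : (ℤ → unitInterval) × ℝ | InLeftWell m M (level β lam p.1) ⌊p.2⌋}) := by
    ext p
    exact inLeftWell_level_iff hβ hmM ⟨Int.floor_le _, (Int.lt_floor_add_one _).le⟩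
  rw [h4]
  exact (measurableSet_lt measurable_const (measurable_level β lam)).inter
    ((measurableSet_le measurable_const (measurable_level β lam)).union h3)

/-- A site with level at least M can itself serve as the entry point, and a site with level at most
m forces the entry to lie to its right. In both cases the past of the site is irrelevant. -/
lemma InLeftWell.congr_of_reset {v' : ℤ → unitInterval} {j k : ℤ}
    (h : ∀ i, j ≤ i → i ≤ k → v i = v' i)
    (hj : M ≤ lam - β * v j ∨ lam - β * v j ≤ m) {x : ℝ} (hjx : (j : ℝ) ≤ x) (hk : x < k)
    (hx : InLeftWell m M (level β lam v) x) : InLeftWell m M (level β lam v') x := by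
  obtain ⟨y, hy, hyM, hym⟩ := hx
  have key : ∀ z, (j : ℝ) ≤ z → z ≤ x → level β lam v z = level β lam v' z := fun z h1 h2 => by
    rw [level, level, profile_congr h h1 (h2.trans_lt hk)]
  have hw : ∀ y', (j : ℝ) ≤ y' → y' ≤ x → y ≤ y' → M ≤ level β lam v y' →
      InLeftWell m M (level β lam v') x := fun y' h1 h2 h3 h4 =>
    ⟨y', h2, by rwa [← key y' h1 h2], fun z hz => by
      rw [← key z (h1.trans hz.1) hz.2]; exact hym z ⟨h3.trans hz.1, hz.2⟩⟩
  rcases le_total (j : ℝ) y with h1 | h1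
  · exact hw y h1 hy le_rfl hyM
  · rcases hj with hj | hj
    · exact hw j le_rfl hjx h1 (by rwa [level_intCast])
    · have := hym j ⟨h1, hjx⟩
      rw [level_intCast] at this
      linarith

lemma inLeftWell_shift (n : ℤ) (x : ℝ) :
    InLeftWell m M (level β lam (shift n v)) x ↔ InLeftWell m M (level β lam v) (x + n) := by
  constructor
  · rintro ⟨y, hy, hyM, hym⟩
    refine ⟨y + n, by linarith, by rwa [← level_shift], fun z hz => ?_⟩
    have := hym (z - n) ⟨by linarith [hz.1], by linarith [hz.2]⟩
    rwa [level_shift, sub_add_cancel] at this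
  · rintro ⟨y, hy, hyM, hym⟩
    refine ⟨y - n, by linarith, by rwa [level_shift, sub_add_cancel], fun z hz => ?_⟩
    rw [level_shift]
    exact hym (z + n) ⟨by linarith [hz.1], by linarith [hz.2]⟩

end Level

end DoubleWellHJ

/-! ### Mean values over a period and the alternating law -/

namespace DoubleWellHJ

/-- The mean over a period of two sites of a random function. -/
noncomputable def windowMean (ν : Measure (ℤ → unitInterval)) (q : (ℤ → unitInterval) → ℝ → ℝ) : ℝ :=
  (∫ v, (∫ x in (0 : ℝ)..2, q v x) ∂ν) / 2

section WindowMean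

variable {ν : Measure (ℤ → unitInterval)} [IsProbabilityMeasure ν]
  {q q₁ q₂ : (ℤ → unitInterval) → ℝ → ℝ} {C : ℝ}

lemma measurable_section (hq : Measurable (Function.uncurry q)) (v : ℤ → unitInterval) :
    Measurable (q v) := hq.comp measurable_prodMk_left

lemma integrable_windowIntegral (hq : Measurable (Function.uncurry q)) (hC : ∀ v x, |q v x| ≤ C) :
    Integrable (fun v => ∫ x in (0 : ℝ)..2, q v x) ν := by
  refine Integrable.of_bound (measurable_intervalIntegral hq two_pos.le).aestronglyMeasurable
    (C * 2) (Eventually.of_forall fun v => ?_)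
  have := abs_intervalIntegral_le (hC v) 0 2
  rwa [sub_zero, abs_two] at this

/-- Quantitative monotonicity of the mean. -/
lemma windowMean_add_le (hq₁ : Measurable (Function.uncurry q₁))
    (hq₂ : Measurable (Function.uncurry q₂)) (hC₁ : ∀ v x, |q₁ v x| ≤ C) (hC₂ : ∀ v x, |q₂ v x| ≤ C)
    (hle : ∀ v x, q₁ v x ≤ q₂ v x) {E : Set (ℤ → unitInterval)} {a b κ : ℝ} (ha : 0 ≤ a) (hab : a ≤ b)
    (hb : b ≤ 2) (hκ : 0 ≤ κ) (hE : ∀ v ∈ E, ∀ x ∈ Ioo a b, q₁ v x + κ ≤ q₂ v x) :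
    windowMean ν q₁ + κ * (b - a) * ν.real E / 2 ≤ windowMean ν q₂ := by
  have hi : ∀ v a b, IntervalIntegrable (fun x => q₂ v x - q₁ v x) volume a b := fun v a b =>
    (intervalIntegrable_of_bound (measurable_section hq₂ v) (hC₂ v) a b).sub
      (intervalIntegrable_of_bound (measurable_section hq₁ v) (hC₁ v) a b)
  have h1 : ∀ v, (∫ x in (0 : ℝ)..2, q₂ v x) - (∫ x in (0 : ℝ)..2, q₁ v x) =
      ∫ x in (0 : ℝ)..2, (q₂ v x - q₁ v x) := fun v =>
    (intervalIntegral.integral_sub (intervalIntegrable_of_bound (measurable_section hq₂ v) (hC₂ v) 0 2)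
      (intervalIntegrable_of_bound (measurable_section hq₁ v) (hC₁ v) 0 2)).symm
  have h2 : windowMean ν q₂ - windowMean ν q₁ =
      (∫ v, (∫ x in (0 : ℝ)..2, (q₂ v x - q₁ v x)) ∂ν) / 2 := by
    rw [windowMean, windowMean, ← sub_div, ← integral_sub (integrable_windowIntegral hq₂ hC₂)
      (integrable_windowIntegral hq₁ hC₁)]
    simp only [h1]
  have hpos : ∀ v a b, a ≤ b → 0 ≤ ∫ x in a..b, (q₂ v x - q₁ v x) := fun v a b hab =>
    intervalIntegral.integral_nonneg hab fun x _ => sub_nonneg.2 (hle v x)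
  have hsub : E ⊆ {v | κ * (b - a) ≤ ∫ x in (0 : ℝ)..2, (q₂ v x - q₁ v x)} := by
    intro v hv
    rw [mem_ofPred_eq, ← intervalIntegral.integral_add_adjacent_intervals (hi v 0 a) (hi v a 2),
      ← intervalIntegral.integral_add_adjacent_intervals (hi v a b) (hi v b 2)]
    have h3 := hpos v 0 a ha
    have h4 := hpos v b 2 hb
    have h5 : κ * (b - a) ≤ ∫ x in a..b, (q₂ v x - q₁ v x) := by
      have h6 : ∫ _ in a..b, κ = κ * (b - a) := by
        rw [intervalIntegral.integral_const, smul_eq_mul, mul_comm]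
      rw [← h6]
      refine intervalIntegral.integral_mono_on_of_le_Ioo hab intervalIntegrable_const (hi v a b)
        fun x hx => ?_
      linarith [hE v hv x hx]
    linarith
  -- Markov's inequality converts the pointwise gain on `E` into a gain of the mean.
  have h3 := mul_meas_ge_le_integral_of_nonneg (μ := ν)
    (Eventually.of_forall fun v => hpos v 0 2 two_pos.le)
    (by
      simp only [← h1]
      exact (integrable_windowIntegral hq₂ hC₂).sub (integrable_windowIntegral hq₁ hC₁))
    (κ * (b - a))
  have h4 := mul_le_mul_of_nonneg_left (measureReal_mono (μ := ν) hsub)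
    (mul_nonneg hκ (sub_nonneg.2 hab))
  linarith

lemma windowMean_const (c : ℝ) : windowMean ν (fun _ _ => c) = c := by
  simp [windowMean]

lemma windowMean_mono (hq₁ : Measurable (Function.uncurry q₁))
    (hq₂ : Measurable (Function.uncurry q₂)) (hC₁ : ∀ v x, |q₁ v x| ≤ C) (hC₂ : ∀ v x, |q₂ v x| ≤ C)
    (hle : ∀ v x, q₁ v x ≤ q₂ v x) : windowMean ν q₁ ≤ windowMean ν q₂ := by
  have := windowMean_add_le (ν := ν) hq₁ hq₂ hC₁ hC₂ hle (E := ∅) (κ := 0) le_rfl le_rfl two_pos.le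
    le_rfl (by simp)
  simpa using this

lemma windowMean_le (hq : Measurable (Function.uncurry q)) (hC : ∀ v x, |q v x| ≤ C) {c : ℝ}
    (h : ∀ v x, q v x ≤ c) : windowMean ν q ≤ c := by
  rw [← windowMean_const (ν := ν) c]
  exact windowMean_mono (C := max C |c|) hq measurable_const
    (fun v x => (hC v x).trans (le_max_left _ _)) (fun v x => le_max_right _ _) h

lemma le_windowMean (hq : Measurable (Function.uncurry q)) (hC : ∀ v x, |q v x| ≤ C) {c : ℝ}
    (h : ∀ v x, c ≤ q v x) : c ≤ windowMean ν q := by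
  rw [← windowMean_const (ν := ν) c]
  exact windowMean_mono (C := max C |c|) measurable_const hq
    (fun v x => le_max_right _ _) (fun v x => (hC v x).trans (le_max_left _ _)) h

lemma tendsto_windowMean {ι : Type*} {l : Filter ι} [l.IsCountablyGenerated]
    {F : ι → (ℤ → unitInterval) → ℝ → ℝ} (hF : ∀ᶠ n in l, Measurable (Function.uncurry (F n)))
    (hC : ∀ᶠ n in l, ∀ v x, |F n v x| ≤ C)
    (h : ∀ᵐ v ∂ν, ∀ᵐ x, Tendsto (fun n => F n v x) l (𝓝 (q v x))) :
    Tendsto (fun n => windowMean ν (F n)) l (𝓝 (windowMean ν q)) := by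
  refine Tendsto.div_const ?_ 2
  refine tendsto_integral_filter_of_dominated_convergence (fun _ => C * 2) ?_ ?_
    (integrable_const _) ?_
  · filter_upwards [hF] with n hn
    exact (measurable_intervalIntegral hn two_pos.le).aestronglyMeasurable
  · filter_upwards [hC] with n hn
    refine Eventually.of_forall fun v => ?_
    have := abs_intervalIntegral_le (hn v) 0 2
    rwa [sub_zero, abs_two] at this
  · filter_upwards [h] with v hv
    refine intervalIntegral.tendsto_integral_filter_of_dominated_convergence (fun _ => C) ?_ ?_
      intervalIntegrable_const ?_
    · filter_upwards [hF] with n hn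
      exact (measurable_section hn v).aestronglyMeasurable
    · filter_upwards [hC] with n hn
      exact Eventually.of_forall fun x _ => hn v x
    · filter_upwards [hv] with x hx _ using hx

end WindowMean

section AlternatingLaw

variable (μ₁ μ₂ : ProbabilityMeasure unitInterval)

/-- The one-site marginals of the alternating law. -/
noncomputable def siteLaw (i : ℤ) : Measure unitInterval :=
  ((if Even i then μ₁ else μ₂ : ProbabilityMeasure unitInterval) : Measure unitInterval)

instance (i : ℤ) : IsProbabilityMeasure (siteLaw μ₁ μ₂ i) := by
  unfold siteLaw; infer_instance

lemma alternatingLaw_eq : alternatingLaw μ₁ μ₂ = Measure.infinitePi (siteLaw μ₁ μ₂) := rfl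

instance : IsProbabilityMeasure (alternatingLaw μ₁ μ₂) := by
  rw [alternatingLaw_eq]; infer_instance

lemma siteLaw_even {i : ℤ} (hi : Even i) : siteLaw μ₁ μ₂ i = μ₁ := by rw [siteLaw, if_pos hi]

lemma siteLaw_odd {i : ℤ} (hi : ¬Even i) : siteLaw μ₁ μ₂ i = μ₂ := by rw [siteLaw, if_neg hi]

lemma siteLaw_add_two (i : ℤ) : siteLaw μ₁ μ₂ (i + 2) = siteLaw μ₁ μ₂ i := by
  simp only [siteLaw, Int.even_add, even_two, iff_true]

lemma ae_forall_site {Q : ℤ → unitInterval → Prop}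
    (h : ∀ i, ∀ᵐ a ∂siteLaw μ₁ μ₂ i, Q i a) : ∀ᵐ v ∂alternatingLaw μ₁ μ₂, ∀ i, Q i (v i) := by
  rw [ae_all_iff]
  intro i
  exact (measurePreserving_eval_infinitePi (siteLaw μ₁ μ₂) i).quasiMeasurePreserving.ae (h i)

lemma alternatingLaw_three_sites {i j k : ℤ} (hij : i ≠ j) (hik : i ≠ k) (hjk : j ≠ k)
    {A B D : Set unitInterval} (hA : MeasurableSet A) (hB : MeasurableSet B)
    (hD : MeasurableSet D) (hA0 : siteLaw μ₁ μ₂ i A ≠ 0) (hB0 : siteLaw μ₁ μ₂ j B ≠ 0)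
    (hD0 : siteLaw μ₁ μ₂ k D ≠ 0) :
    0 < (alternatingLaw μ₁ μ₂).real {v | v i ∈ A ∧ v j ∈ B ∧ v k ∈ D} := by
  classical
  have hS : {v : ℤ → unitInterval | v i ∈ A ∧ v j ∈ B ∧ v k ∈ D} =
      Set.pi (({i, j, k} : Finset ℤ) : Set ℤ) fun l => if l = i then A else if l = j then B else D := by
    ext v
    simp [hij.symm, hik.symm, hjk.symm]
  have hm : ∀ l ∈ ({i, j, k} : Finset ℤ),
      MeasurableSet (if l = i then A else if l = j then B else D) := by
    intro l _
    split_ifs <;> assumption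
  rw [measureReal_def, ENNReal.toReal_pos_iff]
  refine ⟨pos_iff_ne_zero.2 ?_, measure_lt_top _ _⟩
  rw [hS, alternatingLaw_eq, Measure.infinitePi_pi _ hm, Finset.prod_ne_zero_iff]
  intro l hl
  simp only [Finset.mem_insert, Finset.mem_singleton] at hl
  rcases hl with rfl | rfl | rfl
  · simpa using hA0
  · simpa [hij.symm] using hB0
  · simpa [hik.symm, hjk.symm] using hD0

end AlternatingLaw

end DoubleWellHJ

/-! ### Almost sure means and switching points -/

namespace DoubleWellHJ

lemma StrictMono.exists_gap {g : ℝ → ℝ} (hg : StrictMono g) (hc : Continuous g) (a b : ℝ) {d : ℝ}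
    (hd : 0 < d) : ∃ κ > 0, ∀ s ∈ Icc a b, g s + κ ≤ g (s + d) := by
  rcases (Icc a b).eq_empty_or_nonempty with he | hne
  · exact ⟨1, one_pos, by simp [he]⟩
  · obtain ⟨s, -, hs⟩ := isCompact_Icc.exists_isMinOn hne
      (f := fun s => g (s + d) - g s) (by fun_prop)
    refine ⟨g (s + d) - g s, sub_pos.2 (hg (by linarith)), fun t ht => ?_⟩
    have := hs ht
    simp only [mem_ofPred_eq] at this
    linarith

lemma IsBranches.exists_bound {G : ℝ → ℝ} {m M pm pM : ℝ} {g₁ g₃ g₄ : ℝ → ℝ}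
    (hg : IsBranches G m M pm pM g₁ g₃ g₄) (a b : ℝ) :
    ∃ C ≥ 0, ∀ s ∈ Icc a b, |g₁ s| ≤ C ∧ |g₃ s| ≤ C ∧ |g₄ s| ≤ C := by
  have key : ∀ g : ℝ → ℝ, Continuous g → ∃ C, ∀ s ∈ Icc a b, |g s| ≤ C := fun g hgc => by
    obtain ⟨C, hC⟩ := isCompact_Icc.exists_bound_of_continuousOn (hgc.continuousOn (s := Icc a b))
    exact ⟨C, fun s hs => by simpa using hC s hs⟩
  obtain ⟨C₁, h₁⟩ := key g₁ hg.cont₁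
  obtain ⟨C₃, h₃⟩ := key g₃ hg.cont₃
  obtain ⟨C₄, h₄⟩ := key g₄ hg.cont₄
  exact ⟨max 0 (max C₁ (max C₃ C₄)), le_max_left _ _, fun s hs =>
    ⟨(h₁ s hs).trans (by simp), (h₃ s hs).trans (by simp), (h₄ s hs).trans (by simp)⟩⟩

section Slopes

variable {G : ℝ → ℝ} {m M pm pM β lam : ℝ} {g₁ g₃ g₄ : ℝ → ℝ} {μ₁ μ₂ : ProbabilityMeasure unitInterval}

lemma measurable_wellSlope_level (hg : IsBranches G m M pm pM g₁ g₃ g₄) (hβ : 0 < β) (hmM : m < M) :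
    Measurable (Function.uncurry fun v => wellSlope g₁ g₃ m M (level β lam v)) :=
  Measurable.ite (measurableSet_inLeftWell hβ hmM)
    (hg.cont₁.measurable.comp (measurable_level β lam))
    (hg.cont₃.measurable.comp (measurable_level β lam))

lemma measurable_high_level (hg : IsBranches G m M pm pM g₁ g₃ g₄) :
    Measurable (Function.uncurry fun v x => g₄ (level β lam v x)) :=
  hg.cont₄.measurable.comp (measurable_level β lam)

lemma abs_wellSlope_le {s : ℝ → ℝ} {C x : ℝ} (h₁ : |g₁ (s x)| ≤ C) (h₃ : |g₃ (s x)| ≤ C) :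
    |wellSlope g₁ g₃ m M s x| ≤ C := by
  rw [wellSlope]
  split_ifs <;> assumption

lemma wellSlope_congr {s s' : ℝ → ℝ} {x x' : ℝ} (h : InLeftWell m M s x ↔ InLeftWell m M s' x')
    (he : s x = s' x') : wellSlope g₁ g₃ m M s x = wellSlope g₁ g₃ m M s' x' := by
  classical
  rw [wellSlope, wellSlope, he]
  exact if_congr h rfl rfl

lemma measure_level_pos_of_lt_m (hone : (1 : unitInterval) ∈ (μ₂ : Measure unitInterval).support)
    (h : lam < m + β) : (μ₂ : Measure unitInterval) {a | lam - β * a < m} ≠ 0 := by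
  refine ((Measure.mem_support_iff_forall _).1 hone _ ?_).ne'
  refine (isOpen_lt (by fun_prop) continuous_const).mem_nhds ?_
  simp only [mem_ofPred_eq, Icc.coe_one]
  linarith

lemma measure_level_pos_of_M_lt (hzero : (0 : unitInterval) ∈ (μ₁ : Measure unitInterval).support)
    (h : M < lam) : (μ₁ : Measure unitInterval) {a | M < lam - β * a} ≠ 0 := by
  refine ((Measure.mem_support_iff_forall _).1 hzero _ ?_).ne'
  refine (isOpen_lt continuous_const (by fun_prop)).mem_nhds ?_
  simp only [mem_ofPred_eq, Icc.coe_zero]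
  linarith

/-- For λ < m + β odd sites with values close to 1 have level below m; for λ ≥ m + β > M even sites
with values close to 0 have level above M. The strict inequalities make these resets stable under
small changes of λ. -/
lemma exists_siteLaw_reset_pos {c : ℝ} (hsup : SeparatedSupports c μ₁ μ₂) (hM : M < m + β) (lam : ℝ) :
    ∃ r, siteLaw μ₁ μ₂ r {a | M < lam - β * a ∨ lam - β * a < m} ≠ 0 := by
  rcases lt_or_ge lam (m + β) with h | h
  · refine ⟨1, ?_⟩
    rw [siteLaw_odd _ _ (by decide)]
    exact fun h0 => measure_level_pos_of_lt_m hsup.one_mem h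
      (measure_mono_null (fun a ha => Or.inr ha) h0)
  · refine ⟨0, ?_⟩
    rw [siteLaw_even _ _ (by decide)]
    exact fun h0 => measure_level_pos_of_M_lt hsup.zero_mem (hM.trans_le h)
      (measure_mono_null (fun a ha => Or.inl ha) h0)

lemma measurableSet_reset : MeasurableSet {a : unitInterval | M < lam - β * a ∨ lam - β * a < m} := by
  have he : {a : unitInterval | M < lam - β * a ∨ lam - β * a < m} =
      {a : unitInterval | M < lam - β * a} ∪ {a : unitInterval | lam - β * a < m} := by
    ext a; simp
  rw [he]
  exact (measurableSet_lt measurable_const (by fun_prop)).union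
    (measurableSet_lt (by fun_prop) measurable_const)

/-- The hysteresis slope depends on the whole past, but only back to the last reset site, and these
recur; this is the locality required by `ae_hasMean`. -/
lemma ae_hasMean_wellSlope (hg : IsBranches G m M pm pM g₁ g₃ g₄) (hβ : 0 < β) (hmM : m < M)
    {c : ℝ} (hsup : SeparatedSupports c μ₁ μ₂) (hM : M < m + β) (lam : ℝ) :
    ∀ᵐ v ∂alternatingLaw μ₁ μ₂, HasMean (wellSlope g₁ g₃ m M (level β lam v))
      (windowMean (alternatingLaw μ₁ μ₂) fun v => wellSlope g₁ g₃ m M (level β lam v)) := by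
  obtain ⟨C, -, hC⟩ := hg.exists_bound (lam - β) lam
  obtain ⟨r, hr⟩ := exists_siteLaw_reset_pos hsup hM lam
  refine ae_hasMean (siteLaw_add_two μ₁ μ₂) (q := fun v => wellSlope g₁ g₃ m M (level β lam v))
    (measurable_wellSlope_level hg hβ hmM) (C := C) (fun v x => ?_) (fun n v x => ?_) measurableSet_reset (fun v v' j k h hj x hjx hxk => ?_)
    hr
  · have := hC _ (level_mem (v := v) hβ x)
    exact abs_wellSlope_le this.1 this.2.1
  · exact wellSlope_congr (inLeftWell_shift n x) (level_shift n x)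
  · have hj' : M ≤ lam - β * v j ∨ lam - β * v j ≤ m := hj.imp (fun h => le_of_lt h) fun h => le_of_lt h
    have hk : j ≤ k := by
      have := hjx.trans hxk.le
      exact_mod_cast this
    have e1 : InLeftWell m M (level β lam v) x ↔ InLeftWell m M (level β lam v') x :=
      ⟨fun hx => hx.congr_of_reset h hj' hjx hxk, fun hx => hx.congr_of_reset
        (fun i h1 h2 => (h i h1 h2).symm) (by rwa [← h j le_rfl hk]) hjx hxk⟩
    have e2 : level β lam v x = level β lam v' x := by rw [level, level, profile_congr h hjx hxk]
    exact wellSlope_congr e1 e2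

lemma ae_hasMean_of_local {q : (ℤ → unitInterval) → ℝ → ℝ} (hq : Measurable (Function.uncurry q))
    {C : ℝ} (hC : ∀ v x, |q v x| ≤ C) (f : ℝ → ℝ) (hf : ∀ v x, q v x = f (profile v x)) :
    ∀ᵐ v ∂alternatingLaw μ₁ μ₂, HasMean (q v) (windowMean (alternatingLaw μ₁ μ₂) q) := by
  refine ae_hasMean (siteLaw_add_two μ₁ μ₂) hq hC (fun n v x => ?_) MeasurableSet.univ
    (fun v v' j k h _ x hjx hxk => ?_) (r := 0) (by simp)
  · rw [hf, hf, profile_shift]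
  · rw [hf, hf, profile_congr h hjx hxk]

lemma ae_hasMean_high (hg : IsBranches G m M pm pM g₁ g₃ g₄) (hβ : 0 < β) (lam : ℝ) :
    ∀ᵐ v ∂alternatingLaw μ₁ μ₂, HasMean (fun x => g₄ (level β lam v x))
      (windowMean (alternatingLaw μ₁ μ₂) fun v x => g₄ (level β lam v x)) := by
  obtain ⟨C, -, hC⟩ := hg.exists_bound (lam - β) lam
  exact ae_hasMean_of_local (measurable_high_level hg) (fun v x => (hC _ (level_mem hβ x)).2.2)
    (fun t => g₄ (lam - β * t)) fun v x => rfl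

lemma abs_profile_sub_le (v : ℤ → unitInterval) {i : ℤ} {x : ℝ} (hx : x ∈ Icc (i : ℝ) (i + 1)) :
    |profile v x - v i| ≤ x - i := by
  rw [profile_eq v hx, add_sub_cancel_left, abs_mul, abs_of_nonneg (sub_nonneg.2 hx.1)]
  have h1 := (v i).2
  have h2 := (v (i + 1)).2
  refine mul_le_of_le_one_right (sub_nonneg.2 hx.1) ?_
  rw [abs_le]
  constructor <;> linarith [h1.1, h1.2, h2.1, h2.2]

/-- The profile moves at most at unit speed, so a site with value in `A` keeps f ≥ κ on a stretch of
length ε. Hence f ∘ profile has positive mean, and `HasMean.hasSmallGaps` applies. -/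
lemma ae_hasSmallGaps_of_pos {f : ℝ → ℝ} (hf : Continuous f) {A : Set unitInterval} {κ ε : ℝ}
    (h0 : ∀ t ∈ Icc (0 : ℝ) 1, 0 ≤ f t)
    (hκ : 0 < κ) (hε : 0 < ε) (hε1 : ε ≤ 1) {r : ℤ} (hr0 : 0 ≤ r) (hr1 : r ≤ 1)
    (hA : siteLaw μ₁ μ₂ r A ≠ 0) (hAm : MeasurableSet A)
    (hfA : ∀ a ∈ A, ∀ t ∈ Icc (0 : ℝ) 1, |t - a| ≤ ε → κ ≤ f t) :
    ∀ᵐ v ∂alternatingLaw μ₁ μ₂, HasSmallGaps {x | 0 < f (profile v x)} := by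
  obtain ⟨C, hC⟩ := isCompact_Icc.exists_bound_of_continuousOn (hf.continuousOn (s := Icc 0 1))
  have hm : Measurable (Function.uncurry fun v x => f (profile v x)) :=
    hf.measurable.comp measurable_profile
  have hC' : ∀ v x, |f (profile v x)| ≤ C := fun v x => hC _ (profile_mem v x)
  have hC0 : 0 ≤ C := (abs_nonneg _).trans (hC' 0 0)
  have hr0' : (0 : ℝ) ≤ r := by exact_mod_cast hr0
  have hr1' : (r : ℝ) ≤ 1 := by exact_mod_cast hr1
  have hpos : 0 < windowMean (alternatingLaw μ₁ μ₂) fun v x => f (profile v x) := by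
    have h1 := windowMean_add_le (ν := alternatingLaw μ₁ μ₂) (q₁ := fun _ _ => 0) (C := C)
      measurable_const hm (fun v x => by simpa using hC0) hC' (fun v x => h0 _ (profile_mem v x))
      (E := {v | v r ∈ A}) (a := r) (b := r + ε) (κ := κ) hr0' (by linarith) (by linarith) hκ.le
      (fun v hv x hx => by
        rw [zero_add]
        refine hfA _ hv _ (profile_mem v x) ((abs_profile_sub_le v (i := r)
          ⟨hx.1.le, hx.2.le.trans (by linarith)⟩).trans (by linarith [hx.2])))
    rw [windowMean_const] at h1
    have h2 : 0 < (alternatingLaw μ₁ μ₂).real {v | v r ∈ A} := by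
      have := alternatingLaw_three_sites μ₁ μ₂ (i := r) (j := r + 1) (k := r + 2) (by omega) (by omega)
        (by omega) hAm MeasurableSet.univ MeasurableSet.univ hA (by simp) (by simp)
      simpa using this
    have h3 : 0 < κ * (r + ε - r) * (alternatingLaw μ₁ μ₂).real {v | v r ∈ A} / 2 := by
      rw [add_sub_cancel_left]; positivity
    linarith
  filter_upwards [ae_hasMean_of_local (μ₁ := μ₁) (μ₂ := μ₂) hm hC' f fun v x => rfl] with v hv
  exact hv.hasSmallGaps (measurable_section hm v) (hC' v) hpos fun x hx => hx

lemma ae_hasSmallGaps_high {c : ℝ} (hsup : SeparatedSupports c μ₁ μ₂) {δ : ℝ} (hδ : 0 < δ) :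
    ∀ᵐ v ∂alternatingLaw μ₁ μ₂, HasSmallGaps {x | 1 - δ < profile v x} := by
  have hε : 0 < min (δ / 3) 1 := lt_min (by positivity) one_pos
  have h := ae_hasSmallGaps_of_pos (μ₁ := μ₁) (μ₂ := μ₂) (f := fun t => max 0 (t - (1 - δ)))
    (A := {a | 1 - δ / 3 < (a : ℝ)}) (κ := δ / 3) (ε := min (δ / 3) 1)
    (by fun_prop) (fun t _ => le_max_left _ _) (by positivity) hε (min_le_right _ _) (r := 1)
    (by norm_num) le_rfl (by
      rw [siteLaw_odd _ _ (by decide)]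
      refine ((Measure.mem_support_iff_forall _).1 hsup.one_mem _ ?_).ne'
      refine (isOpen_lt continuous_const (by fun_prop)).mem_nhds ?_
      simp only [mem_ofPred_eq, Icc.coe_one]
      linarith) (measurableSet_lt measurable_const (by fun_prop)) (fun a ha t _ hta => by
        have h1 := (abs_le.1 (hta.trans (min_le_left _ _))).1
        have h2 : 1 - δ / 3 < (a : ℝ) := ha
        exact le_max_of_le_right (by linarith))
  filter_upwards [h] with v hv
  simpa using hv

lemma ae_hasSmallGaps_low {c : ℝ} (hsup : SeparatedSupports c μ₁ μ₂) {δ : ℝ} (hδ : 0 < δ) :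
    ∀ᵐ v ∂alternatingLaw μ₁ μ₂, HasSmallGaps {x | profile v x < δ} := by
  have hε : 0 < min (δ / 3) 1 := lt_min (by positivity) one_pos
  have h := ae_hasSmallGaps_of_pos (μ₁ := μ₁) (μ₂ := μ₂) (f := fun t => max 0 (δ - t))
    (A := {a | (a : ℝ) < δ / 3}) (κ := δ / 3) (ε := min (δ / 3) 1)
    (by fun_prop) (fun t _ => le_max_left _ _) (by positivity) hε (min_le_right _ _) (r := 0)
    le_rfl zero_le_one (by
      rw [siteLaw_even _ _ (by decide)]
      refine ((Measure.mem_support_iff_forall _).1 hsup.zero_mem _ ?_).ne'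
      refine (isOpen_lt (by fun_prop) continuous_const).mem_nhds ?_
      simp only [mem_ofPred_eq, Icc.coe_zero]
      linarith) (measurableSet_lt (by fun_prop) measurable_const) (fun a ha t _ hta => by
        have h1 := (abs_le.1 (hta.trans (min_le_left _ _))).2
        have h2 : (a : ℝ) < δ / 3 := ha
        exact le_max_of_le_right (by linarith))
  filter_upwards [h] with v hv
  simpa using hv

end Slopes

end DoubleWellHJ

/-! ### Monotonicity and bounds of the mean slopes -/

namespace DoubleWellHJ

section Means

variable {G : ℝ → ℝ} {m M pm pM β : ℝ} {g₁ g₃ g₄ : ℝ → ℝ} {ν : Measure (ℤ → unitInterval)}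

/-- The mean slope of the corrector at height `lam` that stays on the left of the origin. -/
noncomputable def lowMean (g₁ g₃ : ℝ → ℝ) (m M β : ℝ) (ν : Measure (ℤ → unitInterval)) (lam : ℝ) : ℝ :=
  windowMean ν fun v => wellSlope g₁ g₃ m M (level β lam v)

/-- The mean slope of the corrector at height `lam` that stays on the right of the origin. -/
noncomputable def highMean (g₄ : ℝ → ℝ) (β : ℝ) (ν : Measure (ℤ → unitInterval)) (lam : ℝ) : ℝ :=
  windowMean ν fun v x => g₄ (level β lam v x)

lemma level_add (lam d : ℝ) (v : ℤ → unitInterval) (x : ℝ) :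
    level β (lam + d) v x = level β lam v x + d := by
  rw [level, level]; ring

lemma level_le_level {lam lam' : ℝ} (h : lam ≤ lam') (v : ℤ → unitInterval) (x : ℝ) :
    level β lam v x ≤ level β lam' v x := by
  rw [level, level]; linarith

/-- The two negative branches are separated by the increasing part of `G` on [pm, pM]; its width is
the size of the jumps of the mean slope. -/
lemma IsBranches.sub_le_of_inLeftWell (h : IsDoubleWell G m M pm pM)
    (hg : IsBranches G m M pm pM g₁ g₃ g₄) {s s' : ℝ → ℝ} {x : ℝ} (h0 : 0 ≤ s x)
    (hs : ¬InLeftWell m M s x) (hs' : InLeftWell m M s' x) :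
    wellSlope g₁ g₃ m M s' x + (pM - pm) ≤ wellSlope g₁ g₃ m M s x := by
  rw [wellSlope, wellSlope, if_pos hs', if_neg hs]
  have h3 := hg.le₁ _ hs'.m_lt.le
  have h4 : s x ≤ M := by
    by_contra! hc
    exact hs (inLeftWell_of_le h.m_lt_M hc.le)
  have h5 := (hg.mem₃ _ h0 h4).1
  linarith

variable [IsProbabilityMeasure ν]

/-- Raising the height gains a uniform amount everywhere: by compactness if the branch is kept, and
at least pM - pm if the state changes to the left well. -/
lemma lowMean_strictAntiOn (h : IsDoubleWell G m M pm pM) (hg : IsBranches G m M pm pM g₁ g₃ g₄)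
    (hβ : 0 < β) : StrictAntiOn (lowMean g₁ g₃ m M β ν) (Ici β) := by
  intro l₁ h₁ l₂ h₂ hl
  obtain ⟨κ₁, hκ₁, hgap₁⟩ := StrictMono.exists_gap (g := fun s => -g₁ s) hg.anti₁.neg hg.cont₁.neg
    (l₁ - β) l₁ (sub_pos.2 hl)
  obtain ⟨κ₃, hκ₃, hgap₃⟩ := StrictMono.exists_gap (g := fun s => -g₃ s) hg.anti₃.neg hg.cont₃.neg
    (l₁ - β) l₁ (sub_pos.2 hl)
  obtain ⟨C, -, hC⟩ := hg.exists_bound (l₁ - β) l₂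
  have hCl : ∀ l ∈ Icc l₁ l₂, ∀ v x, |wellSlope g₁ g₃ m M (level β l v) x| ≤ C := fun l hl v x => by
    have h1 := level_mem (lam := l) (v := v) hβ x
    have := hC (level β l v x) ⟨by linarith [h1.1, hl.1], h1.2.trans hl.2⟩
    exact abs_wellSlope_le this.1 this.2.1
  have hκ : 0 < min (min κ₁ κ₃) (pM - pm) := lt_min (lt_min hκ₁ hκ₃) (sub_pos.2 h.pm_lt_pM)
  have key : ∀ v x, wellSlope g₁ g₃ m M (level β l₂ v) x + min (min κ₁ κ₃) (pM - pm) ≤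
      wellSlope g₁ g₃ m M (level β l₁ v) x := by
    intro v x
    have hm := level_mem (lam := l₁) (v := v) hβ x
    have e : level β l₂ v x = level β l₁ v x + (l₂ - l₁) := by rw [← level_add]; congr 1; ring
    have k1 := hgap₁ _ hm
    have k3 := hgap₃ _ hm
    have m1 : min (min κ₁ κ₃) (pM - pm) ≤ κ₁ := (min_le_left _ _).trans (min_le_left _ _)
    have m2 : min (min κ₁ κ₃) (pM - pm) ≤ κ₃ := (min_le_left _ _).trans (min_le_right _ _)
    have m3 : min (min κ₁ κ₃) (pM - pm) ≤ pM - pm := min_le_right _ _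
    have h0 : 0 ≤ level β l₁ v x := by linarith [hm.1, mem_Ici.1 h₁]
    by_cases c1 : InLeftWell m M (level β l₁ v) x
    · have c2 := c1.mono (fun y => level_le_level hl.le v y)
      rw [wellSlope, wellSlope, if_pos c1, if_pos c2, e]
      linarith
    · by_cases c2 : InLeftWell m M (level β l₂ v) x
      · have := hg.sub_le_of_inLeftWell h h0 c1 c2
        linarith
      · rw [wellSlope, wellSlope, if_neg c1, if_neg c2, e]
        linarith
  have := windowMean_add_le (ν := ν) (measurable_wellSlope_level hg hβ h.m_lt_M)
    (measurable_wellSlope_level hg hβ h.m_lt_M)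
    (hCl l₂ ⟨hl.le, le_rfl⟩) (hCl l₁ ⟨le_rfl, hl.le⟩)
    (fun v x => by linarith [key v x]) (E := univ) (a := 0) (b := 2) le_rfl two_pos.le le_rfl
    hκ.le (fun v _ x _ => key v x)
  rw [probReal_univ] at this
  rw [lowMean, lowMean]
  linarith

lemma highMean_strictMono (hg : IsBranches G m M pm pM g₁ g₃ g₄)
    (hβ : 0 < β) : StrictMono (highMean g₄ β ν) := by
  intro l₁ l₂ hl
  obtain ⟨κ, hκ, hgap⟩ := StrictMono.exists_gap hg.mono₄ hg.cont₄ (l₁ - β) l₁ (sub_pos.2 hl)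
  obtain ⟨C, -, hC⟩ := hg.exists_bound (l₁ - β) l₂
  have hCl : ∀ l ∈ Icc l₁ l₂, ∀ v x, |g₄ (level β l v x)| ≤ C := fun l hl v x => by
    have h1 := level_mem (lam := l) (v := v) hβ x
    exact (hC (level β l v x) ⟨by linarith [h1.1, hl.1], h1.2.trans hl.2⟩).2.2
  have key : ∀ v x, g₄ (level β l₁ v x) + κ ≤ g₄ (level β l₂ v x) := by
    intro v x
    have e : level β l₂ v x = level β l₁ v x + (l₂ - l₁) := by rw [← level_add]; congr 1; ring
    rw [e]
    exact hgap _ (level_mem hβ x)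
  have := windowMean_add_le (ν := ν) (measurable_high_level hg) (measurable_high_level hg)
    (hCl l₁ ⟨le_rfl, hl.le⟩) (hCl l₂ ⟨hl.le, le_rfl⟩)
    (fun v x => by linarith [key v x]) (E := univ) (a := 0) (b := 2) le_rfl two_pos.le le_rfl
    hκ.le (fun v _ x _ => key v x)
  rw [probReal_univ] at this
  rw [highMean, highMean]
  linarith

lemma continuous_highMean (hg : IsBranches G m M pm pM g₁ g₃ g₄)
    (hβ : 0 < β) : Continuous (highMean g₄ β ν) := by
  rw [continuous_iff_continuousAt]
  intro lam
  obtain ⟨C, -, hC⟩ := hg.exists_bound (lam - 1 - β) (lam + 1)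
  refine tendsto_windowMean (C := C) (Eventually.of_forall fun n => measurable_high_level hg) ?_ ?_
  · filter_upwards [Ioo_mem_nhds (show lam - 1 < lam by linarith) (show lam < lam + 1 by linarith)]
      with l hl v x
    have h1 := level_mem (lam := l) (v := v) hβ x
    exact (hC _ ⟨by linarith [h1.1, hl.1], by linarith [h1.2, hl.2]⟩).2.2
  · refine Eventually.of_forall fun v => Eventually.of_forall fun x => ?_
    have : Continuous fun l => g₄ (level β l v x) := by
      unfold level
      exact hg.cont₄.comp (by fun_prop)
    exact this.tendsto lam

lemma lowMean_nonpos (h : IsDoubleWell G m M pm pM) (hg : IsBranches G m M pm pM g₁ g₃ g₄)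
    (hβ : 0 < β) {lam : ℝ} (hl : β ≤ lam) : lowMean g₁ g₃ m M β ν lam ≤ 0 := by
  obtain ⟨C, -, hC⟩ := hg.exists_bound (lam - β) lam
  refine windowMean_le (C := C) (measurable_wellSlope_level hg hβ h.m_lt_M) (fun v x => ?_)
    fun v x => wellSlope_nonpos h hg (fun y => ?_) x
  · have := hC _ (level_mem (v := v) hβ x)
    exact abs_wellSlope_le this.1 this.2.1
  · have := (level_mem (lam := lam) (v := v) hβ y).1
    linarith

lemma exists_lowMean_le (h : IsDoubleWell G m M pm pM) (hg : IsBranches G m M pm pM g₁ g₃ g₄)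
    (hβ : 0 < β) (K : ℝ) : ∃ L, ∀ lam, L ≤ lam → lowMean g₁ g₃ m M β ν lam ≤ K := by
  refine ⟨β + max M (G (min K pm)), fun lam hl => ?_⟩
  obtain ⟨C, -, hC⟩ := hg.exists_bound (lam - β) lam
  refine windowMean_le (C := C) (measurable_wellSlope_level hg hβ h.m_lt_M) (fun v x => ?_)
    fun v x => ?_
  · have := hC _ (level_mem (v := v) hβ x)
    exact abs_wellSlope_le this.1 this.2.1
  · have h1 := (level_mem (lam := lam) (v := v) hβ x).1
    have h2 : InLeftWell m M (level β lam v) x := inLeftWell_of_le h.m_lt_M (by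
      linarith [le_max_left M (G (min K pm))])
    rw [wellSlope, if_pos h2]
    calc g₁ (level β lam v x) ≤ g₁ (G (min K pm)) :=
          hg.anti₁.antitone (by linarith [le_max_right M (G (min K pm))])
      _ = min K pm := hg.inv₁ _ (min_le_right _ _)
      _ ≤ K := min_le_left _ _

lemma exists_le_highMean (hg : IsBranches G m M pm pM g₁ g₃ g₄)
    (hβ : 0 < β) (K : ℝ) : ∃ L, ∀ lam, L ≤ lam → K ≤ highMean g₄ β ν lam := by
  refine ⟨β + G (max K 0), fun lam hl => ?_⟩
  obtain ⟨C, -, hC⟩ := hg.exists_bound (lam - β) lam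
  refine le_windowMean (C := C) (measurable_high_level hg) (fun v x => ?_) fun v x => ?_
  · exact (hC _ (level_mem (v := v) hβ x)).2.2
  · have h1 := (level_mem (lam := lam) (v := v) hβ x).1
    calc K ≤ max K 0 := le_max_left _ _
      _ = g₄ (G (max K 0)) := (hg.inv₄ _ (le_max_right _ _)).symm
      _ ≤ _ := hg.mono₄.monotone (by linarith)

/-- If v 0 < 1/4, the potential is below 1/2 on (0, 1/4), so the level is at least β/2 there for
every height λ ≥ β. The uniformity in λ produces the flat piece at height β. -/
lemma exists_pos_le_highMean (h : IsDoubleWell G m M pm pM) (hg : IsBranches G m M pm pM g₁ g₃ g₄)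
    (hβ : 0 < β) {μ₁ μ₂ : ProbabilityMeasure unitInterval}
    (hzero : (0 : unitInterval) ∈ (μ₁ : Measure unitInterval).support) :
    ∃ κ > 0, ∀ lam, β ≤ lam → κ ≤ highMean g₄ β (alternatingLaw μ₁ μ₂) lam := by
  have hA : siteLaw μ₁ μ₂ 0 {a : unitInterval | (a : ℝ) < 1 / 4} ≠ 0 := by
    rw [siteLaw_even _ _ (by decide)]
    refine ((Measure.mem_support_iff_forall _).1 hzero _ ?_).ne'
    refine (isOpen_lt (by fun_prop) continuous_const).mem_nhds ?_
    simp
  have hE : 0 < (alternatingLaw μ₁ μ₂).real {v | v 0 ∈ {a : unitInterval | (a : ℝ) < 1 / 4}} := by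
    have := alternatingLaw_three_sites μ₁ μ₂ (i := 0) (j := 1) (k := 2) (by omega) (by omega)
      (by omega) (measurableSet_lt (by fun_prop) measurable_const) MeasurableSet.univ
      MeasurableSet.univ hA (by simp) (by simp)
    simpa using this
  have hg0 : g₄ 0 = 0 := by
    conv_lhs => rw [← h.map_zero]
    exact hg.inv₄ 0 le_rfl
  have hg2 : 0 < g₄ (β / 2) := hg0 ▸ hg.mono₄ (by positivity)
  refine ⟨_, show 0 < g₄ (β / 2) * (1 / 4 - 0) * (alternatingLaw μ₁ μ₂).real
    {v | v 0 ∈ {a : unitInterval | (a : ℝ) < 1 / 4}} / 2 by positivity, fun lam hl => ?_⟩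
  obtain ⟨C, hC0, hC⟩ := hg.exists_bound (lam - β) lam
  have := windowMean_add_le (ν := alternatingLaw μ₁ μ₂) (q₁ := fun _ _ => 0) (C := C)
    measurable_const (measurable_high_level (β := β) (lam := lam) hg) (fun v x => by simpa using hC0)
    (fun v x => (hC _ (level_mem (v := v) hβ x)).2.2)
    (fun v x => hg.nonneg₄ _ (by linarith [(level_mem (lam := lam) (v := v) hβ x).1]))
    (E := {v | v 0 ∈ {a : unitInterval | (a : ℝ) < 1 / 4}}) (a := 0) (b := 1 / 4) (κ := g₄ (β / 2))
    le_rfl (by norm_num) (by norm_num) hg2.le (fun v hv x hx => by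
      rw [zero_add]
      refine hg.mono₄.monotone ?_
      have h1 := (abs_le.1 (abs_profile_sub_le v (i := 0) (x := x)
        ⟨by simpa using hx.1.le, by norm_num; linarith [hx.2]⟩)).2
      have h2 : (v 0 : ℝ) < 1 / 4 := hv
      rw [level]
      push_cast at h1
      nlinarith [hx.2])
  rw [windowMean_const, zero_add] at this
  exact this

end Means

end DoubleWellHJ

/-! ### Continuity points and jumps of the low mean slope -/

namespace DoubleWellHJ

section Stability

variable {G : ℝ → ℝ} {m M pm pM β lam : ℝ} {g₁ g₃ g₄ : ℝ → ℝ} {v : ℤ → unitInterval}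

lemma inLeftWell_level_intCast_rec (hβ : 0 < β) (hmM : m < M) (i : ℤ) :
    InLeftWell m M (level β lam v) i ↔
      m < lam - β * v i ∧ (M ≤ lam - β * v i ∨ InLeftWell m M (level β lam v) (i - 1 : ℤ)) := by
  have := inLeftWell_level_iff (lam := lam) (v := v) hβ hmM (i := i - 1) (x := i)
    ⟨by push_cast; linarith, by push_cast; linarith⟩
  rwa [level_intCast] at this

/-- Induction to the right from a strict reset site. A borderline level is harmless when the state
would be the same on either side: level M when the left well is already occupied, level m when it is
not. -/
lemma eventually_inLeftWell_intCast_iff (hβ : 0 < β) (hmM : m < M)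
    (hreset : ∀ n, ∃ j ≤ n, M < lam - β * v j ∨ lam - β * v j < m)
    (hM : ∀ i, lam - β * v i = M → InLeftWell m M (level β lam v) (i - 1 : ℤ))
    (hm : ∀ i, lam - β * v i = m → ¬InLeftWell m M (level β lam v) (i - 1 : ℤ)) (i : ℤ) :
    ∀ᶠ l in 𝓝 lam, (InLeftWell m M (level β l v) i ↔ InLeftWell m M (level β lam v) i) := by
  have hlt : ∀ t i, t < lam - β * v i → ∀ᶠ l in 𝓝 lam, t < l - β * v i := fun t i h =>
    ((continuous_id.sub continuous_const).tendsto lam).eventually (lt_mem_nhds h)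
  have hgt : ∀ t i, lam - β * v i < t → ∀ᶠ l in 𝓝 lam, l - β * v i < t := fun t i h =>
    ((continuous_id.sub continuous_const).tendsto lam).eventually (gt_mem_nhds h)
  have htrue : ∀ i, M < lam - β * v i →
      ∀ᶠ l in 𝓝 lam, (InLeftWell m M (level β l v) i ↔ InLeftWell m M (level β lam v) i) := by
    intro i h
    filter_upwards [hlt M i h] with l hl
    exact iff_of_true (inLeftWell_of_le hmM (by rw [level_intCast]; exact hl.le))
      (inLeftWell_of_le hmM (by rw [level_intCast]; exact h.le))
  have hfalse : ∀ i, lam - β * v i < m →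
      ∀ᶠ l in 𝓝 lam, (InLeftWell m M (level β l v) i ↔ InLeftWell m M (level β lam v) i) := by
    intro i h
    filter_upwards [hgt m i h] with l hl
    refine iff_of_false (fun hc => ?_) (fun hc => ?_)
    · have := hc.m_lt
      rw [level_intCast] at this; linarith
    · have := hc.m_lt
      rw [level_intCast] at this; linarith
  obtain ⟨j, hj, hjr⟩ := hreset i
  induction i, hj using Int.leInduction with
  | base => exact hjr.elim (htrue j) (hfalse j)
  | succ i _ ih =>
    have hrec : ∀ l, InLeftWell m M (level β l v) (i + 1 : ℤ) ↔ m < l - β * v (i + 1) ∧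
        (M ≤ l - β * v (i + 1) ∨ InLeftWell m M (level β l v) i) := fun l => by
      rw [inLeftWell_level_intCast_rec hβ hmM, add_sub_cancel_right]
    have hM' := hM (i + 1)
    have hm' := hm (i + 1)
    rw [add_sub_cancel_right] at hM' hm'
    rcases lt_trichotomy (lam - β * v (i + 1)) m with h1 | h1 | h1
    · exact hfalse _ h1
    · filter_upwards [hgt M (i + 1) (h1.trans_lt hmM), ih] with l hl hi
      rw [hrec, hrec]
      refine iff_of_false (fun hc => ?_) (fun hc => absurd hc.1 h1.not_gt)
      exact hc.2.elim (fun h => absurd h (not_le.2 hl)) fun h => hm' h1 (hi.1 h)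
    · rcases lt_trichotomy (lam - β * v (i + 1)) M with h2 | h2 | h2
      · filter_upwards [hgt M (i + 1) h2, hlt m (i + 1) h1, ih] with l hl hl' hi
        rw [hrec, hrec]
        simp only [h1, hl', not_le.2 h2, not_le.2 hl, hi]
      · filter_upwards [hlt m (i + 1) h1, ih] with l hl hi
        rw [hrec, hrec]
        exact iff_of_true ⟨hl, Or.inr (hi.2 (hM' h2))⟩ ⟨h1, Or.inl h2.ge⟩
      · exact htrue _ h2

lemma tendsto_wellSlope_level (hβ : 0 < β) (hmM : m < M) (c₁ : Continuous g₁) (c₃ : Continuous g₃)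
    {x : ℝ} (hst : ∀ᶠ l in 𝓝 lam, (InLeftWell m M (level β l v) ⌊x⌋ ↔
      InLeftWell m M (level β lam v) ⌊x⌋)) (hxm : level β lam v x ≠ m) (hxM : level β lam v x ≠ M) :
    Tendsto (fun l => wellSlope g₁ g₃ m M (level β l v) x) (𝓝 lam)
      (𝓝 (wellSlope g₁ g₃ m M (level β lam v) x)) := by
  have hc : Continuous fun l => level β l v x := by unfold level; fun_prop
  have hx : x ∈ Icc ((⌊x⌋ : ℤ) : ℝ) (⌊x⌋ + 1) := ⟨Int.floor_le x, (Int.lt_floor_add_one x).le⟩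
  have e1 : ∀ᶠ l in 𝓝 lam, (m < level β l v x ↔ m < level β lam v x) := by
    rcases lt_or_gt_of_ne hxm with h | h
    · filter_upwards [(hc.tendsto lam).eventually (gt_mem_nhds h)] with l hl
      exact iff_of_false hl.not_gt h.not_gt
    · filter_upwards [(hc.tendsto lam).eventually (lt_mem_nhds h)] with l hl
      exact iff_of_true hl h
  have e2 : ∀ᶠ l in 𝓝 lam, (M ≤ level β l v x ↔ M ≤ level β lam v x) := by
    rcases lt_or_gt_of_ne hxM with h | h
    · filter_upwards [(hc.tendsto lam).eventually (gt_mem_nhds h)] with l hl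
      exact iff_of_false hl.not_ge h.not_ge
    · filter_upwards [(hc.tendsto lam).eventually (lt_mem_nhds h)] with l hl
      exact iff_of_true (le_of_lt hl) (le_of_lt h)
  have e3 : ∀ᶠ l in 𝓝 lam, (InLeftWell m M (level β l v) x ↔ InLeftWell m M (level β lam v) x) := by
    filter_upwards [e1, e2, hst] with l h1 h2 h3
    rw [inLeftWell_level_iff hβ hmM hx, inLeftWell_level_iff hβ hmM hx, h1, h2, h3]
  by_cases hL : InLeftWell m M (level β lam v) x
  · have : Tendsto (fun l => g₁ (level β l v x)) (𝓝 lam) (𝓝 (g₁ (level β lam v x))) :=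
      (c₁.comp hc).tendsto lam
    rw [wellSlope, if_pos hL]
    refine this.congr' ?_
    filter_upwards [e3] with l hl
    rw [wellSlope, if_pos (hl.2 hL)]
  · have : Tendsto (fun l => g₃ (level β l v x)) (𝓝 lam) (𝓝 (g₃ (level β lam v x))) :=
      (c₃.comp hc).tendsto lam
    rw [wellSlope, if_neg hL]
    refine this.congr' ?_
    filter_upwards [e3] with l hl
    rw [wellSlope, if_neg fun h => hL (hl.1 h)]

/-- Between sites with distinct values the profile is injective, so each level set is countable. -/
lemma ae_profile_ne (hv : ∀ i, (v i : ℝ) ≠ v (i + 1)) (t : ℝ) : ∀ᵐ x, profile v x ≠ t := by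
  have hc : {x | profile v x = t}.Countable := by
    have hsub : {x | profile v x = t} ⊆ ⋃ i : ℤ, {x ∈ Icc (i : ℝ) (i + 1) | profile v x = t} :=
      fun x hx => mem_iUnion.2 ⟨⌊x⌋, ⟨Int.floor_le x, (Int.lt_floor_add_one x).le⟩, hx⟩
    refine (countable_iUnion fun i => Set.Subsingleton.countable ?_).mono hsub
    rintro x ⟨hx, hxt⟩ y ⟨hy, hyt⟩
    rw [← hyt, profile_eq v hx, profile_eq v hy] at hxt
    have h1 : (x - y) * ((v (i + 1) : ℝ) - v i) = 0 := by linarith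
    rcases mul_eq_zero.1 h1 with h2 | h2
    · linarith
    · exact absurd (by linarith) (hv i)
  rw [ae_iff]
  simpa using hc.measure_zero volume

end Stability

section Jumps

variable {G : ℝ → ℝ} {m M pm pM β lam c : ℝ} {g₁ g₃ g₄ : ℝ → ℝ}
  {μ₁ μ₂ : ProbabilityMeasure unitInterval}

lemma ae_separated (hsup : SeparatedSupports c μ₁ μ₂) :
    ∀ᵐ v ∂alternatingLaw μ₁ μ₂, ∀ i : ℤ, (Even i → (v i : ℝ) < c) ∧ (¬Even i → c < (v i : ℝ)) := by
  refine ae_forall_site μ₁ μ₂ (Q := fun i a => (Even i → (a : ℝ) < c) ∧ (¬Even i → c < (a : ℝ)))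
    fun i => ?_
  by_cases hi : Even i
  · rw [siteLaw_even _ _ hi]
    filter_upwards [Measure.support_mem_ae (μ := (μ₁ : Measure unitInterval))] with a ha
    exact ⟨fun _ => hsup.lt_c a ha, fun h => absurd hi h⟩
  · rw [siteLaw_odd _ _ hi]
    filter_upwards [Measure.support_mem_ae (μ := (μ₂ : Measure unitInterval))] with a ha
    exact ⟨fun h => absurd h hi, fun _ => hsup.c_lt a ha⟩

/-- Almost surely every borderline site is harmless. For λ < m + β the absence of atoms of μ₁ leaves
level M to odd sites only, and the preceding even site has a higher level, so the left well is
already occupied; for λ ≥ m + β all levels exceed m and the state, once entered, persists. For λ > M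
the absence of atoms of μ₂ leaves level m to even sites only, and the preceding odd site is below m;
for λ ≤ M no site reaches M. Dominated convergence does the rest. -/
lemma continuousAt_lowMean (h : IsDoubleWell G m M pm pM) (hg : IsBranches G m M pm pM g₁ g₃ g₄)
    (hβ : 0 < β) (hsup : SeparatedSupports c μ₁ μ₂) (hMβ : M < m + β)
    (h₁ : lam < m + β → ∀ a : unitInterval, M + β * a = lam → (μ₁ : Measure unitInterval) {a} = 0)
    (h₂ : M < lam → ∀ a : unitInterval, m + β * a = lam → (μ₂ : Measure unitInterval) {a} = 0) :
    ContinuousAt (lowMean g₁ g₃ m M β (alternatingLaw μ₁ μ₂)) lam := by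
  have hnull : ∀ (μ : ProbabilityMeasure unitInterval) (t : ℝ),
      (∀ a : unitInterval, t + β * a = lam → (μ : Measure unitInterval) {a} = 0) →
      ∀ᵐ (a : unitInterval) ∂(μ : Measure unitInterval), lam - β * a ≠ t := by
    intro μ t ht
    by_cases hex : ∃ a : unitInterval, t + β * a = lam
    · obtain ⟨a, ha⟩ := hex
      have h0 := ht a ha
      rw [← compl_mem_ae_iff] at h0
      filter_upwards [h0] with b hb hbt
      refine hb ?_
      rw [mem_singleton_iff]
      have h3 : β * (b : ℝ) = β * a := by linarith
      exact Subtype.ext (mul_left_cancel₀ hβ.ne' h3)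
    · push Not at hex
      exact Eventually.of_forall fun a hat => hex a (by linarith)
  have hav1 : ∀ᵐ v ∂alternatingLaw μ₁ μ₂, ∀ i : ℤ, lam < m + β → Even i → lam - β * v i ≠ M := by
    refine ae_forall_site μ₁ μ₂ (Q := fun i a => lam < m + β → Even i → lam - β * a ≠ M)
      fun i => ?_
    by_cases hc : lam < m + β ∧ Even i
    · rw [siteLaw_even _ _ hc.2]
      filter_upwards [hnull μ₁ M (h₁ hc.1)] with a ha _ _ using ha
    · exact Eventually.of_forall fun a h1 h2 => absurd ⟨h1, h2⟩ hc
  have hav2 : ∀ᵐ v ∂alternatingLaw μ₁ μ₂, ∀ i : ℤ, M < lam → ¬Even i → lam - β * v i ≠ m := by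
    refine ae_forall_site μ₁ μ₂ (Q := fun i a => M < lam → ¬Even i → lam - β * a ≠ m)
      fun i => ?_
    by_cases hc : M < lam ∧ ¬Even i
    · rw [siteLaw_odd _ _ hc.2]
      filter_upwards [hnull μ₂ m (h₂ hc.1)] with a ha _ _ using ha
    · exact Eventually.of_forall fun a h1 h2 => absurd ⟨h1, h2⟩ hc
  obtain ⟨r, hr⟩ := exists_siteLaw_reset_pos hsup hMβ lam
  obtain ⟨C, -, hC⟩ := hg.exists_bound (lam - 1 - β) (lam + 1)
  refine tendsto_windowMean (C := C)
    (Eventually.of_forall fun n => measurable_wellSlope_level hg hβ h.m_lt_M) ?_ ?_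
  · filter_upwards [Ioo_mem_nhds (show lam - 1 < lam by linarith) (show lam < lam + 1 by linarith)]
      with l hl v x
    have h1 := level_mem (lam := l) (v := v) hβ x
    have := hC (level β l v x) ⟨by linarith [h1.1, hl.1], by linarith [h1.2, hl.2]⟩
    exact abs_wellSlope_le this.1 this.2.1
  filter_upwards [hav1, hav2, ae_separated hsup,
    ae_exists_mem (siteLaw_add_two μ₁ μ₂) measurableSet_reset hr] with v hv1 hv2 hv hres
  have hsucc : ∀ i : ℤ, (v i : ℝ) ≠ v (i + 1) := by
    intro i
    by_cases hi : Even i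
    · have h1 := (hv i).1 hi
      have h2 := (hv (i + 1)).2 (by rw [Int.even_add_one]; exact not_not.2 hi)
      linarith
    · have h1 := (hv i).2 hi
      have h2 := (hv (i + 1)).1 (by rw [Int.even_add_one]; exact hi)
      linarith
  have hst := eventually_inLeftWell_intCast_iff (lam := lam) (v := v) hβ h.m_lt_M
    (fun n => (hres n).2) (fun i hi => ?_) (fun i hi => ?_)
  · filter_upwards [ae_profile_ne hsucc ((lam - m) / β), ae_profile_ne hsucc ((lam - M) / β)]
      with x hxm hxM
    refine tendsto_wellSlope_level hβ h.m_lt_M hg.cont₁ hg.cont₃ (hst ⌊x⌋) (fun hc => hxm ?_)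
      (fun hc => hxM ?_)
    · rw [level] at hc
      rw [eq_div_iff hβ.ne']; linarith
    · rw [level] at hc
      rw [eq_div_iff hβ.ne']; linarith
  · rcases lt_or_ge lam (m + β) with hl | hl
    · have hodd : ¬Even i := fun he => hv1 i hl he hi
      have h1 := (hv i).2 hodd
      have h2 := (hv (i - 1)).1 (by rw [Int.even_sub_one]; exact hodd)
      refine inLeftWell_of_le h.m_lt_M ?_
      rw [level_intCast]
      nlinarith
    · have hgt : ∀ k, m < lam - β * v k := by
        intro k
        have hk : (v k : ℝ) ≤ 1 := (v k).2.2
        by_cases hke : Even k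
        · have := (hv k).1 hke
          nlinarith [hsup.c_mem.2]
        · have := hv2 k (hMβ.trans_le hl) hke
          refine lt_of_le_of_ne ?_ this.symm
          nlinarith
      obtain ⟨j, hj, hjr⟩ := (hres (i - 1)).2
      rcases hjr with hjr | hjr
      · exact (inLeftWell_level_intCast_iff hβ h.m_lt_M _).2 ⟨j, hj, le_of_lt hjr, fun k _ _ => hgt k⟩
      · exact absurd hjr (hgt j).not_gt
  · rcases le_or_gt lam M with hl | hl
    · intro hc
      obtain ⟨j, -, hj, -⟩ := (inLeftWell_level_intCast_iff hβ h.m_lt_M _).1 hc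
      have hj0 : (0 : ℝ) ≤ v j := (v j).2.1
      by_cases hje : Even j
      · refine hv1 j (hl.trans_lt hMβ) hje (le_antisymm ?_ hj)
        nlinarith
      · have := (hv j).2 hje
        nlinarith [hsup.c_mem.1]
    · have heven : Even i := by
        by_contra hc
        exact hv2 i hl hc hi
      have h1 := (hv i).1 heven
      have h2 := (hv (i - 1)).2 (by rw [Int.even_sub_one]; exact not_not.2 heven)
      intro hc
      have := hc.m_lt
      rw [level_intCast] at this
      nlinarith

/-- On an event of positive probability the states just below and just above λ differ along a
stretch after the site i, which costs at least pM - pm in the slope. The level moves at most at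
speed β and so needs a length (M - m)/β to cross from one threshold to the other, during which the
discrepancy survives. Taking i among 0 and 1 keeps the stretch inside the window [0, 2]. -/
lemma exists_lowMean_jump (h : IsDoubleWell G m M pm pM) (hg : IsBranches G m M pm pM g₁ g₃ g₄)
    (hβ : 0 < β) (hMβ : M < m + β) {i : ℤ} (hi0 : 0 ≤ i) (hi1 : i ≤ 1) {A B D : Set unitInterval}
    (hA : MeasurableSet A) (hB : MeasurableSet B) (hD : MeasurableSet D)
    (hA0 : siteLaw μ₁ μ₂ (i - 1) A ≠ 0) (hB0 : siteLaw μ₁ μ₂ i B ≠ 0)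
    (hD0 : siteLaw μ₁ μ₂ (i + 1) D ≠ 0)
    (hstate : ∀ v : ℤ → unitInterval, v (i - 1) ∈ A → v i ∈ B → v (i + 1) ∈ D → ∀ l₁ l₂,
      l₁ < lam → lam < l₂ → ∀ x ∈ Ioo (i : ℝ) (i + (M - m) / β),
      ¬InLeftWell m M (level β l₁ v) x ∧ InLeftWell m M (level β l₂ v) x) :
    ∃ κ > 0, ∀ l₁ l₂, β ≤ l₁ → l₁ < lam → lam < l₂ →
      lowMean g₁ g₃ m M β (alternatingLaw μ₁ μ₂) l₂ + κ ≤
        lowMean g₁ g₃ m M β (alternatingLaw μ₁ μ₂) l₁ := by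
  have hE := alternatingLaw_three_sites μ₁ μ₂ (i := i - 1) (j := i) (k := i + 1) (by omega) (by omega)
    (by omega) hA hB hD hA0 hB0 hD0
  set E := {v : ℤ → unitInterval | v (i - 1) ∈ A ∧ v i ∈ B ∧ v (i + 1) ∈ D}
  have hp : 0 < pM - pm := sub_pos.2 h.pm_lt_pM
  have hd : 0 < (M - m) / β := div_pos (sub_pos.2 h.m_lt_M) hβ
  have hd1 : (M - m) / β < 1 := by rw [div_lt_one hβ]; linarith
  have hi0' : (0 : ℝ) ≤ i := by exact_mod_cast hi0
  have hi1' : (i : ℝ) ≤ 1 := by exact_mod_cast hi1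
  refine ⟨_, show 0 < (pM - pm) * ((i + (M - m) / β) - i) * (alternatingLaw μ₁ μ₂).real E / 2 by
    rw [add_sub_cancel_left]; positivity, fun l₁ l₂ hl₁ h1 h2 => ?_⟩
  obtain ⟨C, -, hC⟩ := hg.exists_bound (l₁ - β) l₂
  have hCl : ∀ l ∈ Icc l₁ l₂, ∀ v x, |wellSlope g₁ g₃ m M (level β l v) x| ≤ C := fun l hl v x => by
    have h1 := level_mem (lam := l) (v := v) hβ x
    have := hC (level β l v x) ⟨by linarith [h1.1, hl.1], h1.2.trans hl.2⟩
    exact abs_wellSlope_le this.1 this.2.1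
  have h0 : ∀ v x, 0 ≤ level β l₁ v x := fun v x => by
    linarith [(level_mem (lam := l₁) (v := v) hβ x).1]
  have hl := (h1.trans h2).le
  exact windowMean_add_le (measurable_wellSlope_level hg hβ h.m_lt_M)
    (measurable_wellSlope_level hg hβ h.m_lt_M)
    (hCl l₂ ⟨hl, le_rfl⟩) (hCl l₁ ⟨le_rfl, hl⟩)
    (fun v x => wellSlope_anti h hg (h0 v) (fun y => level_le_level hl v y) x)
    hi0' (by linarith) (by linarith) hp.le fun v hv x hx =>
      have hs := hstate v hv.1 hv.2.1 hv.2.2 l₁ l₂ h1 h2 x hx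
      hg.sub_le_of_inLeftWell h (h0 v x) hs.1 hs.2

/-- An even site whose level is exactly M at height λ, between two odd sites below m. Just above λ
the peak reaches M and the left well is entered; just below it is missed, and the site on the left
has erased any earlier entry. -/
lemma exists_lowMean_jump_of_atom_low (h : IsDoubleWell G m M pm pM)
    (hg : IsBranches G m M pm pM g₁ g₃ g₄) (hβ : 0 < β) (hsup : SeparatedSupports c μ₁ μ₂)
    (hMβ : M < m + β) (hl : lam < m + β) {a : unitInterval} (ha : M + β * a = lam)
    (hμ : (μ₁ : Measure unitInterval) {a} ≠ 0) :
    ∃ κ > 0, ∀ l₁ l₂, β ≤ l₁ → l₁ < lam → lam < l₂ →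
      lowMean g₁ g₃ m M β (alternatingLaw μ₁ μ₂) l₂ + κ ≤
        lowMean g₁ g₃ m M β (alternatingLaw μ₁ μ₂) l₁ := by
  have hU : siteLaw μ₁ μ₂ 1 {b : unitInterval | lam - β * b < m} ≠ 0 := by
    rw [siteLaw_odd _ _ (by decide)]
    exact measure_level_pos_of_lt_m hsup.one_mem hl
  have hU' : siteLaw μ₁ μ₂ (0 - 1) {b : unitInterval | lam - β * b < m} ≠ 0 := by
    rw [siteLaw_odd _ _ (by decide)]
    exact measure_level_pos_of_lt_m hsup.one_mem hl
  have hUm : MeasurableSet {b : unitInterval | lam - β * b < m} :=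
    measurableSet_lt (by fun_prop) measurable_const
  refine exists_lowMean_jump h hg hβ hMβ (i := 0) le_rfl zero_le_one hUm (measurableSet_singleton a)
    hUm hU' (by rwa [siteLaw_even _ _ (by decide)]) hU
    fun v hv₁ hv₂ hv₃ l₁ l₂ h1 h2 x hx => ?_
  have hd1 : (M - m) / β < 1 := by rw [div_lt_one hβ]; linarith
  have hv₁' : lam - β * v (0 - 1) < m := hv₁
  have hv₂' : v 0 = a := hv₂
  have hv₃' : lam - β * v (0 + 1) < m := hv₃
  have hx01 : x ∈ Icc ((0 : ℤ) : ℝ) ((0 : ℤ) + 1) :=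
    ⟨hx.1.le, hx.2.le.trans (by gcongr)⟩
  have hxβ : β * (x - (0 : ℤ)) < M - m := by
    rw [mul_comm, ← lt_div_iff₀ hβ]; exact sub_left_lt_of_lt_add hx.2
  have hpe := profile_eq v hx01
  have habs := (abs_le.1 (abs_profile_sub_le v hx01)).2
  have hinc : 0 ≤ (x - ((0 : ℤ) : ℝ)) * (v (0 + 1) - v 0) := by
    refine mul_nonneg (sub_nonneg.2 hx01.1) ?_
    rw [hv₂']
    nlinarith [h.m_lt_M]
  rw [hv₂'] at hpe habs hinc
  constructor
  · rw [inLeftWell_level_iff hβ h.m_lt_M hx01, inLeftWell_level_intCast_rec hβ h.m_lt_M, hv₂']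
    rintro ⟨-, hc | ⟨-, hc | hc⟩⟩
    · rw [level] at hc; nlinarith
    · linarith
    · have := hc.m_lt
      rw [level_intCast] at this
      linarith
  · rw [inLeftWell_level_iff hβ h.m_lt_M hx01]
    refine ⟨?_, Or.inr (inLeftWell_of_le h.m_lt_M ?_)⟩
    · rw [level]; nlinarith
    · rw [level_intCast, hv₂']; linarith

/-- The mirror situation: an odd site whose level is exactly m, between two even sites above M. Just
above λ the left well, occupied since the site on the left, is kept; just below it is left, and
re-entry has to wait until the level has climbed back to M. -/
lemma exists_lowMean_jump_of_atom_high (h : IsDoubleWell G m M pm pM)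
    (hg : IsBranches G m M pm pM g₁ g₃ g₄) (hβ : 0 < β) (hsup : SeparatedSupports c μ₁ μ₂)
    (hMβ : M < m + β) (hl : M < lam) {a : unitInterval} (ha : m + β * a = lam)
    (hμ : (μ₂ : Measure unitInterval) {a} ≠ 0) :
    ∃ κ > 0, ∀ l₁ l₂, β ≤ l₁ → l₁ < lam → lam < l₂ →
      lowMean g₁ g₃ m M β (alternatingLaw μ₁ μ₂) l₂ + κ ≤
        lowMean g₁ g₃ m M β (alternatingLaw μ₁ μ₂) l₁ := by
  have hU : siteLaw μ₁ μ₂ (1 + 1) {b : unitInterval | M < lam - β * b} ≠ 0 := by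
    rw [siteLaw_even _ _ (by decide)]
    exact measure_level_pos_of_M_lt hsup.zero_mem hl
  have hU' : siteLaw μ₁ μ₂ (1 - 1) {b : unitInterval | M < lam - β * b} ≠ 0 := by
    rw [siteLaw_even _ _ (by decide)]
    exact measure_level_pos_of_M_lt hsup.zero_mem hl
  have hUm : MeasurableSet {b : unitInterval | M < lam - β * b} :=
    measurableSet_lt measurable_const (by fun_prop)
  refine exists_lowMean_jump h hg hβ hMβ (i := 1) zero_le_one le_rfl hUm (measurableSet_singleton a)
    hUm hU' (by rwa [siteLaw_odd _ _ (by decide)]) hU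
    fun v hv₁ hv₂ hv₃ l₁ l₂ h1 h2 x hx => ?_
  have hd1 : (M - m) / β < 1 := by rw [div_lt_one hβ]; linarith
  have hv₁' : M < lam - β * v (1 - 1) := hv₁
  have hv₂' : v 1 = a := hv₂
  have hv₃' : M < lam - β * v (1 + 1) := hv₃
  have hx01 : x ∈ Icc ((1 : ℤ) : ℝ) ((1 : ℤ) + 1) :=
    ⟨hx.1.le, hx.2.le.trans (by gcongr)⟩
  have hxβ : β * (x - (1 : ℤ)) < M - m := by
    rw [mul_comm, ← lt_div_iff₀ hβ]; exact sub_left_lt_of_lt_add hx.2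
  have hpe := profile_eq v hx01
  have habs := (abs_le.1 (abs_profile_sub_le v hx01)).1
  have hdec : 0 ≤ (x - ((1 : ℤ) : ℝ)) * (v 1 - v (1 + 1)) := by
    refine mul_nonneg (sub_nonneg.2 hx01.1) ?_
    rw [hv₂']
    nlinarith [h.m_lt_M]
  rw [hv₂'] at hpe habs hdec
  constructor
  · rw [inLeftWell_level_iff hβ h.m_lt_M hx01]
    rintro ⟨-, hc | hc⟩
    · rw [level] at hc; nlinarith
    · have := hc.m_lt
      rw [level_intCast, hv₂'] at this
      linarith
  · rw [inLeftWell_level_iff hβ h.m_lt_M hx01, inLeftWell_level_intCast_rec hβ h.m_lt_M, hv₂']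
    refine ⟨?_, Or.inr ⟨by linarith, Or.inr (inLeftWell_of_le h.m_lt_M ?_)⟩⟩
    · rw [level]; nlinarith
    · rw [level_intCast]; linarith

end Jumps

end DoubleWellHJ

/-! ### The height function of a pair of mean slopes -/

namespace DoubleWellHJ

/-- The smallest height above `β` at which `θ` lies between the two mean slopes `φ` and `ψ`. -/
noncomputable def slopeHeight (φ ψ : ℝ → ℝ) (β θ : ℝ) : ℝ := sInf {l | β < l ∧ φ l ≤ θ ∧ θ ≤ ψ l}

lemma slopeHeight_le {φ ψ : ℝ → ℝ} {β l θ : ℝ} (hl : β < l) (h1 : φ l ≤ θ) (h2 : θ ≤ ψ l) :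
    slopeHeight φ ψ β θ ≤ l :=
  csInf_le ⟨β, fun _ ht => ht.1.le⟩ ⟨hl, h1, h2⟩

/-- Decreasing and increasing mean slopes, on both sides of the origin. -/
structure IsSlopePair (φ ψ : ℝ → ℝ) (β : ℝ) : Prop where
  anti : StrictAntiOn φ (Ici β)
  mono : StrictMono ψ
  cont : Continuous ψ
  nonpos : ∀ l, β ≤ l → φ l ≤ 0
  pos : ∃ κ > 0, ∀ l, β ≤ l → κ ≤ ψ l
  bot : ∀ K, ∃ L, ∀ l, L ≤ l → φ l ≤ K
  top : ∀ K, ∃ L, ∀ l, L ≤ l → K ≤ ψ l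

namespace IsSlopePair

variable {φ ψ : ℝ → ℝ} {β : ℝ} (h : IsSlopePair φ ψ β)

include h

lemma exists_mem (K : ℝ) : ∃ l, β < l ∧ φ l ≤ -K ∧ K ≤ ψ l := by
  obtain ⟨L₁, h₁⟩ := h.bot (-K)
  obtain ⟨L₂, h₂⟩ := h.top K
  refine ⟨max (β + 1) (max L₁ L₂), (lt_add_one β).trans_le (le_max_left _ _), h₁ _ ?_, h₂ _ ?_⟩
  · exact (le_max_left _ _).trans (le_max_right _ _)
  · exact (le_max_right _ _).trans (le_max_right _ _)

lemma le_slopeHeight (θ : ℝ) : β ≤ slopeHeight φ ψ β θ := by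
  obtain ⟨l, h1, h2, h3⟩ := h.exists_mem |θ|
  exact le_csInf ⟨l, h1, h2.trans (neg_abs_le θ), (le_abs_self θ).trans h3⟩ fun _ ht => ht.1.le

lemma mem_of_slopeHeight_lt {l θ : ℝ} (hl : slopeHeight φ ψ β θ < l) : φ l ≤ θ ∧ θ ≤ ψ l := by
  obtain ⟨l₀, h1, h2, h3⟩ := h.exists_mem |θ|
  obtain ⟨l', ⟨h4, h5, h6⟩, h7⟩ := exists_lt_of_csInf_lt
    (⟨l₀, h1, h2.trans (neg_abs_le θ), (le_abs_self θ).trans h3⟩ :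
      {l | β < l ∧ φ l ≤ θ ∧ θ ≤ ψ l}.Nonempty) hl
  exact ⟨(h.anti (mem_Ici.2 h4.le) (mem_Ici.2 (h4.le.trans h7.le)) h7).le.trans h5,
    h6.trans (h.mono h7).le⟩

lemma lt_or_lt_of_lt_slopeHeight {l θ : ℝ} (hl : β < l) (hlt : l < slopeHeight φ ψ β θ) :
    θ < φ l ∨ ψ l < θ := by
  by_contra! hc
  exact absurd (slopeHeight_le hl hc.1 hc.2) hlt.not_ge

lemma le_slopeHeight_of_lt_or_lt {l θ : ℝ} (ho : θ < φ l ∨ ψ l < θ) : l ≤ slopeHeight φ ψ β θ := by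
  by_contra! hc
  have := h.mem_of_slopeHeight_lt hc
  rcases ho with ho | ho <;> linarith

/-- Strict monotonicity turns the inequalities at l₀ + ε/4 into strict ones at l₀ + ε/2, and at l₀ -
ε/2 the slope lies strictly outside [φ, ψ]; both are open conditions. Jumps of φ do no harm, they
only produce flat pieces. -/
lemma continuous_slopeHeight : Continuous (slopeHeight φ ψ β) := by
  rw [Metric.continuous_iff']
  intro θ₀ ε hε
  set l₀ := slopeHeight φ ψ β θ₀
  have hβ := h.le_slopeHeight θ₀
  have hup : ∀ᶠ θ in 𝓝 θ₀, slopeHeight φ ψ β θ < l₀ + ε := by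
    obtain ⟨h1, h2⟩ := h.mem_of_slopeHeight_lt (show l₀ < l₀ + ε / 4 by linarith)
    have h3 : φ (l₀ + ε / 2) < θ₀ := (h.anti (mem_Ici.2 (by linarith)) (mem_Ici.2 (by linarith))
      (by linarith)).trans_le h1
    have h4 : θ₀ < ψ (l₀ + ε / 2) := h2.trans_lt (h.mono (by linarith))
    filter_upwards [lt_mem_nhds h3, gt_mem_nhds h4] with θ h5 h6
    exact (slopeHeight_le (by linarith) (le_of_lt h5) (le_of_lt h6)).trans_lt (by linarith)
  have hdown : ∀ᶠ θ in 𝓝 θ₀, l₀ - ε < slopeHeight φ ψ β θ := by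
    rcases le_or_gt l₀ (β + ε / 2) with hc | hc
    · exact Eventually.of_forall fun θ => by linarith [h.le_slopeHeight θ]
    · rcases h.lt_or_lt_of_lt_slopeHeight (l := l₀ - ε / 2) (θ := θ₀) (by linarith)
        (by linarith) with ho | ho
      · filter_upwards [gt_mem_nhds ho] with θ hθ
        linarith [h.le_slopeHeight_of_lt_or_lt (Or.inl hθ)]
      · filter_upwards [lt_mem_nhds ho] with θ hθ
        linarith [h.le_slopeHeight_of_lt_or_lt (Or.inr hθ)]
  filter_upwards [hup, hdown] with θ h1 h2
  rw [Real.dist_eq, abs_lt]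
  constructor <;> linarith

lemma tendsto_slopeHeight_atTop : Tendsto (slopeHeight φ ψ β) atTop atTop := by
  rw [tendsto_atTop]
  intro K
  filter_upwards [eventually_gt_atTop (ψ K)] with θ hθ
  exact h.le_slopeHeight_of_lt_or_lt (Or.inr hθ)

lemma tendsto_slopeHeight_atBot : Tendsto (slopeHeight φ ψ β) atBot atTop := by
  rw [tendsto_atTop]
  intro K
  filter_upwards [eventually_lt_atBot (φ K)] with θ hθ
  exact h.le_slopeHeight_of_lt_or_lt (Or.inl hθ)

/-- Slopes in (0, κ) lie between φ ≤ 0 and ψ ≥ κ at every height above β. -/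
lemma beta_mem_flatHeights : β ∈ flatHeights (slopeHeight φ ψ β) := by
  obtain ⟨κ, hκ, hψ⟩ := h.pos
  refine ⟨0, κ, hκ, fun θ hθ => le_antisymm ?_ (h.le_slopeHeight θ)⟩
  refine le_of_forall_gt_imp_ge_of_dense fun l hl => ?_
  exact slopeHeight_le hl ((h.nonpos l (le_of_lt hl)).trans hθ.1.le)
    (hθ.2.le.trans (hψ l (le_of_lt hl)))

lemma notMem_flatHeights_of_lt {l : ℝ} (hl : l < β) : l ∉ flatHeights (slopeHeight φ ψ β) := by
  rintro ⟨a, b, hab, hc⟩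
  have h1 := hc ((a + b) / 2) ⟨by linarith, by linarith⟩
  linarith [h.le_slopeHeight ((a + b) / 2)]

/-- With φ and ψ both continuous at l, a slope of height l must equal one of the two values φ l and
ψ l, and two values do not fill an interval. -/
lemma not_continuousAt_of_mem_flatHeights {l : ℝ} (hl : β < l)
    (hflat : l ∈ flatHeights (slopeHeight φ ψ β)) : ¬ContinuousAt φ l := by
  obtain ⟨κ, hκ, hψ⟩ := h.pos
  obtain ⟨a, b, hab, hc⟩ := hflat
  intro hcont
  have key : ∀ θ ∈ Ioo a b, θ = ψ l ∨ θ = φ l := by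
    intro θ hθ
    have hθl := hc θ hθ
    have h2 : ∀ l₂, l < l₂ → φ l₂ ≤ θ ∧ θ ≤ ψ l₂ := fun l₂ hl₂ =>
      h.mem_of_slopeHeight_lt (hθl.trans_lt hl₂)
    have h1 : ∀ l₁, β < l₁ → l₁ < l → θ < φ l₁ ∨ ψ l₁ < θ := fun l₁ h3 h4 =>
      h.lt_or_lt_of_lt_slopeHeight h3 (h4.trans_eq hθl.symm)
    have hev : ∀ᶠ l₁ in 𝓝[<] l, l₁ ∈ Ioo β l := Ioo_mem_nhdsLT hl
    rcases le_or_gt θ 0 with h0 | h0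
    · right
      refine le_antisymm ?_ ?_
      · refine ge_of_tendsto (hcont.tendsto.mono_left (nhdsWithin_le_nhds (s := Iio l))) ?_
        filter_upwards [hev] with l₁ h5
        rcases h1 l₁ h5.1 h5.2 with h6 | h6
        · exact h6.le
        · linarith [hψ l₁ h5.1.le]
      · refine le_of_tendsto (hcont.tendsto.mono_left (nhdsWithin_le_nhds (s := Ioi l))) ?_
        filter_upwards [self_mem_nhdsWithin] with l₂ h5 using (h2 l₂ h5).1
    · left
      refine le_antisymm ?_ ?_
      · refine ge_of_tendsto ((h.cont.tendsto l).mono_left (nhdsWithin_le_nhds (s := Ioi l))) ?_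
        filter_upwards [self_mem_nhdsWithin] with l₂ h5 using (h2 l₂ h5).2
      · refine le_of_tendsto ((h.cont.tendsto l).mono_left (nhdsWithin_le_nhds (s := Iio l))) ?_
        filter_upwards [hev] with l₁ h5
        rcases h1 l₁ h5.1 h5.2 with h6 | h6
        · linarith [h.nonpos l₁ h5.1.le]
        · exact h6.le
  -- Three distinct slopes, at most two admissible values.
  have k1 := key (a + (b - a) / 4) ⟨by linarith, by linarith⟩
  have k2 := key (a + (b - a) / 2) ⟨by linarith, by linarith⟩
  have k3 := key (a + 3 * (b - a) / 4) ⟨by linarith, by linarith⟩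
  rcases k1 with k1 | k1 <;> rcases k2 with k2 | k2 <;> rcases k3 with k3 | k3 <;> linarith

/-- The flat piece consists of slopes between the right limit of φ at l, which is `sSup s`, and that
limit plus κ. It lies below φ β ≤ 0, so the constraint by ψ is automatic. -/
lemma mem_flatHeights_of_jump {l κ : ℝ} (hl : β < l) (hκ : 0 < κ)
    (hj : ∀ l₁ l₂, β ≤ l₁ → l₁ < l → l < l₂ → φ l₂ + κ ≤ φ l₁) :
    l ∈ flatHeights (slopeHeight φ ψ β) := by
  obtain ⟨κ', hκ', hψ⟩ := h.pos
  set s := φ '' Ioi l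
  have hne : s.Nonempty := ⟨_, l + 1, by simp, rfl⟩
  have hbdd : BddAbove s := ⟨φ β, by
    rintro _ ⟨l₂, h2, rfl⟩
    linarith [hj β l₂ le_rfl hl h2]⟩
  have hup : ∀ l₁, β ≤ l₁ → l₁ < l → sSup s + κ ≤ φ l₁ := by
    intro l₁ h1 h2
    have : sSup s ≤ φ l₁ - κ := csSup_le hne (by
      rintro _ ⟨l₂, h3, rfl⟩
      linarith [hj l₁ l₂ h1 h2 h3])
    linarith
  refine ⟨sSup s, sSup s + κ, by linarith, fun θ hθ => le_antisymm ?_ ?_⟩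
  · refine le_of_forall_gt_imp_ge_of_dense fun l₂ h2 => ?_
    refine slopeHeight_le (hl.trans h2) ((le_csSup hbdd ⟨l₂, h2, rfl⟩).trans hθ.1.le) ?_
    have h3 := hup β le_rfl hl
    linarith [h.nonpos β le_rfl, hψ l₂ (hl.trans h2).le, hθ.2]
  · refine le_of_forall_lt_imp_le_of_dense fun l₁ h1 => ?_
    rcases lt_or_ge β l₁ with h2 | h2
    · exact h.le_slopeHeight_of_lt_or_lt (Or.inl (hθ.2.trans_le (hup l₁ h2.le h1)))
    · exact h2.trans (h.le_slopeHeight θ)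

end IsSlopePair

end DoubleWellHJ

/-! ### Correctors at every slope and the effective Hamiltonian -/

namespace DoubleWellHJ

lemma HasSmallGaps.mono {Z Z' : Set ℝ} (h : HasSmallGaps Z) (hZ : Z ⊆ Z') : HasSmallGaps Z' := by
  intro η hη
  obtain ⟨X₀, hX₀, h⟩ := h η hη
  refine ⟨X₀, hX₀, fun L hL x hx => ?_⟩
  obtain ⟨z, hz, hz'⟩ := h L hL x hx
  exact ⟨z, hZ hz, hz'⟩

lemma hasSmallGaps_univ : HasSmallGaps univ := fun η hη =>
  ⟨1, one_pos, fun L hL x _ => ⟨x, mem_univ _, le_rfl, by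
    have : 0 < η * L := by positivity
    linarith⟩⟩

lemma exists_slope_of_between {G W : ℝ → ℝ} {lam δ C θ₁ θ₂ θ : ℝ} {q₁ q₂ : ℝ → ℝ} {Z : Set ℝ}
    (hq₁ : Measurable q₁) (hq₂ : Measurable q₂) (hC₁ : ∀ x, |q₁ x| ≤ C) (hC₂ : ∀ x, |q₂ x| ≤ C)
    (hs₁ : IsSlope G W lam δ q₁) (hs₂ : IsSlope G W lam δ q₂)
    (hZ : ∀ z ∈ Z, ∃ p₁ p₂, Tendsto q₁ (𝓝 z) (𝓝 p₁) ∧ Tendsto q₂ (𝓝 z) (𝓝 p₂) ∧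
      ∀ p ∈ uIcc p₁ p₂, lam - δ ≤ G p + W z ∧ G p + W z ≤ lam + δ)
    (hm₁ : HasMean q₁ θ₁) (hm₂ : HasMean q₂ θ₂) (hgap : HasSmallGaps Z)
    (hθ : θ ∈ uIcc θ₁ θ₂) {η : ℝ} (hη : 0 < η) :
    ∃ X₀ > 0, ∀ L, X₀ ≤ L → ∃ q : ℝ → ℝ, Measurable q ∧ (∀ x, |q x| ≤ C) ∧
      IsSlope G W lam δ q ∧
      ∀ x, |x| ≤ L → |(∫ t in (0 : ℝ)..x, q t) - θ * x| ≤ η * L := by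
  rw [← segment_eq_uIcc, segment_eq_image'] at hθ
  obtain ⟨τ, hτ, rfl⟩ := hθ
  refine exists_interpolated_slope hq₁ hq₂ hC₁ hC₂ hs₁ hs₂ (fun z hz => ?_) (fun z hz => ?_) hm₁ hm₂
    hgap hτ.1 hτ.2 hη
  · obtain ⟨p₁, p₂, h1, h2, hp⟩ := hZ z hz
    exact ⟨p₁, p₂, h1.mono_left nhdsWithin_le_nhds, h2.mono_left nhdsWithin_le_nhds,
      fun p hp' => (hp p (Icc_subset_uIcc hp')).1, fun p hp' => (hp p (Icc_subset_uIcc' hp')).2⟩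
  · obtain ⟨p₁, p₂, h1, h2, hp⟩ := hZ z hz
    exact ⟨p₂, p₁, h2.mono_left nhdsWithin_le_nhds, h1.mono_left nhdsWithin_le_nhds,
      fun p hp' => (hp p (Icc_subset_uIcc' hp')).1, fun p hp' => (hp p (Icc_subset_uIcc hp')).2⟩

section Slopes

variable {G : ℝ → ℝ} {m M pm pM β : ℝ} {g₁ g₃ g₄ : ℝ → ℝ}

lemma isSlope_high (hg : IsBranches G m M pm pM g₁ g₃ g₄) {W : ℝ → ℝ} {lam : ℝ} (hW : Continuous W)
    (h0 : ∀ x, 0 ≤ lam - W x) : IsSlope G W lam 0 fun x => g₄ (lam - W x) := by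
  intro y
  have ht : Tendsto (fun x => g₄ (lam - W x)) (𝓝 y) (𝓝 (g₄ (lam - W y))) :=
    (hg.cont₄.comp (continuous_const.sub hW)).tendsto y
  refine ⟨_, _, ht.mono_left nhdsWithin_le_nhds, ht.mono_left nhdsWithin_le_nhds, ?_, ?_⟩
  · rw [Icc_self]
    rintro p rfl
    rw [hg.map₄ _ (h0 y)]; linarith
  · rw [Icc_self]
    rintro p rfl
    rw [hg.map₄ _ (h0 y)]; linarith

/-- Means are available almost surely only for countably many heights, hence the dense set `D`;
correctors of nearby heights are still good up to δ. At height β the two correctors of one height l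
> β are glued where the level is small. Above β the slope lies between φ(l₂) and φ(l₁), or between
ψ(l₁) and ψ(l₂), for l₁ < λ < l₂ in `D`, and two correctors of the same kind are glued. -/
lemma hasSlopes_profile (h : IsDoubleWell G m M pm pM) (hg : IsBranches G m M pm pM g₁ g₃ g₄)
    (hβ : 0 < β) (hm : 0 < m) (hMβ : M < m + β) {φ ψ : ℝ → ℝ} (hpair : IsSlopePair φ ψ β)
    {v : ℤ → unitInterval} {D : Set ℝ} (hD : Dense D)
    (hlow : ∀ l ∈ D, HasMean (wellSlope g₁ g₃ m M (level β l v)) (φ l))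
    (hhigh : ∀ l ∈ D, HasMean (fun x => g₄ (level β l v x)) (ψ l))
    (hgap₁ : ∀ δ > 0, HasSmallGaps {x | 1 - δ < profile v x})
    (hgap₀ : ∀ δ > 0, HasSmallGaps {x | profile v x < δ}) :
    HasSlopes G (fun x => β * profile v x) (slopeHeight φ ψ β) := by
  intro Θ
  obtain ⟨L₀, hL₀, hL₁, hL₂⟩ := hpair.exists_mem Θ
  obtain ⟨C, hC0, hC⟩ := hg.exists_bound 0 (L₀ + 1)
  refine ⟨C, hC0, fun θ hθ δ hδ => ?_⟩
  have hle : slopeHeight φ ψ β θ ≤ L₀ := slopeHeight_le hL₀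
    (hL₁.trans (abs_le.1 hθ).1) ((abs_le.1 hθ).2.trans hL₂)
  have hge := hpair.le_slopeHeight θ
  set lam := slopeHeight φ ψ β θ with hlam
  have hWc : Continuous fun x => β * profile v x := continuous_const.mul (continuous_profile v)
  have h0 : ∀ l, β ≤ l → ∀ x, 0 ≤ level β l v x := fun l hl x => by
    linarith [(level_mem (lam := l) (v := v) hβ x).1]
  have hbd : ∀ l, β ≤ l → l ≤ L₀ + 1 → ∀ x, level β l v x ∈ Icc 0 (L₀ + 1) := fun l hl hl' x =>
    ⟨h0 l hl x, (level_mem hβ x).2.trans hl'⟩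
  have hmLow : ∀ l, Measurable (wellSlope g₁ g₃ m M (level β l v)) := fun l =>
    measurable_section (measurable_wellSlope_level hg hβ h.m_lt_M) v
  have hmHigh : ∀ l, Measurable (fun x => g₄ (level β l v x)) := fun l =>
    measurable_section (measurable_high_level hg) v
  have hCLow : ∀ l, β ≤ l → l ≤ L₀ + 1 → ∀ x, |wellSlope g₁ g₃ m M (level β l v) x| ≤ C :=
    fun l hl hl' x => abs_wellSlope_le (hC _ (hbd l hl hl' x)).1 (hC _ (hbd l hl hl' x)).2.1
  have hCHigh : ∀ l, β ≤ l → l ≤ L₀ + 1 → ∀ x, |g₄ (level β l v x)| ≤ C :=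
    fun l hl hl' x => (hC _ (hbd l hl hl' x)).2.2
  have hsLow : ∀ l, β ≤ l → lam - δ ≤ l → l ≤ lam + δ →
      IsSlope G (fun x => β * profile v x) lam δ (wellSlope g₁ g₃ m M (level β l v)) :=
    fun l hl h1 h2 => (isSlope_wellSlope h hg hWc (h0 l hl)).mono (by linarith) (by linarith)
  have hsHigh : ∀ l, β ≤ l → lam - δ ≤ l → l ≤ lam + δ →
      IsSlope G (fun x => β * profile v x) lam δ (fun x => g₄ (level β l v x)) :=
    fun l hl h1 h2 => (isSlope_high hg hWc (h0 l hl)).mono (by linarith) (by linarith)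
  have hlW : ∀ l x, level β l v x + β * profile v x = l := fun l x => by rw [level]; ring
  rcases hge.eq_or_lt with heq | hgt
  · set ε := min (min (δ / 2) (m / 4)) 1
    have hε : 0 < ε := by positivity
    have hε1 : ε ≤ δ / 2 := (min_le_left _ _).trans (min_le_left _ _)
    have hε2 : ε ≤ m / 4 := (min_le_left _ _).trans (min_le_right _ _)
    have hε3 : ε ≤ 1 := min_le_right _ _
    obtain ⟨l, hlD, hl1, hl2⟩ := hD.exists_between (show β < β + ε by linarith)
    obtain ⟨hφ, hψ⟩ := hpair.mem_of_slopeHeight_lt (heq.symm.trans_lt hl1)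
    refine exists_slope_of_between (hmLow l) (hmHigh l) (hCLow l hl1.le (by linarith))
      (hCHigh l hl1.le (by linarith)) (hsLow l hl1.le (by linarith) (by linarith))
      (hsHigh l hl1.le (by linarith) (by linarith)) (Z := {x | 1 - ε / β < profile v x})
      (fun z hz => ?_) (hlow l hlD) (hhigh l hlD) (hgap₁ _ (by positivity))
      (Icc_subset_uIcc ⟨hφ, hψ⟩) hδ
    have hz' : level β l v z < 2 * ε := by
      have h1 : β * (1 - ε / β) < β * profile v z := mul_lt_mul_of_pos_left hz hβ
      have h2 : β * (1 - ε / β) = β - ε := by field_simp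
      rw [level]; linarith
    have hz0 := h0 l hl1.le z
    have hzm : level β l v z < m := by linarith
    have hzM : level β l v z ≤ M := by linarith [h.m_lt_M]
    refine ⟨_, _, tendsto_wellSlope_of_lt_m hg continuous_level hzm,
      (hg.cont₄.comp continuous_level).tendsto z, fun p hp => ?_⟩
    have h34 : g₃ (level β l v z) ≤ g₄ (level β l v z) :=
      (hg.mem₃ _ hz0 hzM).2.trans (hg.nonneg₄ _ hz0)
    have hp' : p ∈ Icc (g₃ (level β l v z)) (g₄ (level β l v z)) := by
      rwa [← uIcc_of_le h34]
    have h1 := hg.le_of_mem_three_four h hz0 hzM hp'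
    have h2 := h.nonneg p
    have h3 := hlW l z
    constructor <;> linarith
  · set ε := min δ 1
    have hε : 0 < ε := by positivity
    have hε1 : ε ≤ δ := min_le_left _ _
    have hε2 : ε ≤ 1 := min_le_right _ _
    have main : ∀ l₁ ∈ D, ∀ l₂ ∈ D, β < l₁ → lam - ε < l₁ → l₁ < lam → lam < l₂ → l₂ < lam + ε →
        (l₂ < m + β ∨ M < l₁) → ∃ X₀ > 0, ∀ L, X₀ ≤ L → ∃ q : ℝ → ℝ, Measurable q ∧
          (∀ x, |q x| ≤ C) ∧ IsSlope G (fun x => β * profile v x) lam δ q ∧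
          ∀ x, |x| ≤ L → |(∫ t in (0 : ℝ)..x, q t) - θ * x| ≤ δ * L := by
      intro l₁ hD₁ l₂ hD₂ hl1 hl2 hl3 hl4 hl5 hor
      have hl12 : l₁ ≤ l₂ := (hl3.trans hl4).le
      have hβ2 : β ≤ l₂ := hl1.le.trans hl12
      obtain ⟨hφ, hψ⟩ := hpair.mem_of_slopeHeight_lt hl4
      have hlev := level_le_level (β := β) hl12 v
      rcases hpair.lt_or_lt_of_lt_slopeHeight hl1 hl3 with ho | ho
      · have fin : ∀ Z : Set ℝ, HasSmallGaps Z → (∀ z ∈ Z, ∃ p₁ p₂,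
            Tendsto (wellSlope g₁ g₃ m M (level β l₁ v)) (𝓝 z) (𝓝 p₁) ∧
            Tendsto (wellSlope g₁ g₃ m M (level β l₂ v)) (𝓝 z) (𝓝 p₂) ∧
            ∀ p ∈ uIcc p₁ p₂, G p ∈ Icc (level β l₁ v z) (level β l₂ v z)) → _ := fun Z hZ hZs =>
          exists_slope_of_between (hmLow l₁) (hmLow l₂) (hCLow l₁ hl1.le (by linarith))
            (hCLow l₂ hβ2 (by linarith)) (hsLow l₁ hl1.le (by linarith) (by linarith))
            (hsLow l₂ hβ2 (by linarith) (by linarith)) (Z := Z)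
            (fun z hz => by
              obtain ⟨p₁, p₂, h1, h2, h3⟩ := hZs z hz
              refine ⟨p₁, p₂, h1, h2, fun p hp => ?_⟩
              have h4 := h3 p hp
              have h5 := hlW l₁ z
              have h6 := hlW l₂ z
              constructor <;> linarith [h4.1, h4.2])
            (hlow l₁ hD₁) (hlow l₂ hD₂) hZ (Icc_subset_uIcc' ⟨hφ, ho.le⟩) hδ
        rcases hor with hor | hor
        · refine fin {x | 1 - (m + β - l₂) / β < profile v x}
            (hgap₁ _ (div_pos (by linarith) hβ)) fun z hz => ?_
          have hz2 : level β l₂ v z < m := by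
            have h1 : β * (1 - (m + β - l₂) / β) < β * profile v z := mul_lt_mul_of_pos_left hz hβ
            have h2 : β * (1 - (m + β - l₂) / β) = l₂ - m := by field_simp; ring
            rw [level]; linarith
          refine ⟨_, _, tendsto_wellSlope_of_lt_m hg continuous_level ((hlev z).trans_lt hz2),
            tendsto_wellSlope_of_lt_m hg continuous_level hz2, fun p hp => ?_⟩
          rw [uIcc_of_ge (hg.anti₃.antitone (hlev z))] at hp
          exact hg.mem_Icc_of_mem_three h (h0 l₁ hl1.le z) (hlev z) (hz2.le.trans h.m_lt_M.le) hp
        · refine fin {x | profile v x < (l₁ - M) / β}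
            (hgap₀ _ (div_pos (by linarith) hβ)) fun z hz => ?_
          have hz1 : M < level β l₁ v z := by
            have h1 : β * profile v z < β * ((l₁ - M) / β) := mul_lt_mul_of_pos_left hz hβ
            have h2 : β * ((l₁ - M) / β) = l₁ - M := by field_simp
            rw [level]; linarith
          refine ⟨_, _, tendsto_wellSlope_of_M_lt hg h.m_lt_M continuous_level hz1,
            tendsto_wellSlope_of_M_lt hg h.m_lt_M continuous_level (hz1.trans_le (hlev z)),
            fun p hp => ?_⟩
          rw [uIcc_of_ge (hg.anti₁.antitone (hlev z))] at hp
          exact hg.mem_Icc_of_mem_one h (h.m_lt_M.le.trans hz1.le) (hlev z) hp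
      · refine exists_slope_of_between (hmHigh l₁) (hmHigh l₂) (hCHigh l₁ hl1.le (by linarith))
            (hCHigh l₂ hβ2 (by linarith)) (hsHigh l₁ hl1.le (by linarith) (by linarith))
            (hsHigh l₂ hβ2 (by linarith) (by linarith)) (Z := univ)
            (fun z _ => ⟨_, _, (hg.cont₄.comp continuous_level).tendsto z,
              (hg.cont₄.comp continuous_level).tendsto z, fun p hp => ?_⟩)
            (hhigh l₁ hD₁) (hhigh l₂ hD₂) hasSmallGaps_univ (Icc_subset_uIcc ⟨ho.le, hψ⟩) hδ
        have hp' : p ∈ Icc (g₄ (level β l₁ v z)) (g₄ (level β l₂ v z)) := by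
          rwa [← uIcc_of_le (hg.mono₄.monotone (hlev z))]
        have h4 := hg.mem_Icc_of_mem_four h (h0 l₁ hl1.le z) (hlev z) hp'
        have h5 := hlW l₁ z
        have h6 := hlW l₂ z
        constructor <;> linarith [h4.1, h4.2]
    -- Below m + β both hysteresis states are off the left well where the potential is near 1; from
    -- m + β on, which exceeds M, both are in the left well where it is near 0. One of the two kinds
    -- of common switching points is always available.
    rcases lt_or_ge lam (m + β) with hc | hc
    · obtain ⟨l₁, hD₁, h1, h2⟩ := hD.exists_between (max_lt hgt (show lam - ε < lam by linarith))
      obtain ⟨l₂, hD₂, h3, h4⟩ := hD.exists_between (lt_min hc (show lam < lam + ε by linarith))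
      exact main l₁ hD₁ l₂ hD₂ ((le_max_left _ _).trans_lt h1) ((le_max_right _ _).trans_lt h1) h2 h3
        (h4.trans_le (min_le_right _ _)) (Or.inl (h4.trans_le (min_le_left _ _)))
    · obtain ⟨l₁, hD₁, h1, h2⟩ := hD.exists_between
        (max_lt (max_lt hgt (show lam - ε < lam by linarith)) (hMβ.trans_le hc))
      obtain ⟨l₂, hD₂, h3, h4⟩ := hD.exists_between (show lam < lam + ε by linarith)
      have h5 := (le_max_left _ _).trans_lt h1
      exact main l₁ hD₁ l₂ hD₂ ((le_max_left _ _).trans_lt h5) ((le_max_right _ _).trans_lt h5) h2 h3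
        h4 (Or.inr ((le_max_right _ _).trans_lt h1))

variable {c : ℝ} {μ₁ μ₂ : ProbabilityMeasure unitInterval}

lemma isSlopePair_means (h : IsDoubleWell G m M pm pM) (hg : IsBranches G m M pm pM g₁ g₃ g₄)
    (hβ : 0 < β) (hsup : SeparatedSupports c μ₁ μ₂) :
    IsSlopePair (lowMean g₁ g₃ m M β (alternatingLaw μ₁ μ₂))
      (highMean g₄ β (alternatingLaw μ₁ μ₂)) β where
  anti := lowMean_strictAntiOn h hg hβ
  mono := highMean_strictMono hg hβ
  cont := continuous_highMean hg hβ
  nonpos _ hl := lowMean_nonpos h hg hβ hl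
  pos := exists_pos_le_highMean h hg hβ hsup.zero_mem
  bot := exists_lowMean_le h hg hβ
  top := exists_le_highMean hg hβ

/-- The effective Hamiltonian. -/
noncomputable def effHamiltonian (g₁ g₃ g₄ : ℝ → ℝ) (m M β : ℝ)
    (μ₁ μ₂ : ProbabilityMeasure unitInterval) : ℝ → ℝ :=
  slopeHeight (lowMean g₁ g₃ m M β (alternatingLaw μ₁ μ₂)) (highMean g₄ β (alternatingLaw μ₁ μ₂)) β

lemma ae_hasSlopes_alternatingLaw (h : IsDoubleWell G m M pm pM)
    (hg : IsBranches G m M pm pM g₁ g₃ g₄) (hβ : 0 < β) (hm : 0 < m) (hMβ : M < m + β)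
    (hsup : SeparatedSupports c μ₁ μ₂) :
    ∀ᵐ v ∂alternatingLaw μ₁ μ₂, HasSlopes G (fun x => β * profile v x)
      (effHamiltonian g₁ g₃ g₄ m M β μ₁ μ₂) := by
  obtain ⟨D, hDc, hD⟩ := TopologicalSpace.exists_countable_dense ℝ
  have h1 : ∀ᵐ v ∂alternatingLaw μ₁ μ₂, ∀ l ∈ D,
      HasMean (wellSlope g₁ g₃ m M (level β l v))
        (lowMean g₁ g₃ m M β (alternatingLaw μ₁ μ₂) l) :=
    (ae_ball_iff hDc).2 fun l _ => ae_hasMean_wellSlope hg hβ h.m_lt_M hsup hMβ l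
  have h2 : ∀ᵐ v ∂alternatingLaw μ₁ μ₂, ∀ l ∈ D, HasMean (fun x => g₄ (level β l v x))
        (highMean g₄ β (alternatingLaw μ₁ μ₂) l) :=
    (ae_ball_iff hDc).2 fun l _ => ae_hasMean_high hg hβ l
  have h3 : ∀ᵐ v ∂alternatingLaw μ₁ μ₂, ∀ n : ℕ, HasSmallGaps {x | 1 - 1 / (n + 1 : ℝ) < profile v x} :=
    ae_all_iff.2 fun n => ae_hasSmallGaps_high hsup (by positivity)
  have h4 : ∀ᵐ v ∂alternatingLaw μ₁ μ₂, ∀ n : ℕ, HasSmallGaps {x | profile v x < 1 / (n + 1 : ℝ)} :=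
    ae_all_iff.2 fun n => ae_hasSmallGaps_low hsup (by positivity)
  filter_upwards [h1, h2, h3, h4] with v h1 h2 h3 h4
  refine hasSlopes_profile h hg hβ hm hMβ (isSlopePair_means h hg hβ hsup) hD h1 h2
    (fun δ hδ => ?_) (fun δ hδ => ?_)
  · obtain ⟨n, hn⟩ := exists_nat_one_div_lt hδ
    exact (h3 n).mono fun x hx => lt_trans (by linarith) (show _ < profile v x from hx)
  · obtain ⟨n, hn⟩ := exists_nat_one_div_lt hδ
    exact (h4 n).mono fun x hx => lt_trans (show profile v x < _ from hx) hn

/-- The second outcome of the coin is the first one moved by one site, and effective slopes do not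
see translations; the same argument disposes of the uniform phase w. -/
lemma map_shift_alternatingLaw :
    (alternatingLaw μ₁ μ₂).map (shift 1) = alternatingLaw μ₂ μ₁ := by
  rw [alternatingLaw_eq, map_shift_infinitePi, alternatingLaw_eq]
  congr 1
  funext i
  by_cases hi : Even i
  · rw [siteLaw_even _ _ hi, siteLaw_odd _ _ (by rw [Int.even_add_one]; exact not_not.2 hi)]
  · rw [siteLaw_odd _ _ hi, siteLaw_even _ _ (by rw [Int.even_add_one]; exact hi)]

/-- Almost sure properties, measurable or not, are transported by the shift. -/
lemma ae_map_shift {p : (ℤ → unitInterval) → Prop} {ν : Measure (ℤ → unitInterval)} (n : ℤ)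
    (hp : ∀ᵐ v ∂ν, p v) : ∀ᵐ v ∂ν.map (shift n), p (shift (-n) v) := by
  have he : ∀ v, shift (-n) (shift n v) = v := fun v => by
    funext i
    simp [shift]
  have hq : Measure.QuasiMeasurePreserving (shift (-n)) (ν.map (shift n)) ν := by
    refine ⟨measurable_shift _, ?_⟩
    rw [Measure.map_map (measurable_shift _) (measurable_shift _)]
    have : shift (-n) ∘ shift n = id := funext he
    rw [this, Measure.map_id]
  exact hq.ae hp

lemma ae_hasSlopes_sampleLaw (h : IsDoubleWell G m M pm pM)
    (hg : IsBranches G m M pm pM g₁ g₃ g₄) (hβ : 0 < β) (hm : 0 < m) (hMβ : M < m + β)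
    (hsup : SeparatedSupports c μ₁ μ₂) :
    ∀ᵐ ω ∂sampleLaw μ₁ μ₂, HasSlopes G (fun x => β * potential x ω)
      (effHamiltonian g₁ g₃ g₄ m M β μ₁ μ₂) := by
  have hA := ae_hasSlopes_alternatingLaw h hg hβ hm hMβ hsup
  have hB : ∀ᵐ v ∂alternatingLaw μ₂ μ₁, HasSlopes G (fun x => β * profile v x)
      (effHamiltonian g₁ g₃ g₄ m M β μ₁ μ₂) := by
    rw [← map_shift_alternatingLaw]
    filter_upwards [ae_map_shift 1 hA] with v hv
    have := hv.translate 1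
    simp only [profile_shift] at this
    simpa [add_assoc] using this
  have hC : ∀ᵐ v ∂interlacedLaw μ₁ μ₂, HasSlopes G (fun x => β * profile v x)
      (effHamiltonian g₁ g₃ g₄ m M β μ₁ μ₂) := by
    rw [interlacedLaw, ae_add_measure_iff]
    exact ⟨Measure.ae_smul_measure hA _, Measure.ae_smul_measure hB _⟩
  have hfin : ∀ ν : Measure (ℤ → unitInterval), [IsFiniteMeasure ν] →
      IsFiniteMeasure ((2⁻¹ : ℝ≥0∞) • ν) := fun ν _ => Measure.smul_finite ν (by simp)
  have := hfin (alternatingLaw μ₁ μ₂)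
  have := hfin (alternatingLaw μ₂ μ₁)
  have : SFinite (interlacedLaw μ₁ μ₂) := by unfold interlacedLaw; infer_instance
  have hD : ∀ᵐ ω ∂sampleLaw μ₁ μ₂, HasSlopes G (fun x => β * profile ω.2 x)
      (effHamiltonian g₁ g₃ g₄ m M β μ₁ μ₂) :=
    Measure.quasiMeasurePreserving_snd.ae hC
  filter_upwards [hD] with ω hω
  exact hω.translate (ω.1 : ℝ)

lemma isEffectiveHamiltonian_effHamiltonian (h : IsDoubleWell G m M pm pM)
    (hg : IsBranches G m M pm pM g₁ g₃ g₄) (hβ : 0 < β) (hm : 0 < m) (hMβ : M < m + β)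
    (hsup : SeparatedSupports c μ₁ μ₂) :
    IsEffectiveHamiltonian (sampleLaw μ₁ μ₂) G β potential
      (effHamiltonian g₁ g₃ g₄ m M β μ₁ μ₂) where
  continuous := (isSlopePair_means h hg hβ hsup).continuous_slopeHeight
  coercive_top := (isSlopePair_means h hg hβ hsup).tendsto_slopeHeight_atTop
  coercive_bot := (isSlopePair_means h hg hβ hsup).tendsto_slopeHeight_atBot
  homogenizes := by
    filter_upwards [ae_hasSlopes_sampleLaw h hg hβ hm hMβ hsup] with ω hω g _ u hu ubar hubar
    have hc : Continuous fun x => potential x ω :=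
      (continuous_profile ω.2).comp (continuous_add_const (ω.1 : ℝ))
    refine hω.homogenizes h.continuous (continuous_const.mul hc) (Wb := β) (fun x => ?_) hu hubar
    have := profile_mem ω.2 (x + (ω.1 : ℝ))
    rw [abs_mul, abs_of_pos hβ]
    refine mul_le_of_le_one_right hβ.le ?_
    exact abs_le.2 ⟨by linarith [this.1, show potential x ω = profile ω.2 (x + (ω.1 : ℝ)) from rfl], this.2⟩

/-- The flat pieces of the effective Hamiltonian above the height `β`. -/
lemma flatHeights_effHamiltonian (h : IsDoubleWell G m M pm pM)
    (hg : IsBranches G m M pm pM g₁ g₃ g₄) (hβ : 0 < β) (hMβ : M < m + β)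
    (hsup : SeparatedSupports c μ₁ μ₂) :
    flatHeights (effHamiltonian g₁ g₃ g₄ m M β μ₁ μ₂) = {β} ∪ {l | β < l ∧
      ((l < m + β ∧ ∃ a ∈ atoms μ₁, M + β * a = l) ∨ (M < l ∧ ∃ a ∈ atoms μ₂, m + β * a = l))} := by
  have hp := isSlopePair_means h hg hβ hsup
  ext l
  rcases lt_trichotomy l β with hl | rfl | hl
  · refine iff_of_false (hp.notMem_flatHeights_of_lt hl) ?_
    rintro (rfl | hc)
    · exact lt_irrefl _ hl
    · exact hl.not_gt hc.1
  · exact iff_of_true hp.beta_mem_flatHeights (Or.inl rfl)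
  · constructor
    · intro hf
      refine Or.inr ⟨hl, ?_⟩
      by_contra! hc
      refine hp.not_continuousAt_of_mem_flatHeights hl hf (continuousAt_lowMean h hg hβ hsup hMβ
        (fun h1 a ha => ?_) (fun h1 a ha => ?_))
      · by_contra hne
        exact hc.1 h1 a ⟨a, hne, rfl⟩ ha
      · by_contra hne
        exact hc.2 h1 a ⟨a, hne, rfl⟩ ha
    · rintro (rfl | ⟨-, ⟨h1, _, ⟨a, ha, rfl⟩, hal⟩ | ⟨h1, _, ⟨a, ha, rfl⟩, hal⟩⟩)
      · exact absurd hl (lt_irrefl _)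
      · obtain ⟨κ, hκ, hj⟩ := exists_lowMean_jump_of_atom_low h hg hβ hsup hMβ h1 hal ha
        exact hp.mem_flatHeights_of_jump hl hκ hj
      · obtain ⟨κ, hκ, hj⟩ := exists_lowMean_jump_of_atom_high h hg hβ hsup hMβ h1 hal ha
        exact hp.mem_flatHeights_of_jump hl hκ hj

end Slopes

end DoubleWellHJ

/-! ### Measures with prescribed atoms -/

namespace DoubleWellHJ

/-- Lebesgue measure on `K` puts x into the support without creating atoms; summable positive
weights on `A` add exactly the atoms wanted. The sum is then normalised. -/
lemma exists_probabilityMeasure_atoms {K A : Set unitInterval} (hK : IsClosed K) {x : unitInterval}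
    (hx : x ∈ interior K) (hA : A.Countable) (hAK : A ⊆ K) :
    ∃ μ : ProbabilityMeasure unitInterval, (∀ a, (μ : Measure unitInterval) {a} ≠ 0 ↔ a ∈ A) ∧
      (μ : Measure unitInterval).support ⊆ K ∧ x ∈ (μ : Measure unitInterval).support := by
  have := hA.to_subtype
  obtain ⟨w, hw0, hw1⟩ := ENNReal.exists_pos_sum_of_countable' (ε := 1) one_ne_zero A
  set ρ : Measure unitInterval :=
    volume.restrict K + Measure.sum fun a : A => w a • Measure.dirac (a : unitInterval)
  have happ : ∀ s, MeasurableSet s → ρ s =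
      volume (s ∩ K) + ∑' a : A, w a * s.indicator 1 (a : unitInterval) := fun s hs => by
    rw [Measure.add_apply, Measure.restrict_apply hs, Measure.sum_apply _ hs]
    simp only [Measure.smul_apply, smul_eq_mul, Measure.dirac_apply' _ hs]
  have hfin : IsFiniteMeasure ρ := by
    refine ⟨?_⟩
    rw [happ _ MeasurableSet.univ]
    refine ENNReal.add_lt_top.2 ⟨measure_lt_top _ _, ?_⟩
    simpa using hw1.trans ENNReal.one_lt_top
  have hpos : ∀ U ∈ 𝓝 x, 0 < ρ U := by
    intro U hU
    have h1 : 0 < volume (interior U ∩ interior K) := by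
      obtain ⟨a, b, hab, hsub⟩ := (isOpen_interior.inter isOpen_interior).exists_Ioo_subset
        ⟨x, mem_interior_iff_mem_nhds.2 hU, hx⟩
      refine lt_of_lt_of_le ?_ (measure_mono hsub)
      rw [unitInterval.volume_Ioo, ENNReal.ofReal_pos, sub_pos]
      exact hab
    have h2 : volume (interior U ∩ interior K) ≤ ρ (interior U) := by
      rw [happ _ isOpen_interior.measurableSet]
      exact (measure_mono (inter_subset_inter_right _ interior_subset)).trans le_self_add
    exact h1.trans_le (h2.trans (measure_mono interior_subset))
  have hne : NeZero ρ := ⟨fun h0 => by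
    have := hpos univ univ_mem
    rw [h0] at this
    simp at this⟩
  let μ : ProbabilityMeasure unitInterval := ⟨(ρ univ)⁻¹ • ρ, inferInstance⟩
  have hμ : ∀ s, (μ : Measure unitInterval) s = (ρ univ)⁻¹ * ρ s := fun s => rfl
  have hc : (ρ univ)⁻¹ ≠ 0 := ENNReal.inv_ne_zero.2 (measure_ne_top _ _)
  refine ⟨μ, fun a => ?_, ?_, ?_⟩
  · rw [hμ, mul_ne_zero_iff, happ _ (measurableSet_singleton a)]
    have h0 : volume ({a} ∩ K) = 0 := measure_mono_null inter_subset_left (measure_singleton a)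
    rw [h0, zero_add]
    constructor
    · rintro ⟨-, h1⟩
      obtain ⟨b, hb⟩ : ∃ b : A, w b * ({a} : Set unitInterval).indicator 1 (b : unitInterval) ≠ 0 := by
        by_contra! hcon
        exact h1 (ENNReal.tsum_eq_zero.2 hcon)
      have hba : (b : unitInterval) = a := by
        by_contra hba
        exact hb (by simp [hba])
      exact hba ▸ b.2
    · refine fun ha => ⟨hc, fun h1 => ?_⟩
      have := ENNReal.tsum_eq_zero.1 h1 ⟨a, ha⟩
      simp [(hw0 ⟨a, ha⟩).ne'] at this
  · refine Measure.support_subset_of_isClosed hK ?_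
    rw [mem_ae_iff, hμ, happ _ hK.measurableSet.compl, compl_inter_self, measure_empty, zero_add]
    refine mul_eq_zero.2 (Or.inr (ENNReal.tsum_eq_zero.2 fun a => ?_))
    simp [hAK a.2]
  · rw [Measure.mem_support_iff_forall]
    intro U hU
    rw [hμ]
    exact ENNReal.mul_pos hc (hpos U hU).ne'

/-- With d = (M - m)/β one has M + β(1 - d)/2 = m + β(1 + d)/2. Heights of `S` up to this common
value become atoms of μ₁ in [0, (1 - d)/2], the others atoms of μ₂ in [(1 + d)/2, 1], and d > 0
separates the supports around 1/2. -/
lemma exists_separatedSupports {m M β : ℝ} (hβ : 0 < β) (hmM : m < M) (hMβ : M < m + β)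
    {S : Set ℝ} (hS : S.Countable) (hSsub : S ⊆ {β} ∪ Icc (max β M) (m + β)) :
    ∃ (c : ℝ) (μ₁ μ₂ : ProbabilityMeasure unitInterval), SeparatedSupports c μ₁ μ₂ ∧
      ∀ l, β < l → (((l < m + β ∧ ∃ a ∈ atoms μ₁, M + β * a = l) ∨
        (M < l ∧ ∃ a ∈ atoms μ₂, m + β * a = l)) ↔ l ∈ S) := by
  set d := (M - m) / β
  have hd : 0 < d := div_pos (sub_pos.2 hmM) hβ
  have hd1 : d < 1 := by rw [div_lt_one hβ]; linarith
  have hdβ : β * d = M - m := by simp only [d]; field_simp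
  have hcount : ∀ t, {a : unitInterval | t + β * a ∈ S}.Countable := fun t =>
    hS.preimage_of_injOn (f := fun a : unitInterval => t + β * (a : ℝ)) fun a _ b _ hab =>
      Subtype.ext (mul_left_cancel₀ hβ.ne' (add_left_cancel hab))
  obtain ⟨μ₁, hA₁, hs₁, h0⟩ := exists_probabilityMeasure_atoms
    (K := {a : unitInterval | (a : ℝ) ≤ (1 - d) / 2})
    (A := {a : unitInterval | M + β * a ∈ S} ∩ {a : unitInterval | (a : ℝ) ≤ (1 - d) / 2})
    (isClosed_le continuous_subtype_val continuous_const) (x := 0)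
    (mem_interior.2 ⟨{a : unitInterval | (a : ℝ) < (1 - d) / 2}, fun a ha => le_of_lt (α := ℝ) ha,
      isOpen_lt continuous_subtype_val continuous_const,
      show ((0 : unitInterval) : ℝ) < (1 - d) / 2 by rw [Icc.coe_zero]; linarith⟩)
    ((hcount M).mono inter_subset_left) inter_subset_right
  obtain ⟨μ₂, hA₂, hs₂, h1⟩ := exists_probabilityMeasure_atoms
    (K := {a : unitInterval | (1 + d) / 2 ≤ (a : ℝ)})
    (A := {a : unitInterval | m + β * a ∈ S} ∩ {a : unitInterval | (1 + d) / 2 ≤ (a : ℝ)})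
    (isClosed_le continuous_const continuous_subtype_val) (x := 1)
    (mem_interior.2 ⟨{a : unitInterval | (1 + d) / 2 < (a : ℝ)}, fun a ha => le_of_lt (α := ℝ) ha,
      isOpen_lt continuous_const continuous_subtype_val,
      show (1 + d) / 2 < ((1 : unitInterval) : ℝ) by rw [Icc.coe_one]; linarith⟩)
    ((hcount m).mono inter_subset_left) inter_subset_right
  refine ⟨1 / 2, μ₁, μ₂, ⟨by norm_num, h0, fun v hv => ?_, h1, fun v hv => ?_⟩, fun l hl => ?_⟩
  · have : (v : ℝ) ≤ (1 - d) / 2 := hs₁ hv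
    linarith
  · have : (1 + d) / 2 ≤ (v : ℝ) := hs₂ hv
    linarith
  · constructor
    · rintro (⟨-, _, ⟨a, ha, rfl⟩, rfl⟩ | ⟨-, _, ⟨a, ha, rfl⟩, rfl⟩)
      · exact ((hA₁ a).1 ha).1
      · exact ((hA₂ a).1 ha).1
    · intro hlS
      have hlm : max β M ≤ l ∧ l ≤ m + β := by
        rcases hSsub hlS with h | h
        · exact absurd h hl.ne'
        · exact h
      have hM := (le_max_right _ _).trans hlm.1
      rcases le_total l (M + β * ((1 - d) / 2)) with hc | hc
      · have h1 : β * ((l - M) / β) = l - M := by field_simp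
        have h2 : (l - M) / β ≤ (1 - d) / 2 := by rw [div_le_iff₀ hβ]; linarith
        have h3 : 0 ≤ (l - M) / β := div_nonneg (by linarith) hβ.le
        refine Or.inl ⟨by nlinarith, (l - M) / β,
          ⟨⟨(l - M) / β, h3, by linarith⟩, (hA₁ _).2 ⟨?_, h2⟩, rfl⟩, by linarith⟩
        rw [mem_ofPred_eq, h1, add_sub_cancel]
        exact hlS
      · have h1 : β * ((l - m) / β) = l - m := by field_simp
        have h2 : (1 + d) / 2 ≤ (l - m) / β := by rw [le_div_iff₀ hβ]; linarith
        have h3 : (l - m) / β ≤ 1 := by rw [div_le_one hβ]; linarith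
        refine Or.inr ⟨by nlinarith, (l - m) / β,
          ⟨⟨(l - m) / β, by linarith, h3⟩, (hA₂ _).2 ⟨?_, h2⟩, rfl⟩, by linarith⟩
        rw [mem_ofPred_eq, h1, add_sub_cancel]
        exact hlS

end DoubleWellHJ

/-! ### Conclusion -/

theorem mainTheorem6 (G : ℝ → ℝ) (m M pm pM β : ℝ)
    (hG : DoubleWellHJ.IsDoubleWell G m M pm pM) (hβ : 0 < β) (hlt : max β M < m + β) :
    (∀ (c : ℝ) (μ₁ μ₂ : ProbabilityMeasure unitInterval),
      DoubleWellHJ.SeparatedSupports c μ₁ μ₂ →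
      ∃ H : ℝ → ℝ,
        DoubleWellHJ.IsEffectiveHamiltonian (DoubleWellHJ.sampleLaw μ₁ μ₂) G β
          DoubleWellHJ.potential H ∧
        DoubleWellHJ.flatHeights H ∩ Ioo (max β M) (m + β) =
          ((fun a => M + β * a) '' DoubleWellHJ.atoms μ₁ ∪
            (fun a => m + β * a) '' DoubleWellHJ.atoms μ₂) ∩ Ioo (max β M) (m + β)) ∧
    (∀ S : Set ℝ, S.Countable → S ⊆ Ioo (max β M) (m + β) →
      ∃ (c : ℝ) (μ₁ μ₂ : ProbabilityMeasure unitInterval) (H : ℝ → ℝ),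
        DoubleWellHJ.SeparatedSupports c μ₁ μ₂ ∧
        DoubleWellHJ.IsEffectiveHamiltonian (DoubleWellHJ.sampleLaw μ₁ μ₂) G β
          DoubleWellHJ.potential H ∧
        DoubleWellHJ.flatHeights H ∩ Ioo (max β M) (m + β) = S) ∧
    (∀ S : Set ℝ, S.Countable → S ⊆ {β} ∪ Icc (max β M) (m + β) → β ∈ S →
      ∃ (c : ℝ) (μ₁ μ₂ : ProbabilityMeasure unitInterval) (H : ℝ → ℝ),
        DoubleWellHJ.SeparatedSupports c μ₁ μ₂ ∧
        DoubleWellHJ.IsEffectiveHamiltonian (DoubleWellHJ.sampleLaw μ₁ μ₂) G β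
          DoubleWellHJ.potential H ∧
        DoubleWellHJ.flatHeights H = S) := by
  have hMβ : M < m + β := (le_max_right _ _).trans_lt hlt
  -- The hypothesis contains β < m + β, so the left well lies strictly above the absolute minimum.
  have hm : 0 < m := by linarith [le_max_left β M]
  obtain ⟨g₁, g₃, g₄, hg⟩ := hG.exists_branches
  have hfl := fun {c : ℝ} {μ₁ μ₂ : ProbabilityMeasure unitInterval}
    (hsup : DoubleWellHJ.SeparatedSupports c μ₁ μ₂) =>
    DoubleWellHJ.flatHeights_effHamiltonian hG hg hβ hMβ hsup
  -- Both realisation statements come from one construction: β is always a flat height, and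
  -- intersecting with the open interval discards it.
  have hflS : ∀ S : Set ℝ, S.Countable → S ⊆ {β} ∪ Icc (max β M) (m + β) →
      ∃ (c : ℝ) (μ₁ μ₂ : ProbabilityMeasure unitInterval) (H : ℝ → ℝ),
        DoubleWellHJ.SeparatedSupports c μ₁ μ₂ ∧
        DoubleWellHJ.IsEffectiveHamiltonian (DoubleWellHJ.sampleLaw μ₁ μ₂) G β
          DoubleWellHJ.potential H ∧
        DoubleWellHJ.flatHeights H = {β} ∪ S := by
    intro S hS hsub
    obtain ⟨c, μ₁, μ₂, hsup, hiff⟩ :=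
      DoubleWellHJ.exists_separatedSupports hβ hG.m_lt_M hMβ hS hsub
    refine ⟨c, μ₁, μ₂, _, hsup,
      DoubleWellHJ.isEffectiveHamiltonian_effHamiltonian hG hg hβ hm hMβ hsup, ?_⟩
    rw [hfl hsup]
    ext l
    constructor
    · rintro (h | ⟨h1, h2⟩)
      · exact Or.inl h
      · exact Or.inr ((hiff l h1).1 h2)
    · rintro (h | h)
      · exact Or.inl h
      · rcases hsub h with h' | h'
        · exact Or.inl h'
        · rcases ((le_max_left β M).trans h'.1).eq_or_lt with he | hβl
          · exact Or.inl he.symm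
          · exact Or.inr ⟨hβl, (hiff l hβl).2 h⟩
  refine ⟨fun c μ₁ μ₂ hsup => ⟨_,
    DoubleWellHJ.isEffectiveHamiltonian_effHamiltonian hG hg hβ hm hMβ hsup, ?_⟩, ?_, ?_⟩
  · rw [hfl hsup]
    ext l
    constructor
    · rintro ⟨h | ⟨-, ⟨-, a, ha, hl⟩ | ⟨-, a, ha, hl⟩⟩, hI⟩
      · exact absurd (h ▸ (le_max_left β M).trans_lt hI.1) (lt_irrefl β)
      · exact ⟨Or.inl ⟨a, ha, hl⟩, hI⟩
      · exact ⟨Or.inr ⟨a, ha, hl⟩, hI⟩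
    · rintro ⟨⟨a, ha, hl⟩ | ⟨a, ha, hl⟩, hI⟩
      · exact ⟨Or.inr ⟨(le_max_left _ _).trans_lt hI.1, Or.inl ⟨hI.2, a, ha, hl⟩⟩, hI⟩
      · exact ⟨Or.inr ⟨(le_max_left _ _).trans_lt hI.1,
          Or.inr ⟨(le_max_right _ _).trans_lt hI.1, a, ha, hl⟩⟩, hI⟩
  · intro S hS hsub
    obtain ⟨c, μ₁, μ₂, H, hsup, hH, hflat⟩ :=
      hflS S hS fun l hl => Or.inr ⟨(hsub hl).1.le, (hsub hl).2.le⟩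
    refine ⟨c, μ₁, μ₂, H, hsup, hH, ?_⟩
    rw [hflat]
    ext l
    constructor
    · rintro ⟨h | h, hI⟩
      · exact absurd (h ▸ (le_max_left β M).trans_lt hI.1) (lt_irrefl β)
      · exact h
    · exact fun h => ⟨Or.inr h, hsub h⟩
  · intro S hS hsub hβS
    obtain ⟨c, μ₁, μ₂, H, hsup, hH, hflat⟩ := hflS S hS hsub
    refine ⟨c, μ₁, μ₂, H, hsup, hH, ?_⟩
    rw [hflat, singleton_union, insert_eq_of_mem hβS]
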